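/- All vector spaces and algebras are over $\mathbb{C}$. "Superalgebra" means $\mathbb{Z}_2$-graded, $[x,y]=xy-(-1)^{|x||y|}yx$ is the supercommutator of an associative superalgebra, $\otimes$ is the tensor product of superalgebras, $(a\otimes b)(a'\otimes b')=(-1)^{|b||a'|}aa'\otimes bb'$, and $U(\mathfrak a)$ is the universal enveloping algebra of a Lie superalgebra $\mathfrak a$. Let $\bar{\mathfrak s}$ be the centreless $N=1$ Ramond algebra: the Lie superalgebra with even basis vectors $L_n$, odd basis vectors $G_n$ ($n\in\mathbb{Z}$) and brackets $$[L_m,L_n]=(n-m)L_{m+n},\quad [L_m,G_p]=(p-\tfrac m2)G_{m+p},\quad [G_p,G_q]=-2L_{p+q}.$$ Let $A=\mathbb{C}[t^{\pm1}]\otimes\Lambda(1)$ with $\Lambda(1)$ the Grassmann algebra in one odd variable $\xi$. It is an $\bar{\mathfrak s}$-module via $$L_n\circ x=t^{n+1}\partial_t(x)+\tfrac n2t^n\xi\,\partial_\xi(x),\qquad G_n\circ x=t^{n+1}\xi\,\partial_t(x)-t^n\partial_\xi(x).$$ Let $\widetilde{\mathfrak s}=\bar{\mathfrak s}\ltimes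 A$ be the semidirect product in which $A$ is abelian and $[x,y]=x\circ y$ for $x\in\bar{\mathfrak s}$, $y\in A$. Let $I$ be the left ideal of $U(\widetilde{\mathfrak s})$ generated by $t^i\cdot t^j-t^{i+j}$, $t^0-1$, $t^i\cdot\xi-t^i\xi$ and $\xi\cdot\xi$ ($i,j\in\mathbb{Z}$), where the dot is the product of $U(\widetilde{\mathfrak s})$. It is a two-sided ideal, and $\overline U=U(\widetilde{\mathfrak s})/I$ is an associative superalgebra. Let $\mathcal T\subset\overline U$ be the span of the elements $$X_m=t^{-m}\cdot L_m+\tfrac m2t^{-m}\xi\cdot G_m-L_0,\qquad Y_m=t^{-m}\cdot G_m-2t^{-m}\xi\cdot L_m-G_0+2\xi\cdot L_0\qquad(m\in\mathbb{Z}\setminus\{0\}).$$ It is a Lie subsuperalgebra of $\overline U$ under the supercommutator. Let $(t-1)\bar{\mathfrak s}\subset\bar{\mathfrak s}$ be the Lie subsuperalgebra that is the image of multiplication by $t-1$, where $tL_n=L_{n+1}$ and $tG_n=G_{n+1}$. Let $\mathcal K=A[\partial_t,\partial_\xi]$ be the Weyl superalgebra, generated by even $t,t^{-1},\partial_t$ and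 odd $\xi,\partial_\xi$, where $t$ and $t^{-1}$ are mutually inverse, $\xi^2=\partial_\xi^2=0$, and $t,\xi,\partial_t,\partial_\xi$ pairwise supercommute except that $[\partial_t,t]=1$ and $[\partial_\xi,\xi]=1$. **Proposition 3.2.** There is an isomorphism of associative superalgebras $\overline U\cong\mathcal K\otimes U(\mathcal T)$. Here $\mathcal T\cong(t-1)\bar{\mathfrak s}$ as Lie superalgebras. -/

import Mathlib

open scoped TensorProduct LaurentPolynomial

noncomputable section

/-- The Koszul sign `(-1)^{|x||y|}` for parities `i = |x|`, `j = |y|`. -/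
def koszul (i j : ZMod 2) : ℂ := (-1) ^ (i * j).val

theorem koszul_zero_left (j : ZMod 2) : koszul 0 j = 1 := by simp [koszul]

theorem koszul_zero_right (i : ZMod 2) : koszul i 0 = 1 := by simp [koszul]

theorem koszul_one_one : koszul 1 1 = -1 := by simp [koszul, ZMod.val_one]

theorem parity_cases (i : ZMod 2) : i = 0 ∨ i = 1 := by
  revert i; decide

/-! ### Lie superalgebras over `ℂ` -/

/-- A Lie superalgebra over `ℂ`: a vector space `L = L₀ ⊕ L₁` with an even bilinear bracket that is
super skew-symmetric and satisfies the super Jacobi identity. -/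
class LieSuperalgebra (L : Type) [AddCommGroup L] [Module ℂ L] where
  /-- the homogeneous component of each parity -/
  part : ZMod 2 → Submodule ℂ L
  isCompl : IsCompl (part 0) (part 1)
  /-- the super bracket -/
  bracket : L →ₗ[ℂ] L →ₗ[ℂ] L
  bracket_mem : ∀ (i j : ZMod 2) (x y : L), x ∈ part i → y ∈ part j → bracket x y ∈ part (i + j)
  skew : ∀ (i j : ZMod 2) (x y : L), x ∈ part i → y ∈ part j →
    bracket x y = -(koszul i j • bracket y x)
  jacobi : ∀ (i j : ZMod 2) (x y z : L), x ∈ part i → y ∈ part j →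
    bracket x (bracket y z) = bracket (bracket x y) z + koszul i j • bracket y (bracket x z)

/-- Isomorphisms of Lie superalgebras: even linear bijections preserving the bracket. -/
structure LieSuperEquiv (L M : Type) [AddCommGroup L] [Module ℂ L] [LieSuperalgebra L]
    [AddCommGroup M] [Module ℂ M] [LieSuperalgebra M] extends L ≃ₗ[ℂ] M where
  map_part : ∀ (i : ZMod 2) (x : L),
    x ∈ LieSuperalgebra.part i ↔ toLinearEquiv x ∈ LieSuperalgebra.part (L := M) i
  map_bracket : ∀ x y : L, toLinearEquiv (LieSuperalgebra.bracket x y) =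
    LieSuperalgebra.bracket (toLinearEquiv x) (toLinearEquiv y)

namespace LieSuperalgebra

section
variable (L : Type) [AddCommGroup L] [Module ℂ L] [LieSuperalgebra L]

/-- The parity map `x ↦ (-1)^{|x|} x`. -/
def parity : L →ₗ[ℂ] L :=
  (part (L := L) 0).projection (part 1) isCompl - (part (L := L) 1).projection (part 0) isCompl.symm

variable {L}

theorem parity_even {x : L} (hx : x ∈ part 0) : parity L x = x := by
  have h1 := Submodule.projection_apply_of_mem_left (isCompl (L := L)) hx
  have h2 := Submodule.projection_apply_of_mem_right (isCompl (L := L)).symm hx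
  simp only [parity, LinearMap.sub_apply, h1, h2, sub_zero]

theorem parity_odd {x : L} (hx : x ∈ part 1) : parity L x = -x := by
  have h1 := Submodule.projection_apply_of_mem_left (isCompl (L := L)).symm hx
  have h2 := Submodule.projection_apply_of_mem_right (isCompl (L := L)) hx
  simp only [parity, LinearMap.sub_apply, h1, h2, zero_sub]

theorem parity_of_mem {i : ZMod 2} {x : L} (hx : x ∈ part i) :
    parity L x = ((-1 : ℂ) ^ i.val) • x := by
  rcases parity_cases i with rfl | rfl
  · simpa using parity_even hx
  · simpa [ZMod.val_one] using parity_odd hx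

theorem exists_add (x : L) : ∃ y ∈ part (L := L) 0, ∃ z ∈ part (L := L) 1, y + z = x := by
  have h : x ∈ part (L := L) 0 ⊔ part 1 := by rw [isCompl.sup_eq_top]; trivial
  exact Submodule.mem_sup.1 h

theorem parity_parity (x : L) : parity L (parity L x) = x := by
  obtain ⟨y, hy, z, hz, rfl⟩ := exists_add x
  simp [parity_even hy, parity_odd hz]

/-- A graded subspace closed under the bracket is a Lie superalgebra (a Lie subsuperalgebra). -/
@[reducible]
def ofSubmodule (N : Submodule ℂ L) (hgr : N ≤ (N ⊓ part 0) ⊔ (N ⊓ part 1))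
    (hbr : ∀ x ∈ N, ∀ y ∈ N, bracket x y ∈ N) : LieSuperalgebra N where
  part i := (part i).comap N.subtype
  isCompl := by
    constructor
    · rw [Submodule.disjoint_def]
      intro x h0 h1
      exact Subtype.ext (Submodule.disjoint_def.1 (isCompl (L := L)).disjoint x.1 h0 h1)
    · rw [codisjoint_iff, eq_top_iff]
      rintro ⟨x, hx⟩ -
      obtain ⟨y, hy, z, hz, rfl⟩ := Submodule.mem_sup.1 (hgr hx)
      exact Submodule.mem_sup.2 ⟨⟨y, hy.1⟩, hy.2, ⟨z, hz.1⟩, hz.2, rfl⟩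
  bracket := LinearMap.mk₂ ℂ (fun x y => ⟨bracket x.1 y.1, hbr _ x.2 _ y.2⟩)
    (fun _ _ _ => Subtype.ext (by simp)) (fun _ _ _ => Subtype.ext (by simp))
    (fun _ _ _ => Subtype.ext (by simp)) (fun _ _ _ => Subtype.ext (by simp))
  bracket_mem i j x y hx hy := bracket_mem i j x.1 y.1 hx hy
  skew i j x y hx hy := Subtype.ext (skew i j x.1 y.1 hx hy)
  jacobi i j x y z hx hy := Subtype.ext (jacobi i j x.1 y.1 z.1 hx hy)

end

end LieSuperalgebra

/-! ### Associative superalgebras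

An associative superalgebra is a `ZMod 2`-graded algebra. -/

section
variable {B : Type} [Ring B] [Algebra ℂ B]

/-- The eigenspaces `{b | σ b = (-1)^i b}` of a parity automorphism `σ`. -/
def parityPart (σ : B →ₐ[ℂ] B) (i : ZMod 2) : Submodule ℂ B where
  carrier := {b | σ b = ((-1 : ℂ) ^ i.val) • b}
  add_mem' {a b} ha hb := by
    simp only [Set.mem_ofPred_eq] at *
    rw [map_add, ha, hb, smul_add]
  zero_mem' := by simp
  smul_mem' c b hb := by
    simp only [Set.mem_ofPred_eq] at *
    rw [map_smul, hb, smul_comm]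

theorem mem_parityPart_zero {σ : B →ₐ[ℂ] B} {b : B} : b ∈ parityPart σ 0 ↔ σ b = b := by
  change σ b = _ ↔ _
  simp

theorem mem_parityPart_one {σ : B →ₐ[ℂ] B} {b : B} : b ∈ parityPart σ 1 ↔ σ b = -b := by
  change σ b = _ ↔ _
  simp [ZMod.val_one]

theorem smul_half_add_half (b : B) : (2⁻¹ : ℂ) • b + (2⁻¹ : ℂ) • b = b := by
  rw [← add_smul]; norm_num

/-- An involutive automorphism `σ` makes an algebra into a superalgebra, with even part
`{b | σ b = b}` and odd part `{b | σ b = -b}`. -/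
@[reducible]
def parityGradedAlgebra (σ : B →ₐ[ℂ] B) (hσ : ∀ b, σ (σ b) = b) :
    GradedAlgebra (parityPart σ) where
  one_mem := mem_parityPart_zero.2 (map_one σ)
  mul_mem i j a b ha hb := by
    rcases parity_cases i with rfl | rfl <;> rcases parity_cases j with rfl | rfl
    · rw [mem_parityPart_zero] at ha hb
      rw [add_zero, mem_parityPart_zero, map_mul, ha, hb]
    · rw [mem_parityPart_zero] at ha
      rw [mem_parityPart_one] at hb
      rw [zero_add, mem_parityPart_one, map_mul, ha, hb, mul_neg]
    · rw [mem_parityPart_zero] at hb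
      rw [mem_parityPart_one] at ha
      rw [add_zero, mem_parityPart_one, map_mul, ha, hb, neg_mul]
    · rw [mem_parityPart_one] at ha hb
      rw [show (1 + 1 : ZMod 2) = 0 from rfl, mem_parityPart_zero, map_mul, ha, hb, neg_mul_neg]
  decompose' b :=
    DirectSum.of (fun i => parityPart σ i) 0 ⟨(2⁻¹ : ℂ) • (b + σ b), by
      rw [mem_parityPart_zero, map_smul, map_add, hσ, add_comm]⟩ +
    DirectSum.of (fun i => parityPart σ i) 1 ⟨(2⁻¹ : ℂ) • (b - σ b), by
      rw [mem_parityPart_one, map_smul, map_sub, hσ, ← smul_neg, neg_sub]⟩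
  left_inv b := by
    rw [map_add, DirectSum.coeAddMonoidHom_of, DirectSum.coeAddMonoidHom_of, ← smul_add,
      add_add_sub_cancel, smul_add, smul_half_add_half]
  right_inv x := by
    induction x using DirectSum.induction_on with
    | zero =>
      rw [map_zero]
      have h0 : ∀ (i : ZMod 2) (h : (0 : B) ∈ parityPart σ i),
        DirectSum.of (fun i => parityPart σ i) i ⟨0, h⟩ = 0 := fun i h => map_zero _
      simp only [map_zero, add_zero, sub_zero, smul_zero, h0]
    | of i x =>
      obtain ⟨x, hx⟩ := x
      have h0 : ∀ (i : ZMod 2) (h : (0 : B) ∈ parityPart σ i),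
        DirectSum.of (fun i => parityPart σ i) i ⟨0, h⟩ = 0 := fun i h => map_zero _
      rw [DirectSum.coeAddMonoidHom_of]
      rcases parity_cases i with rfl | rfl
      · have hx' := mem_parityPart_zero.1 hx
        simp only [hx', sub_self, smul_zero, h0, add_zero, smul_add, smul_half_add_half]
      · have hx' := mem_parityPart_one.1 hx
        simp only [hx', add_neg_cancel, smul_zero, h0, zero_add, sub_neg_eq_add, smul_add,
          smul_half_add_half]
    | add x y hx hy =>
      conv_rhs => rw [← hx, ← hy]
      dsimp only
      rw [add_add_add_comm]
      refine congrArg₂ (· + ·)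
        (Eq.trans (congrArg _ (Subtype.ext ?_)) (map_add (DirectSum.of _ _) _ _))
        (Eq.trans (congrArg _ (Subtype.ext ?_)) (map_add (DirectSum.of _ _) _ _)) <;>
      · simp only [map_add, Submodule.coe_add, ← smul_add]
        congr 1; abel

variable (𝒜 : ZMod 2 → Submodule ℂ B) [GradedAlgebra 𝒜]

/-- The supercommutator of a superalgebra: `[x, y] = x y - (-1)^{|x||y|} y x` for homogeneous
`x` and `y`, extended bilinearly through the homogeneous components. -/
def superCommutator : B →ₗ[ℂ] B →ₗ[ℂ] B :=
  ∑ i : ZMod 2, ∑ j : ZMod 2,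
    (LinearMap.mul ℂ B - koszul i j • (LinearMap.mul ℂ B).flip).compl₁₂
      (GradedAlgebra.proj 𝒜 i) (GradedAlgebra.proj 𝒜 j)

theorem superCommutator_apply {i j : ZMod 2} {x y : B} (hx : x ∈ 𝒜 i) (hy : y ∈ 𝒜 j) :
    superCommutator 𝒜 x y = x * y - koszul i j • (y * x) := by
  have hp : ∀ (k i : ZMod 2) (x : B), x ∈ 𝒜 i →
      GradedAlgebra.proj 𝒜 k x = if k = i then x else 0 := by
    intro k i x hx
    rw [GradedAlgebra.proj_apply]
    split_ifs with h
    · subst h; exact DirectSum.decompose_of_mem_same 𝒜 hx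
    · exact DirectSum.decompose_of_mem_ne 𝒜 hx (Ne.symm h)
  simp only [superCommutator, LinearMap.sum_apply, LinearMap.compl₁₂_apply, hp _ _ _ hx,
    hp _ _ _ hy, LinearMap.sub_apply, LinearMap.smul_apply, LinearMap.mul_apply',
    LinearMap.flip_apply]
  rw [Finset.sum_eq_single i, Finset.sum_eq_single j]
  · simp
  · intro k _ hk; simp [hk]
  · simp
  · intro k _ hk; simp [hk]
  · simp

/-- Every associative superalgebra is a Lie superalgebra under the supercommutator. -/
@[reducible]
def LieSuperalgebra.ofGradedAlgebra : LieSuperalgebra B where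
  part := 𝒜
  isCompl := by
    have h := (DirectSum.Decomposition.isInternal 𝒜)
    exact h.isCompl (i := 0) (j := 1) (by decide) (by
      ext i; rcases parity_cases i with rfl | rfl <;> simp)
  bracket := superCommutator 𝒜
  bracket_mem i j x y hx hy := by
    rw [superCommutator_apply 𝒜 hx hy]
    exact sub_mem (SetLike.mul_mem_graded hx hy)
      (Submodule.smul_mem _ _ (add_comm i j ▸ SetLike.mul_mem_graded hy hx))
  skew i j x y hx hy := by
    rw [superCommutator_apply 𝒜 hx hy, superCommutator_apply 𝒜 hy hx]
    rcases parity_cases i with rfl | rfl <;> rcases parity_cases j with rfl | rfl <;>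
      simp [koszul_zero_left, koszul_zero_right, koszul_one_one, add_comm]
  jacobi i j x y z hx hy := by
    have key : ∀ (k : ZMod 2) (z : B), z ∈ 𝒜 k →
        superCommutator 𝒜 x (superCommutator 𝒜 y z) =
          superCommutator 𝒜 (superCommutator 𝒜 x y) z +
            koszul i j • superCommutator 𝒜 y (superCommutator 𝒜 x z) := by
      intro k z hz
      have hmem : ∀ {i j : ZMod 2} {x y : B}, x ∈ 𝒜 i → y ∈ 𝒜 j →
          x * y - koszul i j • (y * x) ∈ 𝒜 (i + j) := fun {i j x y} hx hy =>
        sub_mem (SetLike.mul_mem_graded hx hy)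
          (Submodule.smul_mem _ _ (add_comm i j ▸ SetLike.mul_mem_graded hy hx))
      rw [superCommutator_apply 𝒜 hy hz, superCommutator_apply 𝒜 hx hy,
        superCommutator_apply 𝒜 hx hz, superCommutator_apply 𝒜 hx (hmem hy hz),
        superCommutator_apply 𝒜 (hmem hx hy) hz, superCommutator_apply 𝒜 hy (hmem hx hz)]
      have h11 : (1 + 1 : ZMod 2) = 0 := rfl
      rcases parity_cases i with rfl | rfl <;> rcases parity_cases j with rfl | rfl <;>
        rcases parity_cases k with rfl | rfl <;>
        simp only [koszul_zero_left, koszul_zero_right, koszul_one_one, one_smul, neg_smul,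
          add_zero, zero_add, h11] <;> noncomm_ring
    classical
    rw [← DirectSum.sum_support_decompose 𝒜 z]
    simp only [map_sum, Finset.smul_sum, ← Finset.sum_add_distrib]
    exact Finset.sum_congr rfl fun k _ => key k _ (SetLike.coe_mem _)

end

/-- The grading of the tensor product `𝒜 ⊗ ℬ` of two superalgebras:
the component of parity `k` is spanned by the `a ⊗ b` with `|a| + |b| = k`. -/
def tensorPart {B C : Type} [Ring B] [Algebra ℂ B] [Ring C] [Algebra ℂ C]
    (𝒜 : ZMod 2 → Submodule ℂ B) (ℬ : ZMod 2 → Submodule ℂ C) [GradedAlgebra 𝒜] [GradedAlgebra ℬ]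
    (k : ZMod 2) : Submodule ℂ (𝒜 ᵍ⊗[ℂ] ℬ) :=
  Submodule.span ℂ {z | ∃ i j : ZMod 2, i + j = k ∧ ∃ a ∈ 𝒜 i, ∃ b ∈ ℬ j,
    z = GradedTensorProduct.tmul ℂ a b}

/-! ### The universal enveloping algebra of a Lie superalgebra -/

/-- The relations `x y = (-1)^{|x||y|} y x + [x, y]` for homogeneous `x`, `y`. -/
inductive SuperUEA.Rel (L : Type) [AddCommGroup L] [Module ℂ L] [LieSuperalgebra L] :
    TensorAlgebra ℂ L → TensorAlgebra ℂ L → Prop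
  | mk (i j : ZMod 2) (x y : L) (hx : x ∈ LieSuperalgebra.part i)
      (hy : y ∈ LieSuperalgebra.part j) :
      SuperUEA.Rel L (TensorAlgebra.ι ℂ x * TensorAlgebra.ι ℂ y)
        (koszul i j • (TensorAlgebra.ι ℂ y * TensorAlgebra.ι ℂ x) +
          TensorAlgebra.ι ℂ (LieSuperalgebra.bracket x y))

/-- The universal enveloping algebra `U(L)` of a Lie superalgebra `L`: the quotient of the tensor
algebra of `L` by the relations `x y - (-1)^{|x||y|} y x = [x, y]`. -/
def SuperUEA (L : Type) [AddCommGroup L] [Module ℂ L] [LieSuperalgebra L] : Type :=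
  RingQuot (SuperUEA.Rel L)

namespace SuperUEA
variable (L : Type) [AddCommGroup L] [Module ℂ L] [LieSuperalgebra L]

instance : Ring (SuperUEA L) := inferInstanceAs (Ring (RingQuot (SuperUEA.Rel L)))

instance : Algebra ℂ (SuperUEA L) := inferInstanceAs (Algebra ℂ (RingQuot (SuperUEA.Rel L)))

variable {L}

/-- The canonical map `L → U(L)`. -/
def ι : L →ₗ[ℂ] SuperUEA L :=
  (RingQuot.mkAlgHom ℂ (SuperUEA.Rel L)).toLinearMap ∘ₗ TensorAlgebra.ι ℂ

theorem ι_mul_ι {i j : ZMod 2} {x y : L} (hx : x ∈ LieSuperalgebra.part i)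
    (hy : y ∈ LieSuperalgebra.part j) :
    ι x * ι y = koszul i j • (ι y * ι x) + ι (LieSuperalgebra.bracket x y) := by
  have h := RingQuot.mkAlgHom_rel ℂ (Rel.mk i j x y hx hy)
  rw [map_mul, map_add, map_smul, map_mul] at h
  exact h

/-- The universal property of `U(L)`. -/
def lift {B : Type} [Ring B] [Algebra ℂ B] (f : L →ₗ[ℂ] B)
    (hf : ∀ (i j : ZMod 2) (x y : L), x ∈ LieSuperalgebra.part i → y ∈ LieSuperalgebra.part j →
      f x * f y = koszul i j • (f y * f x) + f (LieSuperalgebra.bracket x y)) :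
    SuperUEA L →ₐ[ℂ] B :=
  RingQuot.liftAlgHom ℂ ⟨TensorAlgebra.lift ℂ f, by
    rintro _ _ ⟨i, j, x, y, hx, hy⟩
    simpa using hf i j x y hx hy⟩

theorem lift_ι {B : Type} [Ring B] [Algebra ℂ B] (f : L →ₗ[ℂ] B)
    (hf : ∀ (i j : ZMod 2) (x y : L), x ∈ LieSuperalgebra.part i → y ∈ LieSuperalgebra.part j →
      f x * f y = koszul i j • (f y * f x) + f (LieSuperalgebra.bracket x y)) (x : L) :
    lift f hf (ι x) = f x := by
  unfold lift ι
  exact (RingQuot.liftAlgHom_mkAlgHom_apply ℂ _ _ _).trans (TensorAlgebra.lift_ι_apply f x)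

theorem hom_ext {B : Type} [Ring B] [Algebra ℂ B] {f g : SuperUEA L →ₐ[ℂ] B}
    (h : ∀ x : L, f (ι x) = g (ι x)) : f = g := by
  refine RingQuot.ringQuot_ext' ℂ f g ?_
  ext x
  exact h x

/-- `U(L)` is generated by the image of `L`. -/
theorem adjoin_ι : Algebra.adjoin ℂ (Set.range (ι (L := L))) = ⊤ := by
  have h : (Algebra.adjoin ℂ (Set.range (TensorAlgebra.ι ℂ (M := L)))).map
      (RingQuot.mkAlgHom ℂ (SuperUEA.Rel L)) = ⊤ := by
    rw [TensorAlgebra.adjoin_range_ι, Algebra.map_top, AlgHom.range_eq_top]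
    exact RingQuot.mkAlgHom_surjective ℂ _
  rw [AlgHom.map_adjoin, ← Set.range_comp] at h
  exact h

variable (L)

/-- The parity automorphism of `U(L)`, determined by `x ↦ (-1)^{|x|} x` for `x ∈ L`. -/
def parityHom : SuperUEA L →ₐ[ℂ] SuperUEA L :=
  lift (ι ∘ₗ LieSuperalgebra.parity L) (by
    intro i j x y hx hy
    have hb := LieSuperalgebra.bracket_mem i j x y hx hy
    simp only [LinearMap.comp_apply, LieSuperalgebra.parity_of_mem hx,
      LieSuperalgebra.parity_of_mem hy, LieSuperalgebra.parity_of_mem hb, map_smul,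
      smul_mul_smul_comm, ι_mul_ι hx hy]
    have h11 : (1 + 1 : ZMod 2) = 0 := rfl
    rcases parity_cases i with rfl | rfl <;> rcases parity_cases j with rfl | rfl <;>
      simp [ZMod.val_one, h11, add_comm])

variable {L}

theorem parityHom_ι (x : L) : parityHom L (ι x) = ι (LieSuperalgebra.parity L x) := lift_ι _ _ _

theorem parityHom_parityHom (b : SuperUEA L) : parityHom L (parityHom L b) = b := by
  have h : (parityHom L).comp (parityHom L) = AlgHom.id ℂ _ := by
    refine hom_ext fun x => ?_
    simp [parityHom_ι, LieSuperalgebra.parity_parity]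
  exact DFunLike.congr_fun h b

variable (L)

/-- The superalgebra structure of `U(L)`, in which `x ∈ L` keeps its parity. -/
def part : ZMod 2 → Submodule ℂ (SuperUEA L) := parityPart (parityHom L)

instance : GradedAlgebra (part L) := parityGradedAlgebra _ parityHom_parityHom

end SuperUEA

/-! ### The Grassmann–Laurent superalgebra `A = ℂ[t, t⁻¹] ⊗ Λ(1)` -/

namespace Ramond

/-- `A = ℂ[t, t⁻¹] ⊗ Λ(1)`: Laurent polynomials with an adjoined odd variable `ξ`, `ξ² = 0`.
An element is written `f + g ξ` with `f = fst`, `g = snd`. -/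
abbrev A : Type := DualNumber ℂ[T;T⁻¹]

/-- The element `t^i` of `A`. -/
def tPow (i : ℤ) : A := TrivSqZeroExt.inl (LaurentPolynomial.T i)

/-- The element `t^i ξ` of `A`. -/
def tXi (i : ℤ) : A := TrivSqZeroExt.inr (LaurentPolynomial.T i)

theorem tPow_mul_tPow (i j : ℤ) : tPow i * tPow j = tPow (i + j) := by
  rw [tPow, tPow, tPow, ← TrivSqZeroExt.inl_mul, LaurentPolynomial.T_add]

theorem tPow_mul_tXi (i j : ℤ) : tPow i * tXi j = tXi (i + j) := by
  rw [tPow, tXi, tXi, TrivSqZeroExt.inl_mul_inr, LaurentPolynomial.T_add, smul_eq_mul]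

theorem tXi_mul_tPow (i j : ℤ) : tXi i * tPow j = tXi (i + j) := by
  rw [mul_comm, tPow_mul_tXi, add_comm]

theorem tXi_mul_tXi (i j : ℤ) : tXi i * tXi j = 0 := by
  rw [tXi, tXi, TrivSqZeroExt.inr_mul_inr]

theorem tPow_zero : tPow 0 = 1 := by
  rw [tPow, LaurentPolynomial.T_zero, TrivSqZeroExt.inl_one]

/-- The inclusion `f ↦ f`. -/
def evenIncl : ℂ[T;T⁻¹] →ₗ[ℂ] A := (TrivSqZeroExt.inlAlgHom ℂ ℂ[T;T⁻¹] ℂ[T;T⁻¹]).toLinearMap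

/-- The inclusion `g ↦ g ξ`. -/
def oddIncl : ℂ[T;T⁻¹] →ₗ[ℂ] A := (TrivSqZeroExt.inrHom ℂ[T;T⁻¹] ℂ[T;T⁻¹]).restrictScalars ℂ

/-- The map `f + g ξ ↦ f`. -/
def evenCoord : A →ₗ[ℂ] ℂ[T;T⁻¹] := (TrivSqZeroExt.fstHom ℂ ℂ[T;T⁻¹] ℂ[T;T⁻¹]).toLinearMap

/-- The map `f + g ξ ↦ g`. -/
def oddCoord : A →ₗ[ℂ] ℂ[T;T⁻¹] := (TrivSqZeroExt.sndHom ℂ[T;T⁻¹] ℂ[T;T⁻¹]).restrictScalars ℂ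

theorem evenIncl_apply (f : ℂ[T;T⁻¹]) : evenIncl f = TrivSqZeroExt.inl f := rfl
theorem oddIncl_apply (f : ℂ[T;T⁻¹]) : oddIncl f = TrivSqZeroExt.inr f := rfl
theorem evenCoord_apply (x : A) : evenCoord x = x.fst := rfl
theorem oddCoord_apply (x : A) : oddCoord x = x.snd := rfl

/-- Formal differentiation of Laurent polynomials, `t^n ↦ n t^{n-1}`. -/
def laurentDeriv : ℂ[T;T⁻¹] →ₗ[ℂ] ℂ[T;T⁻¹] :=
  Finsupp.linearCombination ℂ (fun n : ℤ => (n : ℂ) • (LaurentPolynomial.T (n - 1) : ℂ[T;T⁻¹])) ∘ₗ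
    (AddMonoidAlgebra.coeffLinearEquiv ℂ).toLinearMap

theorem laurentDeriv_T (n : ℤ) :
    laurentDeriv (LaurentPolynomial.T n) = (n : ℂ) • LaurentPolynomial.T (n - 1) := by
  have h : (AddMonoidAlgebra.coeffLinearEquiv ℂ) (LaurentPolynomial.T n : ℂ[T;T⁻¹]) =
    Finsupp.single n (1 : ℂ) := rfl
  simp only [laurentDeriv, LinearMap.comp_apply, LinearEquiv.coe_coe, h,
    Finsupp.linearCombination_single, one_smul]

/-- `∂_t (f + g ξ) = f' + g' ξ`. -/
def dt : Module.End ℂ A := evenIncl ∘ₗ laurentDeriv ∘ₗ evenCoord + oddIncl ∘ₗ laurentDeriv ∘ₗ oddCoord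

/-- `∂_ξ (f + g ξ) = g`. -/
def dxi : Module.End ℂ A := evenIncl ∘ₗ oddCoord

theorem dt_tPow (i : ℤ) : dt (tPow i) = (i : ℂ) • tPow (i - 1) := by
  simp [dt, tPow, evenIncl_apply, oddIncl_apply, evenCoord_apply, oddCoord_apply, laurentDeriv_T]

theorem dt_tXi (i : ℤ) : dt (tXi i) = (i : ℂ) • tXi (i - 1) := by
  simp [dt, tXi, evenIncl_apply, oddIncl_apply, evenCoord_apply, oddCoord_apply, laurentDeriv_T]

theorem dxi_tPow (i : ℤ) : dxi (tPow i) = 0 := by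
  simp [dxi, tPow, evenIncl_apply, oddCoord_apply]

theorem dxi_tXi (i : ℤ) : dxi (tXi i) = tPow i := by
  simp [dxi, tXi, tPow, evenIncl_apply, oddCoord_apply]

/-- Linear maps on `A` are determined by their values on the basis `t^i`, `t^i ξ`. -/
theorem A_hom_ext {M : Type} [AddCommGroup M] [Module ℂ M] {f g : A →ₗ[ℂ] M}
    (h0 : ∀ i, f (tPow i) = g (tPow i)) (h1 : ∀ i, f (tXi i) = g (tXi i)) : f = g := by
  have hL : ∀ {u v : ℂ[T;T⁻¹] →ₗ[ℂ] M}, (∀ i, u (LaurentPolynomial.T i) = v (LaurentPolynomial.T i)) →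
      u = v := by
    intro u v h
    refine LinearMap.ext fun p => ?_
    induction p using LaurentPolynomial.induction_on' with
    | add p q hp hq => rw [map_add, map_add, hp, hq]
    | C_mul_T n a => rw [← LaurentPolynomial.smul_eq_C_mul, map_smul, map_smul, h]
  have e0 : f ∘ₗ evenIncl = g ∘ₗ evenIncl := hL h0
  have e1 : f ∘ₗ oddIncl = g ∘ₗ oddIncl := hL h1
  refine LinearMap.ext fun x => ?_
  rw [← TrivSqZeroExt.inl_fst_add_inr_snd_eq x, map_add, map_add]
  exact congrArg₂ (· + ·) (LinearMap.congr_fun e0 x.fst) (LinearMap.congr_fun e1 x.snd)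

/-- The homogeneous components of `A`: the even part is `ℂ[t, t⁻¹]`, the odd part `ℂ[t, t⁻¹] ξ`. -/
def A.part (i : ZMod 2) : Submodule ℂ A :=
  if i = 0 then LinearMap.range evenIncl else LinearMap.range oddIncl

theorem A.part_zero : A.part 0 = LinearMap.range evenIncl := if_pos rfl

theorem A.part_one : A.part 1 = LinearMap.range oddIncl := if_neg (by decide)

theorem mem_A_part_zero {x : A} : x ∈ A.part 0 ↔ x.snd = 0 := by
  rw [A.part_zero]
  constructor
  · rintro ⟨f, rfl⟩; rfl
  · intro h; exact ⟨x.fst, by rw [evenIncl_apply]; ext <;> simp [h]⟩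

theorem mem_A_part_one {x : A} : x ∈ A.part 1 ↔ x.fst = 0 := by
  rw [A.part_one]
  constructor
  · rintro ⟨f, rfl⟩; rfl
  · intro h; exact ⟨x.snd, by rw [oddIncl_apply]; ext <;> simp [h]⟩

theorem tPow_mem (i : ℤ) : tPow i ∈ A.part 0 := mem_A_part_zero.2 rfl

theorem tXi_mem (i : ℤ) : tXi i ∈ A.part 1 := mem_A_part_one.2 rfl

/-- The parity map `f + g ξ ↦ f - g ξ` of `A`. -/
def A.parity : Module.End ℂ A := evenIncl ∘ₗ evenCoord - oddIncl ∘ₗ oddCoord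

theorem A_parity_tPow (i : ℤ) : A.parity (tPow i) = tPow i := by
  simp [A.parity, tPow, evenIncl_apply, oddIncl_apply, evenCoord_apply, oddCoord_apply]

theorem A_parity_tXi (i : ℤ) : A.parity (tXi i) = -tXi i := by
  simp [A.parity, tXi, evenIncl_apply, oddIncl_apply, evenCoord_apply, oddCoord_apply]

theorem A_parity_even {x : A} (hx : x ∈ A.part 0) : A.parity x = x := by
  rw [mem_A_part_zero] at hx
  ext <;> simp [A.parity, hx, evenIncl_apply, oddIncl_apply, evenCoord_apply, oddCoord_apply]

theorem A_parity_odd {x : A} (hx : x ∈ A.part 1) : A.parity x = -x := by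
  rw [mem_A_part_one] at hx
  ext <;> simp [A.parity, hx, evenIncl_apply, oddIncl_apply, evenCoord_apply, oddCoord_apply]

theorem A_isCompl : IsCompl (A.part 0) (A.part 1) := by
  constructor
  · rw [Submodule.disjoint_def]
    intro x h0 h1
    exact TrivSqZeroExt.ext (mem_A_part_one.1 h1) (mem_A_part_zero.1 h0)
  · rw [codisjoint_iff, eq_top_iff]
    rintro x -
    exact Submodule.mem_sup.2 ⟨TrivSqZeroExt.inl x.fst, mem_A_part_zero.2 rfl,
      TrivSqZeroExt.inr x.snd, mem_A_part_one.2 rfl, TrivSqZeroExt.inl_fst_add_inr_snd_eq x⟩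

/-- The action of `L_n` on `A`: `L_n ∘ x = t^{n+1} ∂_t x + (n/2) t^n ξ ∂_ξ x`. -/
def actL (n : ℤ) : Module.End ℂ A :=
  LinearMap.mulLeft ℂ (tPow (n + 1)) ∘ₗ dt + ((n : ℂ) / 2) • (LinearMap.mulLeft ℂ (tXi n) ∘ₗ dxi)

/-- The action of `G_n` on `A`: `G_n ∘ x = t^{n+1} ξ ∂_t x - t^n ∂_ξ x`. -/
def actG (n : ℤ) : Module.End ℂ A :=
  LinearMap.mulLeft ℂ (tXi (n + 1)) ∘ₗ dt - LinearMap.mulLeft ℂ (tPow n) ∘ₗ dxi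

theorem actL_tPow (n i : ℤ) : actL n (tPow i) = (i : ℂ) • tPow (n + i) := by
  simp only [actL, LinearMap.add_apply, LinearMap.comp_apply, LinearMap.smul_apply,
    LinearMap.mulLeft_apply, dt_tPow, dxi_tPow, mul_smul_comm, tPow_mul_tPow, mul_zero, smul_zero,
    add_zero]
  congr 2; ring

theorem actL_tXi (n i : ℤ) : actL n (tXi i) = ((i : ℂ) + n / 2) • tXi (n + i) := by
  simp only [actL, LinearMap.add_apply, LinearMap.comp_apply, LinearMap.smul_apply,
    LinearMap.mulLeft_apply, dt_tXi, dxi_tXi, mul_smul_comm, tPow_mul_tXi, tXi_mul_tPow]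
  rw [add_smul]; congr 3; ring

theorem actG_tPow (n i : ℤ) : actG n (tPow i) = (i : ℂ) • tXi (n + i) := by
  simp only [actG, LinearMap.sub_apply, LinearMap.comp_apply,
    LinearMap.mulLeft_apply, dt_tPow, dxi_tPow, mul_smul_comm, tXi_mul_tPow, mul_zero, sub_zero]
  congr 2; ring

theorem actG_tXi (n i : ℤ) : actG n (tXi i) = -tPow (n + i) := by
  simp only [actG, LinearMap.sub_apply, LinearMap.comp_apply,
    LinearMap.mulLeft_apply, dt_tXi, dxi_tXi, mul_smul_comm, tXi_mul_tXi, tPow_mul_tPow, smul_zero,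
    zero_sub]

/-! ### The centreless `N = 1` Ramond algebra `s̄` -/

/-- The underlying space of `s̄`: the basis vectors are `L_n = (δ_n, 0)` and `G_n = (0, δ_n)`. -/
def SBar : Type := (ℤ →₀ ℂ) × (ℤ →₀ ℂ)

instance : AddCommGroup SBar := inferInstanceAs (AddCommGroup ((ℤ →₀ ℂ) × (ℤ →₀ ℂ)))

instance : Module ℂ SBar := inferInstanceAs (Module ℂ ((ℤ →₀ ℂ) × (ℤ →₀ ℂ)))

/-- The inclusion of the span of the `L_n`. -/
def SBar.inL : (ℤ →₀ ℂ) →ₗ[ℂ] SBar := LinearMap.inl ℂ (ℤ →₀ ℂ) (ℤ →₀ ℂ)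

/-- The inclusion of the span of the `G_n`. -/
def SBar.inG : (ℤ →₀ ℂ) →ₗ[ℂ] SBar := LinearMap.inr ℂ (ℤ →₀ ℂ) (ℤ →₀ ℂ)

/-- The coordinates in the `L_n`. -/
def SBar.coL : SBar →ₗ[ℂ] (ℤ →₀ ℂ) := LinearMap.fst ℂ (ℤ →₀ ℂ) (ℤ →₀ ℂ)

/-- The coordinates in the `G_n`. -/
def SBar.coG : SBar →ₗ[ℂ] (ℤ →₀ ℂ) := LinearMap.snd ℂ (ℤ →₀ ℂ) (ℤ →₀ ℂ)

/-- The basis vector `L_n` of `s̄`. -/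
def SBar.L (n : ℤ) : SBar := SBar.inL (Finsupp.single n 1)

/-- The basis vector `G_n` of `s̄`. -/
def SBar.G (n : ℤ) : SBar := SBar.inG (Finsupp.single n 1)

/-- The bilinear map with `(e_m, e_n) ↦ c m n • e_{m+n}`. -/
def structureMap (c : ℤ → ℤ → ℂ) : (ℤ →₀ ℂ) →ₗ[ℂ] (ℤ →₀ ℂ) →ₗ[ℂ] (ℤ →₀ ℂ) :=
  Finsupp.linearCombination ℂ fun m => Finsupp.linearCombination ℂ fun n =>
    Finsupp.single (m + n) (c m n)

theorem structureMap_single (c : ℤ → ℤ → ℂ) (m n : ℤ) :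
    structureMap c (Finsupp.single m 1) (Finsupp.single n 1) = c m n • Finsupp.single (m + n) 1 := by
  simp [structureMap]

/-- The bracket of `s̄`: `[L_m, L_n] = (n - m) L_{m+n}`, `[L_m, G_p] = (p - m/2) G_{m+p}`,
`[G_p, L_m] = -(p - m/2) G_{p+m}`, `[G_p, G_q] = -2 L_{p+q}`. -/
def SBar.bracket : SBar →ₗ[ℂ] SBar →ₗ[ℂ] SBar :=
  ((structureMap fun m n => (n : ℂ) - m).compl₁₂ SBar.coL SBar.coL).compr₂ SBar.inL +
  ((structureMap fun m p => (p : ℂ) - m / 2).compl₁₂ SBar.coL SBar.coG).compr₂ SBar.inG +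
  ((structureMap fun p m => -((p : ℂ) - m / 2)).compl₁₂ SBar.coG SBar.coL).compr₂ SBar.inG +
  ((structureMap fun _ _ => -2).compl₁₂ SBar.coG SBar.coG).compr₂ SBar.inL

theorem SBar.coL_L (n : ℤ) : SBar.coL (SBar.L n) = Finsupp.single n 1 := rfl
theorem SBar.coG_L (n : ℤ) : SBar.coG (SBar.L n) = 0 := rfl
theorem SBar.coL_G (n : ℤ) : SBar.coL (SBar.G n) = 0 := rfl
theorem SBar.coG_G (n : ℤ) : SBar.coG (SBar.G n) = Finsupp.single n 1 := rfl

theorem SBar.bracket_L_L (m n : ℤ) :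
    SBar.bracket (SBar.L m) (SBar.L n) = ((n : ℂ) - m) • SBar.L (m + n) := by
  simp only [bracket, LinearMap.add_apply, LinearMap.compr₂_apply, LinearMap.compl₁₂_apply,
    coL_L, coG_L, structureMap_single, map_zero, LinearMap.zero_apply, add_zero, map_smul]
  rfl

theorem SBar.bracket_L_G (m p : ℤ) :
    SBar.bracket (SBar.L m) (SBar.G p) = ((p : ℂ) - m / 2) • SBar.G (m + p) := by
  simp only [bracket, LinearMap.add_apply, LinearMap.compr₂_apply, LinearMap.compl₁₂_apply,
    coL_L, coG_L, coL_G, coG_G, structureMap_single, map_zero, LinearMap.zero_apply, add_zero,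
    zero_add, map_smul]
  rfl

theorem SBar.bracket_G_L (p m : ℤ) :
    SBar.bracket (SBar.G p) (SBar.L m) = (-((p : ℂ) - m / 2)) • SBar.G (p + m) := by
  simp only [bracket, LinearMap.add_apply, LinearMap.compr₂_apply, LinearMap.compl₁₂_apply,
    coL_L, coG_L, coL_G, coG_G, structureMap_single, map_zero, LinearMap.zero_apply, add_zero,
    zero_add, map_smul]
  rfl

theorem SBar.bracket_G_G (p q : ℤ) :
    SBar.bracket (SBar.G p) (SBar.G q) = (-2 : ℂ) • SBar.L (p + q) := by
  simp only [bracket, LinearMap.add_apply, LinearMap.compr₂_apply, LinearMap.compl₁₂_apply,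
    coL_G, coG_G, structureMap_single, map_zero, LinearMap.zero_apply, add_zero,
    zero_add, map_smul]
  rfl

/-- Linear maps on `s̄` are determined by their values on the `L_n` and `G_n`. -/
theorem SBar.hom_ext {M : Type} [AddCommGroup M] [Module ℂ M] {f g : SBar →ₗ[ℂ] M}
    (h0 : ∀ n, f (SBar.L n) = g (SBar.L n)) (h1 : ∀ n, f (SBar.G n) = g (SBar.G n)) : f = g := by
  have e0 : f ∘ₗ SBar.inL = g ∘ₗ SBar.inL := by
    ext n; exact h0 n
  have e1 : f ∘ₗ SBar.inG = g ∘ₗ SBar.inG := by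
    ext n; exact h1 n
  ext x
  have hx : x = SBar.inL (SBar.coL x) + SBar.inG (SBar.coG x) := by
    refine Prod.ext ?_ ?_
    · exact (add_zero _).symm
    · exact (zero_add _).symm
  rw [hx, map_add, map_add]
  exact congrArg₂ (· + ·) (LinearMap.congr_fun e0 _) (LinearMap.congr_fun e1 _)

/-- The homogeneous components of `s̄`: the `L_n` span the even part, the `G_n` the odd part. -/
def SBar.part (i : ZMod 2) : Submodule ℂ SBar :=
  if i = 0 then Submodule.span ℂ (Set.range SBar.L) else Submodule.span ℂ (Set.range SBar.G)

theorem SBar.part_zero : SBar.part 0 = Submodule.span ℂ (Set.range SBar.L) := if_pos rfl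

theorem SBar.part_one : SBar.part 1 = Submodule.span ℂ (Set.range SBar.G) := if_neg (by decide)

theorem SBar.L_mem (n : ℤ) : SBar.L n ∈ SBar.part 0 := by
  rw [part_zero]; exact Submodule.subset_span ⟨n, rfl⟩

theorem SBar.G_mem (n : ℤ) : SBar.G n ∈ SBar.part 1 := by
  rw [part_one]; exact Submodule.subset_span ⟨n, rfl⟩

/-- To prove that a linear property holds on a homogeneous component, check basis vectors. -/
theorem SBar.eq_of_mem {M : Type} [AddCommGroup M] [Module ℂ M] {f g : SBar →ₗ[ℂ] M} {i : ZMod 2}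
    (h0 : i = 0 → ∀ n, f (SBar.L n) = g (SBar.L n)) (h1 : i = 1 → ∀ n, f (SBar.G n) = g (SBar.G n))
    {x : SBar} (hx : x ∈ SBar.part i) : f x = g x := by
  have : SBar.part i ≤ LinearMap.eqLocus f g := by
    rcases parity_cases i with rfl | rfl
    · rw [SBar.part_zero, Submodule.span_le]
      rintro _ ⟨n, rfl⟩
      exact h0 rfl n
    · rw [SBar.part_one, Submodule.span_le]
      rintro _ ⟨n, rfl⟩
      exact h1 rfl n
  exact this hx

theorem SBar.eq_of_mem_mem {M : Type} [AddCommGroup M] [Module ℂ M]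
    {f g : SBar →ₗ[ℂ] SBar →ₗ[ℂ] M} {i j : ZMod 2}
    (h00 : i = 0 → j = 0 → ∀ m n, f (SBar.L m) (SBar.L n) = g (SBar.L m) (SBar.L n))
    (h01 : i = 0 → j = 1 → ∀ m n, f (SBar.L m) (SBar.G n) = g (SBar.L m) (SBar.G n))
    (h10 : i = 1 → j = 0 → ∀ m n, f (SBar.G m) (SBar.L n) = g (SBar.G m) (SBar.L n))
    (h11 : i = 1 → j = 1 → ∀ m n, f (SBar.G m) (SBar.G n) = g (SBar.G m) (SBar.G n))
    {x y : SBar} (hx : x ∈ SBar.part i) (hy : y ∈ SBar.part j) : f x y = g x y := by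
  refine SBar.eq_of_mem (f := f.flip y) (g := g.flip y) ?_ ?_ hx
  · intro hi m
    exact SBar.eq_of_mem (f := f (SBar.L m)) (g := g (SBar.L m)) (fun hj => h00 hi hj m)
      (fun hj => h01 hi hj m) hy
  · intro hi m
    exact SBar.eq_of_mem (f := f (SBar.G m)) (g := g (SBar.G m)) (fun hj => h10 hi hj m)
      (fun hj => h11 hi hj m) hy

theorem SBar.mem_part_zero {x : SBar} : x ∈ SBar.part 0 ↔ SBar.coG x = 0 := by
  constructor
  · intro hx
    exact SBar.eq_of_mem (f := SBar.coG) (g := 0) (fun _ n => rfl) (fun h => absurd h (by decide)) hx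
  · intro h
    have hx : x = SBar.inL (SBar.coL x) := Prod.ext rfl h
    rw [hx]
    generalize SBar.coL x = f
    induction f using Finsupp.induction_linear with
    | zero => rw [map_zero]; exact zero_mem _
    | add f g hf hg => rw [map_add]; exact add_mem hf hg
    | single n c =>
      rw [← mul_one c, ← smul_eq_mul, ← Finsupp.smul_single, map_smul]
      exact Submodule.smul_mem _ _ (SBar.L_mem n)

theorem SBar.mem_part_one {x : SBar} : x ∈ SBar.part 1 ↔ SBar.coL x = 0 := by
  constructor
  · intro hx
    exact SBar.eq_of_mem (f := SBar.coL) (g := 0) (fun h => absurd h (by decide)) (fun _ n => rfl) hx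
  · intro h
    have hx : x = SBar.inG (SBar.coG x) := Prod.ext h rfl
    rw [hx]
    generalize SBar.coG x = f
    induction f using Finsupp.induction_linear with
    | zero => rw [map_zero]; exact zero_mem _
    | add f g hf hg => rw [map_add]; exact add_mem hf hg
    | single n c =>
      rw [← mul_one c, ← smul_eq_mul, ← Finsupp.smul_single, map_smul]
      exact Submodule.smul_mem _ _ (SBar.G_mem n)

theorem SBar.isCompl : IsCompl (SBar.part 0) (SBar.part 1) := by
  constructor
  · rw [Submodule.disjoint_def]
    intro x h0 h1
    exact Prod.ext (SBar.mem_part_one.1 h1) (SBar.mem_part_zero.1 h0)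
  · rw [codisjoint_iff, eq_top_iff]
    rintro x -
    exact Submodule.mem_sup.2 ⟨SBar.inL (SBar.coL x), SBar.mem_part_zero.2 rfl,
      SBar.inG (SBar.coG x), SBar.mem_part_one.2 rfl,
      Prod.ext (add_zero (SBar.coL x)) (zero_add (SBar.coG x))⟩

theorem SBar.bracket_mem (i j : ZMod 2) (x y : SBar) (hx : x ∈ SBar.part i)
    (hy : y ∈ SBar.part j) : SBar.bracket x y ∈ SBar.part (i + j) := by
  have h := SBar.eq_of_mem_mem (f := SBar.bracket.compr₂ (SBar.part (i + j)).mkQ) (g := 0) (i := i)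
    (j := j) ?_ ?_ ?_ ?_ hx hy
  · exact (Submodule.Quotient.mk_eq_zero _).1 h
  all_goals
    rintro rfl rfl m n
    refine (Submodule.Quotient.mk_eq_zero _).2 ?_
  · rw [SBar.bracket_L_L]; exact Submodule.smul_mem _ _ (SBar.L_mem _)
  · rw [SBar.bracket_L_G]; exact Submodule.smul_mem _ _ (SBar.G_mem _)
  · rw [SBar.bracket_G_L]; exact Submodule.smul_mem _ _ (SBar.G_mem _)
  · rw [SBar.bracket_G_G]; exact Submodule.smul_mem _ _ (SBar.L_mem _)

theorem SBar.skew (i j : ZMod 2) (x y : SBar) (hx : x ∈ SBar.part i)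
    (hy : y ∈ SBar.part j) : SBar.bracket x y = -(koszul i j • SBar.bracket y x) := by
  refine SBar.eq_of_mem_mem (f := SBar.bracket) (g := -(koszul i j • SBar.bracket.flip)) (i := i)
    (j := j) ?_ ?_ ?_ ?_ hx hy
  all_goals
    rintro rfl rfl m n
    simp only [LinearMap.neg_apply, LinearMap.smul_apply, LinearMap.flip_apply, SBar.bracket_L_L,
      SBar.bracket_L_G, SBar.bracket_G_L, SBar.bracket_G_G, koszul_zero_left, koszul_zero_right,
      koszul_one_one, add_comm n m]
    module

theorem SBar.jacobi (i j : ZMod 2) (x y z : SBar) (hx : x ∈ SBar.part i)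
    (hy : y ∈ SBar.part j) : SBar.bracket x (SBar.bracket y z) =
      SBar.bracket (SBar.bracket x y) z + koszul i j • SBar.bracket y (SBar.bracket x z) := by
  have h := SBar.eq_of_mem_mem
    (f := (LinearMap.mul ℂ (Module.End ℂ SBar)).compl₁₂ SBar.bracket SBar.bracket)
    (g := SBar.bracket.compr₂ SBar.bracket +
      koszul i j • ((LinearMap.mul ℂ (Module.End ℂ SBar)).compl₁₂ SBar.bracket SBar.bracket).flip)
    (i := i) (j := j) ?_ ?_ ?_ ?_ hx hy
  · exact LinearMap.congr_fun h z
  all_goals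
    rintro rfl rfl m n
    refine SBar.hom_ext (fun k => ?_) (fun k => ?_) <;>
    · simp only [LinearMap.add_apply, LinearMap.smul_apply, LinearMap.flip_apply,
        LinearMap.compl₁₂_apply, LinearMap.compr₂_apply, LinearMap.mul_apply', Module.End.mul_apply,
        SBar.bracket_L_L, SBar.bracket_L_G, SBar.bracket_G_L, SBar.bracket_G_G, koszul_zero_left,
        koszul_zero_right, koszul_one_one, map_smul, smul_smul, add_assoc, add_left_comm n m k,
        ← add_smul]
      congr 1
      push_cast
      ring

/-- The Lie superalgebra `s̄`. -/
instance : LieSuperalgebra SBar where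
  part := SBar.part
  isCompl := SBar.isCompl
  bracket := SBar.bracket
  bracket_mem := SBar.bracket_mem
  skew := SBar.skew
  jacobi := SBar.jacobi

/-! ### The semidirect product `s̃ = s̄ ⋉ A` -/

/-- The action `x ∘ a` of `x ∈ s̄` on `a ∈ A`. -/
def act : SBar →ₗ[ℂ] Module.End ℂ A :=
  Finsupp.linearCombination ℂ actL ∘ₗ SBar.coL + Finsupp.linearCombination ℂ actG ∘ₗ SBar.coG

/-- The bilinear map with value `(-1)^{|x||a|} x ∘ a` on homogeneous `x ∈ s̄` and `a ∈ A`. -/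
def signedAct : SBar →ₗ[ℂ] Module.End ℂ A :=
  Finsupp.linearCombination ℂ actL ∘ₗ SBar.coL +
    Finsupp.linearCombination ℂ (fun n => actG n ∘ₗ A.parity) ∘ₗ SBar.coG

theorem act_L (n : ℤ) : act (SBar.L n) = actL n := by
  simp [act, SBar.coL_L, SBar.coG_L]

theorem act_G (n : ℤ) : act (SBar.G n) = actG n := by
  simp [act, SBar.coL_G, SBar.coG_G]

theorem signedAct_L (n : ℤ) : signedAct (SBar.L n) = actL n := by
  simp [signedAct, SBar.coL_L, SBar.coG_L]

theorem signedAct_G (n : ℤ) : signedAct (SBar.G n) = actG n ∘ₗ A.parity := by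
  simp [signedAct, SBar.coL_G, SBar.coG_G]

theorem signedAct_apply (i j : ZMod 2) (x : SBar) (a : A) (hx : x ∈ SBar.part i)
    (ha : a ∈ A.part j) : signedAct x a = koszul i j • act x a := by
  refine SBar.eq_of_mem (f := signedAct.flip a) (g := koszul i j • act.flip a) (i := i) ?_ ?_ hx
  · rintro rfl n
    simp [signedAct_L, act_L, koszul_zero_left]
  · rintro rfl n
    rcases parity_cases j with rfl | rfl
    · simp [signedAct_G, act_G, koszul_zero_right, A_parity_even ha]
    · simp [signedAct_G, act_G, koszul_one_one, A_parity_odd ha]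

theorem act_mem (i j : ZMod 2) (x : SBar) (a : A) (hx : x ∈ SBar.part i)
    (ha : a ∈ A.part j) : act x a ∈ A.part (i + j) := by
  have h := SBar.eq_of_mem (f := (A.part (i + j)).mkQ ∘ₗ act.flip a) (g := 0) (i := i) ?_ ?_ hx
  · exact (Submodule.Quotient.mk_eq_zero _).1 h
  all_goals
    rintro rfl n
    refine (Submodule.Quotient.mk_eq_zero _).2 ?_
    rw [LinearMap.flip_apply]
    rcases parity_cases j with rfl | rfl
  · rw [mem_A_part_zero] at ha
    rw [act_L, zero_add, mem_A_part_zero]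
    simp [actL, dt, dxi, tPow, tXi, evenIncl_apply, oddIncl_apply, evenCoord_apply, oddCoord_apply, ha]
  · rw [mem_A_part_one] at ha
    rw [act_L, zero_add, mem_A_part_one]
    simp [actL, dt, dxi, tPow, tXi, evenIncl_apply, oddIncl_apply, evenCoord_apply, oddCoord_apply, ha]
  · rw [mem_A_part_zero] at ha
    rw [act_G, add_zero, mem_A_part_one]
    simp [actG, dt, dxi, tPow, tXi, evenIncl_apply, oddIncl_apply, evenCoord_apply, oddCoord_apply, ha]
  · rw [mem_A_part_one] at ha
    rw [act_G, show (1 + 1 : ZMod 2) = 0 from rfl, mem_A_part_zero]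
    simp [actG, dt, dxi, tPow, tXi, evenIncl_apply, oddIncl_apply, evenCoord_apply, oddCoord_apply, ha]

theorem act_bracket (i j : ZMod 2) (x y : SBar) (hx : x ∈ SBar.part i) (hy : y ∈ SBar.part j)
    (a : A) : act (SBar.bracket x y) a = act x (act y a) - koszul i j • act y (act x a) := by
  have h := SBar.eq_of_mem_mem (f := SBar.bracket.compr₂ act)
    (g := (LinearMap.mul ℂ (Module.End ℂ A)).compl₁₂ act act +
      (-koszul i j) • ((LinearMap.mul ℂ (Module.End ℂ A)).compl₁₂ act act).flip)
    (i := i) (j := j) ?_ ?_ ?_ ?_ hx hy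
  · rw [sub_eq_add_neg, ← neg_smul]
    exact LinearMap.congr_fun h a
  all_goals
    rintro rfl rfl m n
    refine A_hom_ext (fun k => ?_) (fun k => ?_) <;>
    · simp only [LinearMap.add_apply, LinearMap.smul_apply, LinearMap.flip_apply,
        LinearMap.compl₁₂_apply, LinearMap.compr₂_apply, LinearMap.mul_apply', Module.End.mul_apply,
        SBar.bracket_L_L, SBar.bracket_L_G, SBar.bracket_G_L, SBar.bracket_G_G, koszul_zero_left,
        koszul_zero_right, koszul_one_one, map_smul, smul_smul, add_assoc, add_left_comm n m k,
        act_L, act_G, actL_tPow, actL_tXi, actG_tPow, actG_tXi, map_neg, smul_neg]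
      push_cast
      module

/-- The underlying space of `s̃`. -/
def STilde : Type := SBar × A

instance : AddCommGroup STilde := inferInstanceAs (AddCommGroup (SBar × A))

instance : Module ℂ STilde := inferInstanceAs (Module ℂ (SBar × A))

/-- The inclusion `s̄ → s̃`. -/
def STilde.inS : SBar →ₗ[ℂ] STilde := LinearMap.inl ℂ SBar A

/-- The inclusion `A → s̃`. -/
def STilde.inA : A →ₗ[ℂ] STilde := LinearMap.inr ℂ SBar A

/-- The projection `s̃ → s̄`. -/
def STilde.prS : STilde →ₗ[ℂ] SBar := LinearMap.fst ℂ SBar A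

/-- The projection `s̃ → A`. -/
def STilde.prA : STilde →ₗ[ℂ] A := LinearMap.snd ℂ SBar A

/-- The bracket of `s̃`: for homogeneous elements, `[x, y]` is the bracket of `s̄` for `x, y ∈ s̄`,
`[x, a] = x ∘ a` and `[a, x] = -(-1)^{|x||a|} x ∘ a` for `x ∈ s̄`, `a ∈ A`, and `[A, A] = 0`. -/
def STilde.bracket : STilde →ₗ[ℂ] STilde →ₗ[ℂ] STilde :=
  (SBar.bracket.compl₁₂ prS prS).compr₂ inS + (act.compl₁₂ prS prA).compr₂ inA +
    ((-signedAct.flip).compl₁₂ prA prS).compr₂ inA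

theorem STilde.bracket_apply (x y : STilde) : STilde.bracket x y =
    ((SBar.bracket x.1 y.1, act x.1 y.2 - signedAct y.1 x.2) : SBar × A) := by
  refine Prod.ext ?_ ?_
  · change SBar.bracket x.1 y.1 + 0 + 0 = _
    rw [add_zero, add_zero]
  · change 0 + act x.1 y.2 + -signedAct y.1 x.2 = _
    rw [zero_add, sub_eq_add_neg]

/-- The homogeneous components `s̃_i = s̄_i ⊕ A_i`. -/
def STilde.part (i : ZMod 2) : Submodule ℂ STilde := (SBar.part i).prod (A.part i)

theorem STilde.bracket_hom {i j : ZMod 2} {x y : STilde} (hx : x ∈ STilde.part i)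
    (hy : y ∈ STilde.part j) : STilde.bracket x y =
    ((SBar.bracket x.1 y.1, act x.1 y.2 - koszul i j • act y.1 x.2) : SBar × A) := by
  rw [STilde.bracket_apply, signedAct_apply j i y.1 x.2 hy.1 hx.2, koszul, mul_comm j i, ← koszul]

theorem STilde.isCompl : IsCompl (STilde.part 0) (STilde.part 1) := by
  constructor
  · rw [Submodule.disjoint_def]
    intro x h0 h1
    exact Prod.ext (Submodule.disjoint_def.1 SBar.isCompl.disjoint _ h0.1 h1.1)
      (Submodule.disjoint_def.1 A_isCompl.disjoint _ h0.2 h1.2)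
  · rw [codisjoint_iff, eq_top_iff]
    rintro x -
    have h1 : x.1 ∈ SBar.part 0 ⊔ SBar.part 1 := by rw [SBar.isCompl.sup_eq_top]; trivial
    have h2 : x.2 ∈ A.part 0 ⊔ A.part 1 := by rw [A_isCompl.sup_eq_top]; trivial
    obtain ⟨y, hy, z, hz, h⟩ := Submodule.mem_sup.1 h1
    obtain ⟨a, ha, b, hb, h'⟩ := Submodule.mem_sup.1 h2
    exact Submodule.mem_sup.2 ⟨((y, a) : SBar × A), ⟨hy, ha⟩, ((z, b) : SBar × A), ⟨hz, hb⟩,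
      Prod.ext h h'⟩

theorem STilde.bracket_mem (i j : ZMod 2) (x y : STilde) (hx : x ∈ STilde.part i)
    (hy : y ∈ STilde.part j) : STilde.bracket x y ∈ STilde.part (i + j) := by
  rw [STilde.bracket_hom hx hy]
  exact ⟨SBar.bracket_mem i j _ _ hx.1 hy.1, sub_mem (act_mem i j _ _ hx.1 hy.2)
    (Submodule.smul_mem _ _ (add_comm i j ▸ act_mem j i _ _ hy.1 hx.2))⟩

theorem STilde.skew (i j : ZMod 2) (x y : STilde) (hx : x ∈ STilde.part i)
    (hy : y ∈ STilde.part j) : STilde.bracket x y = -(koszul i j • STilde.bracket y x) := by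
  rw [STilde.bracket_hom hx hy, STilde.bracket_hom hy hx]
  refine Prod.ext (SBar.skew i j _ _ hx.1 hy.1) ?_
  change act x.1 y.2 - koszul i j • act y.1 x.2 =
    -(koszul i j • (act y.1 x.2 - koszul j i • act x.1 y.2))
  rcases parity_cases i with rfl | rfl <;> rcases parity_cases j with rfl | rfl <;>
    simp only [koszul_zero_left, koszul_zero_right, koszul_one_one] <;> module

theorem STilde.jacobi (i j : ZMod 2) (x y z : STilde) (hx : x ∈ STilde.part i)
    (hy : y ∈ STilde.part j) : STilde.bracket x (STilde.bracket y z) =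
      STilde.bracket (STilde.bracket x y) z + koszul i j • STilde.bracket y (STilde.bracket x z) := by
  have key : ∀ (k : ZMod 2) (z : STilde), z ∈ STilde.part k →
      STilde.bracket x (STilde.bracket y z) = STilde.bracket (STilde.bracket x y) z +
        koszul i j • STilde.bracket y (STilde.bracket x z) := by
    intro k z hz
    rw [STilde.bracket_hom hx (STilde.bracket_mem j k y z hy hz),
      STilde.bracket_hom (STilde.bracket_mem i j x y hx hy) hz,
      STilde.bracket_hom hy (STilde.bracket_mem i k x z hx hz),
      STilde.bracket_hom hx hy, STilde.bracket_hom hy hz, STilde.bracket_hom hx hz]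
    refine Prod.ext (SBar.jacobi i j x.1 y.1 z.1 hx.1 hy.1) ?_
    change act x.1 (act y.1 z.2 - koszul j k • act z.1 y.2) -
        koszul i (j + k) • act (SBar.bracket y.1 z.1) x.2 =
      act (SBar.bracket x.1 y.1) z.2 -
        koszul (i + j) k • act z.1 (act x.1 y.2 - koszul i j • act y.1 x.2) +
      koszul i j • (act y.1 (act x.1 z.2 - koszul i k • act z.1 x.2) -
        koszul j (i + k) • act (SBar.bracket x.1 z.1) y.2)
    rw [act_bracket i j _ _ hx.1 hy.1, act_bracket j k _ _ hy.1 hz.1, act_bracket i k _ _ hx.1 hz.1]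
    have h11 : (1 + 1 : ZMod 2) = 0 := rfl
    rcases parity_cases i with rfl | rfl <;> rcases parity_cases j with rfl | rfl <;>
      rcases parity_cases k with rfl | rfl <;>
      simp only [koszul_zero_left, koszul_zero_right, koszul_one_one, h11, add_zero, zero_add,
        map_sub, map_smul] <;> module
  have hz : z ∈ STilde.part 0 ⊔ STilde.part 1 := by rw [STilde.isCompl.sup_eq_top]; trivial
  obtain ⟨u, hu, v, hv, rfl⟩ := Submodule.mem_sup.1 hz
  simp only [map_add, smul_add, key 0 u hu, key 1 v hv]
  abel

/-- The Lie superalgebra `s̃ = s̄ ⋉ A`. -/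
instance : LieSuperalgebra STilde where
  part := STilde.part
  isCompl := STilde.isCompl
  bracket := STilde.bracket
  bracket_mem := STilde.bracket_mem
  skew := STilde.skew
  jacobi := STilde.jacobi

/-! ### The quotient `Ū` of `U(s̃)` -/

/-- `U = U(s̃)`. -/
abbrev U : Type := SuperUEA STilde

/-- The image of `L_n` in `U`. -/
def uL (n : ℤ) : U := SuperUEA.ι (STilde.inS (SBar.L n))

/-- The image of `G_n` in `U`. -/
def uG (n : ℤ) : U := SuperUEA.ι (STilde.inS (SBar.G n))

/-- The image of `a ∈ A` in `U`. -/
def uA (a : A) : U := SuperUEA.ι (STilde.inA a)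

/-- The generators `t^i · t^j - t^{i+j}`, `t^0 - 1`, `t^i · ξ - t^i ξ`, `ξ · ξ` of `I`; the dot is
the product of `U`. -/
def relatorSet : Set U :=
  {u | (∃ i j : ℤ, u = uA (tPow i) * uA (tPow j) - uA (tPow (i + j))) ∨
    u = uA (tPow 0) - 1 ∨
    (∃ i : ℤ, u = uA (tPow i) * uA (tXi 0) - uA (tXi i)) ∨
    u = uA (tXi 0) * uA (tXi 0)}

/-- The left ideal `I` of `U` generated by the relators. -/
def relatorIdeal : Ideal U := Ideal.span relatorSet

theorem STilde.L_mem (n : ℤ) : STilde.inS (SBar.L n) ∈ LieSuperalgebra.part (L := STilde) 0 :=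
  ⟨SBar.L_mem n, zero_mem (A.part 0)⟩

theorem STilde.G_mem (n : ℤ) : STilde.inS (SBar.G n) ∈ LieSuperalgebra.part (L := STilde) 1 :=
  ⟨SBar.G_mem n, zero_mem (A.part 1)⟩

theorem STilde.tPow_mem (n : ℤ) : STilde.inA (tPow n) ∈ LieSuperalgebra.part (L := STilde) 0 :=
  ⟨zero_mem (SBar.part 0), Ramond.tPow_mem n⟩

theorem STilde.tXi_mem (n : ℤ) : STilde.inA (tXi n) ∈ LieSuperalgebra.part (L := STilde) 1 :=
  ⟨zero_mem (SBar.part 1), Ramond.tXi_mem n⟩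

theorem STilde.bracket_S_S (x y : SBar) :
    LieSuperalgebra.bracket (STilde.inS x) (STilde.inS y) = STilde.inS (SBar.bracket x y) := by
  refine (STilde.bracket_apply _ _).trans (Prod.ext rfl ?_)
  change act x 0 - signedAct y 0 = 0
  rw [map_zero, map_zero, sub_zero]

theorem STilde.bracket_S_A (x : SBar) (a : A) :
    LieSuperalgebra.bracket (STilde.inS x) (STilde.inA a) = STilde.inA (act x a) := by
  refine (STilde.bracket_apply _ _).trans (Prod.ext ?_ ?_)
  · change SBar.bracket x 0 = 0
    rw [map_zero]
  · change act x a - signedAct 0 0 = act x a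
    rw [map_zero, sub_zero]

theorem STilde.bracket_A_A (a b : A) :
    LieSuperalgebra.bracket (STilde.inA a) (STilde.inA b) = 0 := by
  refine (STilde.bracket_apply _ _).trans (Prod.ext ?_ ?_)
  · change SBar.bracket 0 0 = 0
    rw [map_zero]
  · change act 0 b - signedAct 0 a = 0
    rw [map_zero, map_zero, LinearMap.zero_apply, LinearMap.zero_apply, sub_zero]

theorem uA_smul (c : ℂ) (a : A) : uA (c • a) = c • uA a := by simp [uA]

theorem uA_neg (a : A) : uA (-a) = -uA a := by simp [uA]

theorem uL_uL (m n : ℤ) : uL m * uL n = uL n * uL m + ((n : ℂ) - m) • uL (m + n) := by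
  have h := SuperUEA.ι_mul_ι (STilde.L_mem m) (STilde.L_mem n)
  rw [koszul_zero_left, one_smul, STilde.bracket_S_S, SBar.bracket_L_L, map_smul, map_smul] at h
  exact h

theorem uL_uG (m n : ℤ) : uL m * uG n = uG n * uL m + ((n : ℂ) - m / 2) • uG (m + n) := by
  have h := SuperUEA.ι_mul_ι (STilde.L_mem m) (STilde.G_mem n)
  rw [koszul_zero_left, one_smul, STilde.bracket_S_S, SBar.bracket_L_G, map_smul, map_smul] at h
  exact h

theorem uG_uG (m n : ℤ) : uG m * uG n = -(uG n * uG m) + (-2 : ℂ) • uL (m + n) := by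
  have h := SuperUEA.ι_mul_ι (STilde.G_mem m) (STilde.G_mem n)
  rw [koszul_one_one, neg_smul, one_smul, STilde.bracket_S_S, SBar.bracket_G_G, map_smul,
    map_smul] at h
  exact h

theorem uL_tPow (m i : ℤ) :
    uL m * uA (tPow i) = uA (tPow i) * uL m + (i : ℂ) • uA (tPow (m + i)) := by
  have h := SuperUEA.ι_mul_ι (STilde.L_mem m) (STilde.tPow_mem i)
  rw [koszul_zero_left, one_smul, STilde.bracket_S_A, act_L, actL_tPow, map_smul, map_smul] at h
  exact h

theorem uL_tXi (m i : ℤ) :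
    uL m * uA (tXi i) = uA (tXi i) * uL m + ((i : ℂ) + m / 2) • uA (tXi (m + i)) := by
  have h := SuperUEA.ι_mul_ι (STilde.L_mem m) (STilde.tXi_mem i)
  rw [koszul_zero_left, one_smul, STilde.bracket_S_A, act_L, actL_tXi, map_smul, map_smul] at h
  exact h

theorem uG_tPow (m i : ℤ) :
    uG m * uA (tPow i) = uA (tPow i) * uG m + (i : ℂ) • uA (tXi (m + i)) := by
  have h := SuperUEA.ι_mul_ι (STilde.G_mem m) (STilde.tPow_mem i)
  rw [koszul_zero_right, one_smul, STilde.bracket_S_A, act_G, actG_tPow, map_smul, map_smul] at h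
  exact h

theorem uG_tXi (m i : ℤ) :
    uG m * uA (tXi i) = -(uA (tXi i) * uG m) - uA (tPow (m + i)) := by
  have h := SuperUEA.ι_mul_ι (STilde.G_mem m) (STilde.tXi_mem i)
  rw [koszul_one_one, neg_smul, one_smul, STilde.bracket_S_A, act_G, actG_tXi, map_neg, map_neg,
    ← sub_eq_add_neg] at h
  exact h

theorem tPow_tPow_comm (i j : ℤ) : uA (tPow i) * uA (tPow j) = uA (tPow j) * uA (tPow i) := by
  have h := SuperUEA.ι_mul_ι (STilde.tPow_mem i) (STilde.tPow_mem j)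
  rw [koszul_zero_right, one_smul, STilde.bracket_A_A, map_zero, add_zero] at h
  exact h

theorem tXi_tPow_comm (i j : ℤ) : uA (tXi i) * uA (tPow j) = uA (tPow j) * uA (tXi i) := by
  have h := SuperUEA.ι_mul_ι (STilde.tXi_mem i) (STilde.tPow_mem j)
  rw [koszul_zero_right, one_smul, STilde.bracket_A_A, map_zero, add_zero] at h
  exact h

theorem tXi_tXi_comm (i j : ℤ) : uA (tXi i) * uA (tXi j) = -(uA (tXi j) * uA (tXi i)) := by
  have h := SuperUEA.ι_mul_ι (STilde.tXi_mem i) (STilde.tXi_mem j)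
  rw [koszul_one_one, neg_smul, one_smul, STilde.bracket_A_A, map_zero, add_zero] at h
  exact h

theorem relC (i j : ℤ) : uA (tPow i) * uA (tPow j) - uA (tPow (i + j)) ∈ relatorIdeal :=
  Ideal.subset_span (Or.inl ⟨i, j, rfl⟩)

theorem relD : uA (tPow 0) - 1 ∈ relatorIdeal :=
  Ideal.subset_span (Or.inr (Or.inl rfl))

theorem relE (i : ℤ) : uA (tPow i) * uA (tXi 0) - uA (tXi i) ∈ relatorIdeal :=
  Ideal.subset_span (Or.inr (Or.inr (Or.inl ⟨i, rfl⟩)))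

theorem relF : uA (tXi 0) * uA (tXi 0) = 0 := by
  have h := tXi_tXi_comm 0 0
  have h2 : (2 : ℂ) • (uA (tXi 0) * uA (tXi 0)) = 0 := by
    rw [two_smul]; nth_rewrite 1 [h]; rw [neg_add_cancel]
  exact (smul_eq_zero.1 h2).resolve_left two_ne_zero

theorem relH (i j : ℤ) : uA (tPow i) * uA (tXi j) - uA (tXi (i + j)) ∈ relatorIdeal := by
  have e : uA (tPow i) * uA (tXi j) - uA (tXi (i + j)) =
      -(uA (tPow i) * (uA (tPow j) * uA (tXi 0) - uA (tXi j))) +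
      uA (tXi 0) * (uA (tPow i) * uA (tPow j) - uA (tPow (i + j))) +
      (uA (tPow (i + j)) * uA (tXi 0) - uA (tXi (i + j))) := by
    simp only [mul_sub, ← mul_assoc, tXi_tPow_comm 0]
    rw [mul_assoc (uA (tPow i)) (uA (tXi 0)), tXi_tPow_comm 0 j]
    noncomm_ring
  rw [e]
  exact add_mem (add_mem (neg_mem (Ideal.mul_mem_left _ _ (relE j)))
    (Ideal.mul_mem_left _ _ (relC i j))) (relE (i + j))

theorem relK (i : ℤ) : uA (tXi i) * uA (tXi 0) ∈ relatorIdeal := by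
  have e : uA (tXi i) * uA (tXi 0) = uA (tXi 0) * (uA (tPow i) * uA (tXi 0) - uA (tXi i)) := by
    rw [mul_sub, ← mul_assoc, tXi_tPow_comm, mul_assoc, relF, mul_zero, zero_sub, tXi_tXi_comm]
  rw [e]
  exact Ideal.mul_mem_left _ _ (relE i)

theorem smul_mem_relatorIdeal (c : ℂ) {u : U} (hu : u ∈ relatorIdeal) : c • u ∈ relatorIdeal := by
  rw [Algebra.smul_def]; exact Ideal.mul_mem_left _ _ hu

/-- Linear maps on `s̃` are determined by their values on `L_n`, `G_n`, `t^i`, `t^i ξ`. -/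
theorem STilde.hom_ext {M : Type} [AddCommGroup M] [Module ℂ M] {f g : STilde →ₗ[ℂ] M}
    (h0 : ∀ n, f (STilde.inS (SBar.L n)) = g (STilde.inS (SBar.L n)))
    (h1 : ∀ n, f (STilde.inS (SBar.G n)) = g (STilde.inS (SBar.G n)))
    (h2 : ∀ n, f (STilde.inA (tPow n)) = g (STilde.inA (tPow n)))
    (h3 : ∀ n, f (STilde.inA (tXi n)) = g (STilde.inA (tXi n))) : f = g := by
  have e0 : f ∘ₗ STilde.inS = g ∘ₗ STilde.inS := SBar.hom_ext h0 h1
  have e1 : f ∘ₗ STilde.inA = g ∘ₗ STilde.inA := A_hom_ext h2 h3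
  refine LinearMap.ext fun x => ?_
  have hx : x = STilde.inS (STilde.prS x) + STilde.inA (STilde.prA x) := by
    refine Prod.ext ?_ ?_
    · exact (add_zero _).symm
    · exact (zero_add _).symm
  rw [hx, map_add, map_add]
  exact congrArg₂ (· + ·) (LinearMap.congr_fun e0 _) (LinearMap.congr_fun e1 _)

/-- Right multiplication by generators preserves the relators modulo `I`. -/
theorem relator_mul_gen {s : U} (hs : s ∈ relatorSet) :
    (∀ n, s * uL n ∈ relatorIdeal) ∧ (∀ n, s * uG n ∈ relatorIdeal) ∧
    (∀ n, s * uA (tPow n) ∈ relatorIdeal) ∧ (∀ n, s * uA (tXi n) ∈ relatorIdeal) := by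
  have hs' : s ∈ relatorIdeal := Ideal.subset_span hs
  have comm : ∀ v : U, s * v = v * s → s * v ∈ relatorIdeal := fun v h => by
    rw [h]; exact Ideal.mul_mem_left _ _ hs'
  have acomm : ∀ v : U, s * v = -(v * s) → s * v ∈ relatorIdeal := fun v h => by
    rw [h]; exact neg_mem (Ideal.mul_mem_left _ _ hs')
  rcases hs with ⟨i, j, rfl⟩ | rfl | ⟨i, rfl⟩ | rfl
  · refine ⟨fun n => ?_, fun n => ?_, fun n => comm _ ?_, fun n => comm _ ?_⟩
    · have e : (uA (tPow i) * uA (tPow j) - uA (tPow (i + j))) * uL n =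
          uL n * (uA (tPow i) * uA (tPow j) - uA (tPow (i + j))) -
          (i : ℂ) • (uA (tPow (n + i)) * uA (tPow j) - uA (tPow (n + i + j))) -
          (j : ℂ) • (uA (tPow i) * uA (tPow (n + j)) - uA (tPow (i + (n + j)))) := by
        rw [mul_sub, ← mul_assoc, uL_tPow, uL_tPow, add_mul, mul_assoc _ (uL n), uL_tPow, mul_add,
          sub_mul, mul_smul_comm, smul_mul_assoc, ← mul_assoc, ← add_assoc n i j,
          show i + (n + j) = n + i + j by ring]
        push_cast
        module
      rw [e]
      exact sub_mem (sub_mem (Ideal.mul_mem_left _ _ hs') (smul_mem_relatorIdeal _ (relC _ _)))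
        (smul_mem_relatorIdeal _ (relC _ _))
    · have e : (uA (tPow i) * uA (tPow j) - uA (tPow (i + j))) * uG n =
          uG n * (uA (tPow i) * uA (tPow j) - uA (tPow (i + j))) -
          (i : ℂ) • (uA (tPow j) * uA (tXi (n + i)) - uA (tXi (j + (n + i)))) -
          (j : ℂ) • (uA (tPow i) * uA (tXi (n + j)) - uA (tXi (i + (n + j)))) := by
        rw [mul_sub, ← mul_assoc, uG_tPow, uG_tPow, add_mul, mul_assoc _ (uG n), uG_tPow, mul_add,
          sub_mul, mul_smul_comm, smul_mul_assoc, ← mul_assoc, ← add_assoc n i j,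
          show i + (n + j) = n + i + j by ring, show j + (n + i) = n + i + j by ring,
          tXi_tPow_comm]
        push_cast
        module
      rw [e]
      exact sub_mem (sub_mem (Ideal.mul_mem_left _ _ hs') (smul_mem_relatorIdeal _ (relH _ _)))
        (smul_mem_relatorIdeal _ (relH _ _))
    · rw [sub_mul, mul_sub, mul_assoc, tPow_tPow_comm j n, ← mul_assoc, tPow_tPow_comm i n,
        tPow_tPow_comm (i + j) n, mul_assoc]
    · rw [sub_mul, mul_sub, mul_assoc, ← tXi_tPow_comm n j, ← mul_assoc, ← tXi_tPow_comm n i,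
        ← tXi_tPow_comm n (i + j), mul_assoc]
  · refine ⟨fun n => comm _ ?_, fun n => comm _ ?_, fun n => comm _ ?_, fun n => comm _ ?_⟩
    · rw [mul_sub, uL_tPow, Int.cast_zero, zero_smul, add_zero, sub_mul, mul_one, one_mul]
    · rw [mul_sub, uG_tPow, Int.cast_zero, zero_smul, add_zero, sub_mul, mul_one, one_mul]
    · rw [mul_sub, tPow_tPow_comm n, sub_mul, mul_one, one_mul]
    · rw [mul_sub, tXi_tPow_comm n, sub_mul, mul_one, one_mul]
  · refine ⟨fun n => ?_, fun n => ?_, fun n => comm _ ?_, fun n => acomm _ ?_⟩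
    · have e : (uA (tPow i) * uA (tXi 0) - uA (tXi i)) * uL n =
          uL n * (uA (tPow i) * uA (tXi 0) - uA (tXi i)) -
          (i : ℂ) • (uA (tPow (n + i)) * uA (tXi 0) - uA (tXi (n + i))) -
          ((n : ℂ) / 2) • (uA (tPow i) * uA (tXi n) - uA (tXi (i + n))) := by
        rw [mul_sub, ← mul_assoc, uL_tPow, uL_tXi, add_mul, mul_assoc _ (uL n), uL_tXi, mul_add,
          sub_mul, mul_smul_comm, smul_mul_assoc, ← mul_assoc, add_zero, add_comm i n]
        push_cast
        module
      rw [e]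
      exact sub_mem (sub_mem (Ideal.mul_mem_left _ _ hs') (smul_mem_relatorIdeal _ (relE _)))
        (smul_mem_relatorIdeal _ (relH _ _))
    · have e : (uA (tPow i) * uA (tXi 0) - uA (tXi i)) * uG n =
          -(uG n * (uA (tPow i) * uA (tXi 0) - uA (tXi i))) +
          (i : ℂ) • (uA (tXi (n + i)) * uA (tXi 0)) -
          (uA (tPow i) * uA (tPow n) - uA (tPow (i + n))) := by
        rw [mul_sub, ← mul_assoc, uG_tPow, uG_tXi, add_mul, mul_assoc _ (uG n), uG_tXi, mul_sub,
          sub_mul, smul_mul_assoc, mul_neg, ← mul_assoc, add_zero, add_comm i n]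
        module
      rw [e]
      exact sub_mem (add_mem (neg_mem (Ideal.mul_mem_left _ _ hs'))
        (smul_mem_relatorIdeal _ (relK _))) (relC _ _)
    · rw [sub_mul, mul_sub, mul_assoc, tXi_tPow_comm 0 n, ← mul_assoc, tPow_tPow_comm i n,
        tXi_tPow_comm i n, mul_assoc]
    · rw [sub_mul, mul_sub, mul_assoc, tXi_tXi_comm 0 n, mul_neg, ← mul_assoc, ← tXi_tPow_comm n i,
        tXi_tXi_comm i n, mul_assoc]
      abel
  · simp only [relF, zero_mul, zero_mem, implies_true, and_self]

/-- The left ideal `I` is a two-sided ideal. -/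
instance : relatorIdeal.IsTwoSided := by
  have hι : ∀ s ∈ relatorSet, ∀ x : STilde, s * SuperUEA.ι x ∈ relatorIdeal := by
    intro s hs x
    obtain ⟨h0, h1, h2, h3⟩ := relator_mul_gen hs
    have e := STilde.hom_ext (f := (relatorIdeal.restrictScalars ℂ).mkQ ∘ₗ
      LinearMap.mulLeft ℂ s ∘ₗ SuperUEA.ι) (g := 0)
      (fun n => (Submodule.Quotient.mk_eq_zero _).2 (h0 n))
      (fun n => (Submodule.Quotient.mk_eq_zero _).2 (h1 n))
      (fun n => (Submodule.Quotient.mk_eq_zero _).2 (h2 n))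
      (fun n => (Submodule.Quotient.mk_eq_zero _).2 (h3 n))
    exact (Submodule.Quotient.mk_eq_zero _).1 (LinearMap.congr_fun e x)
  have hι' : ∀ x : STilde, ∀ a ∈ relatorIdeal, a * SuperUEA.ι x ∈ relatorIdeal := by
    intro x a ha
    induction ha using Submodule.span_induction with
    | mem s hs => exact hι s hs x
    | zero => rw [zero_mul]; exact zero_mem _
    | add a b _ _ ha hb => rw [add_mul]; exact add_mem ha hb
    | smul c a _ ha => rw [smul_eq_mul, mul_assoc]; exact Ideal.mul_mem_left _ _ ha
  have main : ∀ u : U, ∀ a ∈ relatorIdeal, a * u ∈ relatorIdeal := by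
    intro u
    have hu : u ∈ Algebra.adjoin ℂ (Set.range (SuperUEA.ι (L := STilde))) := by
      rw [SuperUEA.adjoin_ι]; trivial
    induction hu using Algebra.adjoin_induction with
    | mem u hu => obtain ⟨x, rfl⟩ := hu; exact hι' x
    | algebraMap c =>
      intro a ha
      rw [← Algebra.commutes]; exact Ideal.mul_mem_left _ _ ha
    | add u v _ _ hu hv => intro a ha; rw [mul_add]; exact add_mem (hu a ha) (hv a ha)
    | mul u v _ _ hu hv => intro a ha; rw [← mul_assoc]; exact hv _ (hu a ha)
  exact ⟨fun {a} b ha => main b a ha⟩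

/-- `Ū = U / I`. -/
def UBar : Type := U ⧸ relatorIdeal

instance : Ring UBar := inferInstanceAs (Ring (U ⧸ relatorIdeal))

instance : Algebra ℂ UBar := inferInstanceAs (Algebra ℂ (U ⧸ relatorIdeal))

/-- The projection `U → Ū`. -/
def toUBar : U →ₐ[ℂ] UBar := Ideal.Quotient.mkₐ ℂ relatorIdeal

theorem toUBar_surjective : Function.Surjective toUBar := Ideal.Quotient.mkₐ_surjective ℂ _

theorem toUBar_eq_zero {u : U} (hu : u ∈ relatorIdeal) : toUBar u = 0 :=
  Ideal.Quotient.eq_zero_iff_mem.2 hu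

theorem parityHom_uA_tPow (i : ℤ) : SuperUEA.parityHom STilde (uA (tPow i)) = uA (tPow i) := by
  rw [uA, SuperUEA.parityHom_ι, LieSuperalgebra.parity_even (STilde.tPow_mem i)]

theorem parityHom_uA_tXi (i : ℤ) : SuperUEA.parityHom STilde (uA (tXi i)) = -uA (tXi i) := by
  rw [uA, SuperUEA.parityHom_ι, LieSuperalgebra.parity_odd (STilde.tXi_mem i), map_neg]

theorem parityHom_mem {u : U} (hu : u ∈ relatorIdeal) :
    SuperUEA.parityHom STilde u ∈ relatorIdeal := by
  induction hu using Submodule.span_induction with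
  | mem s hs =>
    rcases hs with ⟨i, j, rfl⟩ | rfl | ⟨i, rfl⟩ | rfl
    · simp only [map_sub, map_mul, parityHom_uA_tPow]; exact relC i j
    · simp only [map_sub, map_one, parityHom_uA_tPow]; exact relD
    · simp only [map_sub, map_mul, parityHom_uA_tPow, parityHom_uA_tXi]
      rw [mul_neg, ← neg_sub', ]; exact neg_mem (relE i)
    · simp only [relF, map_zero, zero_mem]
  | zero => rw [map_zero]; exact zero_mem _
  | add a b _ _ ha hb => rw [map_add]; exact add_mem ha hb
  | smul c a _ ha => rw [smul_eq_mul, map_mul]; exact Ideal.mul_mem_left _ _ ha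

/-- The parity automorphism of `Ū`, induced by that of `U`. -/
def UBar.parityHom : UBar →ₐ[ℂ] UBar :=
  Ideal.Quotient.liftₐ relatorIdeal (toUBar.comp (SuperUEA.parityHom STilde))
    (fun _ hu => toUBar_eq_zero (parityHom_mem hu))

theorem UBar.parityHom_toUBar (u : U) :
    UBar.parityHom (toUBar u) = toUBar (SuperUEA.parityHom STilde u) := rfl

theorem UBar.parityHom_parityHom (b : UBar) : UBar.parityHom (UBar.parityHom b) = b := by
  obtain ⟨u, rfl⟩ := toUBar_surjective b
  rw [UBar.parityHom_toUBar, UBar.parityHom_toUBar, SuperUEA.parityHom_parityHom]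

/-- The superalgebra structure of `Ū`, inherited from `U`. -/
def UBar.part : ZMod 2 → Submodule ℂ UBar := parityPart UBar.parityHom

instance : GradedAlgebra UBar.part := parityGradedAlgebra _ UBar.parityHom_parityHom

/-- `Ū` as a Lie superalgebra under the supercommutator. -/
instance : LieSuperalgebra UBar := LieSuperalgebra.ofGradedAlgebra UBar.part

/-- The image of `L_n` in `Ū`. -/
def bL (n : ℤ) : UBar := toUBar (uL n)

/-- The image of `G_n` in `Ū`. -/
def bG (n : ℤ) : UBar := toUBar (uG n)

/-- The image of `t^n` in `Ū`. -/
def bT (n : ℤ) : UBar := toUBar (uA (tPow n))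

/-- The image of `t^n ξ` in `Ū`. -/
def bXi (n : ℤ) : UBar := toUBar (uA (tXi n))

/-- `X_m = t^{-m} · L_m + (m/2) t^{-m} ξ · G_m - L_0`. -/
def X (m : ℤ) : UBar := bT (-m) * bL m + ((m : ℂ) / 2) • (bXi (-m) * bG m) - bL 0

/-- `Y_m = t^{-m} · G_m - 2 t^{-m} ξ · L_m - G_0 + 2 ξ · L_0`. -/
def Y (m : ℤ) : UBar :=
  bT (-m) * bG m - (2 : ℂ) • (bXi (-m) * bL m) - bG 0 + (2 : ℂ) • (bXi 0 * bL 0)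

/-- The subspace `𝒯` of `Ū` spanned by the `X_m`, `Y_m` with `m ≠ 0`. -/
def Tau : Submodule ℂ UBar :=
  Submodule.span ℂ ({u | ∃ m : ℤ, m ≠ 0 ∧ u = X m} ∪ {u | ∃ m : ℤ, m ≠ 0 ∧ u = Y m})

theorem bL_bL (m n : ℤ) : bL m * bL n = bL n * bL m + ((n : ℂ) - m) • bL (m + n) := by
  have h := congrArg toUBar (uL_uL m n)
  simp only [map_mul, map_add, map_smul] at h
  exact h

theorem bL_bG (m n : ℤ) : bL m * bG n = bG n * bL m + ((n : ℂ) - m / 2) • bG (m + n) := by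
  have h := congrArg toUBar (uL_uG m n)
  simp only [map_mul, map_add, map_smul] at h
  exact h

theorem bG_bG (m n : ℤ) : bG m * bG n = -(bG n * bG m) + (-2 : ℂ) • bL (m + n) := by
  have h := congrArg toUBar (uG_uG m n)
  simp only [map_mul, map_add, map_smul, map_neg] at h
  exact h

theorem bL_bT (m i : ℤ) : bL m * bT i = bT i * bL m + (i : ℂ) • bT (m + i) := by
  have h := congrArg toUBar (uL_tPow m i)
  simp only [map_mul, map_add, map_smul] at h
  exact h

theorem bL_bXi (m i : ℤ) : bL m * bXi i = bXi i * bL m + ((i : ℂ) + m / 2) • bXi (m + i) := by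
  have h := congrArg toUBar (uL_tXi m i)
  simp only [map_mul, map_add, map_smul] at h
  exact h

theorem bG_bT (m i : ℤ) : bG m * bT i = bT i * bG m + (i : ℂ) • bXi (m + i) := by
  have h := congrArg toUBar (uG_tPow m i)
  simp only [map_mul, map_add, map_smul] at h
  exact h

theorem bG_bXi (m i : ℤ) : bG m * bXi i = -(bXi i * bG m) - bT (m + i) := by
  have h := congrArg toUBar (uG_tXi m i)
  simp only [map_mul, map_sub, map_neg] at h
  exact h

theorem bT_bT (i j : ℤ) : bT i * bT j = bT (i + j) := by
  have h := toUBar_eq_zero (relC i j)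
  rw [map_sub, map_mul] at h
  exact sub_eq_zero.1 h

theorem bT_bXi (i j : ℤ) : bT i * bXi j = bXi (i + j) := by
  have h := toUBar_eq_zero (relH i j)
  rw [map_sub, map_mul] at h
  exact sub_eq_zero.1 h

theorem bXi_bT (i j : ℤ) : bXi i * bT j = bXi (i + j) := by
  have h := congrArg toUBar (tXi_tPow_comm i j)
  rw [map_mul, map_mul] at h
  rw [add_comm, ← bT_bXi]; exact h

theorem bXi_bXi (i j : ℤ) : bXi i * bXi j = 0 := by
  have h := toUBar_eq_zero (relK i)
  rw [map_mul] at h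
  change bXi i * bXi 0 = 0 at h
  rw [← add_zero j, ← bT_bXi j 0, ← mul_assoc, bXi_bT, add_comm, ← bT_bXi, mul_assoc, h, mul_zero]

theorem bT_zero : bT 0 = 1 := by
  have h := toUBar_eq_zero relD
  rw [map_sub, map_one] at h
  exact sub_eq_zero.1 h

theorem X_zero : X 0 = 0 := by
  simp [X, bT_zero]

theorem Y_zero : Y 0 = 0 := by
  simp [Y, bT_zero]

theorem X_bT (m n : ℤ) : X m * bT n = bT n * X m := by
  simp only [X, sub_mul, add_mul, mul_sub, mul_add, smul_mul_assoc, mul_smul_comm, mul_assoc, bL_bT,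
    bG_bT]
  simp only [← mul_assoc, bT_bT, bXi_bT, bT_bXi, bXi_bXi, smul_zero, add_zero,
    add_comm n (-m), neg_add_cancel_left, zero_add]
  module

theorem X_bXi (m n : ℤ) : X m * bXi n = bXi n * X m := by
  simp only [X, sub_mul, add_mul, mul_sub, mul_add, smul_mul_assoc, mul_smul_comm, mul_assoc, bL_bXi,
    bG_bXi]
  simp only [← mul_assoc, bXi_bT, bT_bXi, bXi_bXi, smul_zero, add_zero, mul_neg, zero_mul,
    add_comm n (-m), neg_add_cancel_left, zero_add, neg_zero, zero_sub]
  push_cast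
  module

theorem Y_bT (m n : ℤ) : Y m * bT n = bT n * Y m := by
  simp only [Y, sub_mul, add_mul, mul_sub, mul_add, smul_mul_assoc, mul_smul_comm, mul_assoc, bL_bT,
    bG_bT]
  simp only [← mul_assoc, bT_bT, bXi_bT, bT_bXi, add_zero,
    add_comm n (-m), neg_add_cancel_left, zero_add]
  module

theorem Y_bXi (m n : ℤ) : Y m * bXi n = -(bXi n * Y m) := by
  simp only [Y, sub_mul, add_mul, mul_sub, mul_add, smul_mul_assoc, mul_smul_comm, mul_assoc, bL_bXi,
    bG_bXi]
  simp only [← mul_assoc, bT_bT, bXi_bT, bT_bXi, bXi_bXi, smul_zero, add_zero, mul_neg, zero_mul,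
    add_comm n (-m), neg_add_cancel_left, zero_add]
  module

theorem X_bL (m n : ℤ) : X m * bL n - bL n * X m =
    ((n : ℂ) - m) • (bT (-m) * bL (m + n)) + (m : ℂ) • (bT (n + -m) * bL m) +
    ((m : ℂ) / 2) • ((-((m : ℂ) - n / 2)) • (bXi (-m) * bG (m + n)) +
      ((m : ℂ) - n / 2) • (bXi (n + -m) * bG m)) - (n : ℂ) • bL n := by
  have h1 : bG m * bL n = bL n * bG m - ((m : ℂ) - n / 2) • bG (m + n) := by
    rw [bL_bG n m, add_comm n m]; abel
  have h2 : bL 0 * bL n = bL n * bL 0 + (n : ℂ) • bL n := by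
    rw [bL_bL 0 n, zero_add, Int.cast_zero, sub_zero]
  simp only [X, sub_mul, add_mul, mul_sub, mul_add, smul_mul_assoc, mul_smul_comm, mul_assoc,
    h1, h2, bL_bL m n]
  simp only [← mul_assoc, bL_bT, bL_bXi, add_mul, smul_mul_assoc]
  push_cast
  module

theorem X_bG (m n : ℤ) : X m * bG n - bG n * X m =
    ((n : ℂ) - m / 2) • (bT (-m) * bG (m + n)) + (m : ℂ) • (bXi (n + -m) * bL m) +
    ((m : ℂ) / 2) • ((-2 : ℂ) • (bXi (-m) * bL (m + n)) + bT (n + -m) * bG m) - (n : ℂ) • bG n := by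
  have h2 : bL 0 * bG n = bG n * bL 0 + (n : ℂ) • bG n := by
    rw [bL_bG 0 n, zero_add, Int.cast_zero, zero_div, sub_zero]
  simp only [X, sub_mul, add_mul, mul_sub, mul_add, smul_mul_assoc, mul_smul_comm, mul_assoc,
    h2, bL_bG m n, bG_bG m n]
  simp only [← mul_assoc, bG_bT, bG_bXi, add_mul, sub_mul, smul_mul_assoc, mul_neg, neg_mul]
  push_cast
  module

theorem Y_bG (m n : ℤ) : Y m * bG n + bG n * Y m =
    (-2 : ℂ) • (bT (-m) * bL (m + n)) - (m : ℂ) • (bXi (n + -m) * bG m) -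
    (2 : ℂ) • (((n : ℂ) - m / 2) • (bXi (-m) * bG (m + n)) - bT (n + -m) * bL m) +
    (2 : ℂ) • bL n + (2 : ℂ) • ((n : ℂ) • (bXi 0 * bG n) - bT n * bL 0) := by
  have h2 : bL 0 * bG n = bG n * bL 0 + (n : ℂ) • bG n := by
    rw [bL_bG 0 n, zero_add, Int.cast_zero, zero_div, sub_zero]
  have h3 : bG 0 * bG n = -(bG n * bG 0) + (-2 : ℂ) • bL n := by
    rw [bG_bG 0 n, zero_add]
  simp only [Y, sub_mul, add_mul, mul_sub, mul_add, smul_mul_assoc, mul_smul_comm, mul_assoc,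
    h2, h3, bL_bG m n, bG_bG m n]
  simp only [← mul_assoc, bG_bT, bG_bXi, add_mul, sub_mul, smul_mul_assoc, mul_neg, neg_mul, add_zero]
  push_cast
  module

theorem Y_bL (m n : ℤ) : Y m * bL n - bL n * Y m =
    (-((m : ℂ) - n / 2)) • (bT (-m) * bG (m + n)) + (m : ℂ) • (bT (n + -m) * bG m) -
    (2 : ℂ) • (((n : ℂ) - m) • (bXi (-m) * bL (m + n)) +
      ((m : ℂ) - n / 2) • (bXi (n + -m) * bL m)) -
    ((n : ℂ) / 2) • bG n + (2 : ℂ) • ((n : ℂ) • (bXi 0 * bL n) - ((n : ℂ) / 2) • (bXi n * bL 0)) := by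
  have h1 : bG m * bL n = bL n * bG m - ((m : ℂ) - n / 2) • bG (m + n) := by
    rw [bL_bG n m, add_comm n m]; abel
  have h2 : bL 0 * bL n = bL n * bL 0 + (n : ℂ) • bL n := by
    rw [bL_bL 0 n, zero_add, Int.cast_zero, sub_zero]
  have h3 : bG 0 * bL n = bL n * bG 0 + ((n : ℂ) / 2) • bG n := by
    rw [bL_bG n 0, add_zero, Int.cast_zero, zero_sub]; module
  simp only [Y, sub_mul, add_mul, mul_sub, mul_add, smul_mul_assoc, mul_smul_comm, mul_assoc,
    h1, h2, h3, bL_bL m n]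
  simp only [← mul_assoc, bL_bT, bL_bXi, add_mul, smul_mul_assoc, add_zero]
  push_cast
  module

theorem X_bL_zero (m : ℤ) : X m * bL 0 = bL 0 * X m := by
  rw [← sub_eq_zero, X_bL]
  simp only [add_zero, zero_add]
  push_cast
  module

theorem X_bG_zero (m : ℤ) : X m * bG 0 = bG 0 * X m := by
  rw [← sub_eq_zero, X_bG]
  simp only [add_zero, zero_add]
  push_cast
  module

theorem Y_bG_zero (m : ℤ) : Y m * bG 0 = -(bG 0 * Y m) := by
  rw [← sub_eq_zero, sub_neg_eq_add, Y_bG]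
  simp only [add_zero, zero_add, bT_zero, one_mul]
  push_cast
  module

theorem Y_bL_zero (m : ℤ) : Y m * bL 0 = bL 0 * Y m := by
  rw [← sub_eq_zero, Y_bL]
  simp only [add_zero, zero_add]
  push_cast
  module

theorem X_X (m n : ℤ) : X m * X n - X n * X m =
    ((n : ℂ) - m) • X (m + n) + (m : ℂ) • X m - (n : ℂ) • X n := by
  have e : X m * X n - X n * X m = bT (-n) * (X m * bL n - bL n * X m) +
      ((n : ℂ) / 2) • (bXi (-n) * (X m * bG n - bG n * X m)) := by
    conv_lhs => rw [show X n = bT (-n) * bL n + ((n : ℂ) / 2) • (bXi (-n) * bG n) - bL 0 from rfl]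
    simp only [mul_sub, mul_add, sub_mul, add_mul, mul_smul_comm, smul_mul_assoc, ← mul_assoc, X_bT,
      X_bXi, X_bL_zero]
    module
  rw [e, X_bL, X_bG]
  simp only [X, mul_sub, mul_add, mul_smul_comm, ← mul_assoc, bT_bT, bXi_bT, bT_bXi, bXi_bXi,
    zero_mul, smul_zero, neg_add_cancel_left, neg_add m n, add_comm (-n) (-m)]
  push_cast
  module

theorem X_Y (m n : ℤ) : X m * Y n - Y n * X m =
    ((n : ℂ) - m / 2) • Y (m + n) + ((m : ℂ) / 2) • Y m - (n : ℂ) • Y n := by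
  have e : X m * Y n - Y n * X m = bT (-n) * (X m * bG n - bG n * X m) -
      (2 : ℂ) • (bXi (-n) * (X m * bL n - bL n * X m)) := by
    conv_lhs => rw [show Y n = bT (-n) * bG n - (2 : ℂ) • (bXi (-n) * bL n) - bG 0 +
      (2 : ℂ) • (bXi 0 * bL 0) from rfl]
    simp only [mul_sub, mul_add, sub_mul, add_mul, mul_smul_comm, smul_mul_assoc, ← mul_assoc, X_bT,
      X_bXi, X_bG_zero]
    simp only [mul_assoc, X_bL_zero]
    module
  rw [e, X_bL, X_bG]
  simp only [Y, mul_sub, mul_add, mul_smul_comm, ← mul_assoc, bT_bT, bXi_bT, bT_bXi, bXi_bXi,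
    zero_mul, smul_zero, neg_add_cancel_left, neg_add m n, add_comm (-n) (-m)]
  module

theorem Y_Y (m n : ℤ) : Y m * Y n + Y n * Y m = (2 : ℂ) • (X n + X m - X (m + n)) := by
  have e : Y m * Y n + Y n * Y m = bT (-n) * (Y m * bG n + bG n * Y m) +
      (2 : ℂ) • (bXi (-n) * (Y m * bL n - bL n * Y m)) := by
    conv_lhs => rw [show Y n = bT (-n) * bG n - (2 : ℂ) • (bXi (-n) * bL n) - bG 0 +
      (2 : ℂ) • (bXi 0 * bL 0) from rfl]
    simp only [mul_sub, mul_add, sub_mul, add_mul, mul_smul_comm, smul_mul_assoc, ← mul_assoc, Y_bT,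
      Y_bXi, Y_bG_zero, neg_mul]
    simp only [mul_assoc, Y_bL_zero]
    module
  rw [e, Y_bL, Y_bG]
  simp only [X, mul_sub, mul_add, mul_smul_comm, ← mul_assoc, bT_bT, bXi_bT, bT_bXi, bXi_bXi,
    zero_mul, smul_zero, neg_add_cancel_left, neg_add m n, add_comm (-n) (-m), neg_add_cancel,
    bT_zero, one_mul, add_zero]
  push_cast
  module

theorem bL_mem (n : ℤ) : bL n ∈ UBar.part 0 := by
  refine mem_parityPart_zero.2 ?_
  rw [bL, UBar.parityHom_toUBar, uL, SuperUEA.parityHom_ι,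
    LieSuperalgebra.parity_even (STilde.L_mem n)]

theorem bG_mem (n : ℤ) : bG n ∈ UBar.part 1 := by
  refine mem_parityPart_one.2 ?_
  rw [bG, UBar.parityHom_toUBar, uG, SuperUEA.parityHom_ι,
    LieSuperalgebra.parity_odd (STilde.G_mem n), map_neg, map_neg]

theorem bT_mem (n : ℤ) : bT n ∈ UBar.part 0 := by
  refine mem_parityPart_zero.2 ?_
  rw [bT, UBar.parityHom_toUBar, parityHom_uA_tPow]

theorem bXi_mem (n : ℤ) : bXi n ∈ UBar.part 1 := by
  refine mem_parityPart_one.2 ?_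
  rw [bXi, UBar.parityHom_toUBar, parityHom_uA_tXi, map_neg]

theorem X_mem (m : ℤ) : X m ∈ UBar.part 0 := by
  have h1 : bT (-m) * bL m ∈ UBar.part (0 + 0) := SetLike.mul_mem_graded (bT_mem _) (bL_mem _)
  have h2 : bXi (-m) * bG m ∈ UBar.part (1 + 1) := SetLike.mul_mem_graded (bXi_mem _) (bG_mem _)
  rw [add_zero] at h1
  rw [show (1 + 1 : ZMod 2) = 0 from rfl] at h2
  unfold X
  exact sub_mem (add_mem h1 (Submodule.smul_mem _ _ h2)) (bL_mem 0)

theorem Y_mem (m : ℤ) : Y m ∈ UBar.part 1 := by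
  have h1 : bT (-m) * bG m ∈ UBar.part (0 + 1) := SetLike.mul_mem_graded (bT_mem _) (bG_mem _)
  have h2 : ∀ k l, bXi k * bL l ∈ UBar.part (1 + 0) := fun k l =>
    SetLike.mul_mem_graded (bXi_mem k) (bL_mem l)
  simp only [add_zero] at h2
  rw [zero_add] at h1
  unfold Y
  exact add_mem (sub_mem (sub_mem h1 (Submodule.smul_mem _ _ (h2 _ _))) (bG_mem 0))
    (Submodule.smul_mem _ _ (h2 _ _))

theorem X_mem_Tau (m : ℤ) : X m ∈ Tau := by
  by_cases h : m = 0
  · rw [h, X_zero]; exact zero_mem _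
  · exact Submodule.subset_span (Or.inl ⟨m, h, rfl⟩)

theorem Y_mem_Tau (m : ℤ) : Y m ∈ Tau := by
  by_cases h : m = 0
  · rw [h, Y_zero]; exact zero_mem _
  · exact Submodule.subset_span (Or.inr ⟨m, h, rfl⟩)

theorem Tau_graded : Tau ≤ (Tau ⊓ LieSuperalgebra.part 0) ⊔ (Tau ⊓ LieSuperalgebra.part 1) := by
  refine Submodule.span_le.2 ?_
  rintro _ (⟨m, -, rfl⟩ | ⟨m, -, rfl⟩)
  · exact Submodule.mem_sup_left ⟨X_mem_Tau m, X_mem m⟩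
  · exact Submodule.mem_sup_right ⟨Y_mem_Tau m, Y_mem m⟩

theorem Tau_bracket (x : UBar) (hx : x ∈ Tau) (y : UBar) (hy : y ∈ Tau) :
    LieSuperalgebra.bracket x y ∈ Tau := by
  have hc : ∀ (c : ℂ) {u : UBar}, u ∈ Tau → c • u ∈ Tau := fun c _ hu => Submodule.smul_mem _ c hu
  have hXX : ∀ m n, X m * X n - X n * X m ∈ Tau := fun m n => by
    rw [X_X]
    exact sub_mem (add_mem (hc _ (X_mem_Tau _)) (hc _ (X_mem_Tau _))) (hc _ (X_mem_Tau _))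
  have hXY : ∀ m n, X m * Y n - Y n * X m ∈ Tau := fun m n => by
    rw [X_Y]
    exact sub_mem (add_mem (hc _ (Y_mem_Tau _)) (hc _ (Y_mem_Tau _))) (hc _ (Y_mem_Tau _))
  have hYY : ∀ m n, Y m * Y n + Y n * Y m ∈ Tau := fun m n => by
    rw [Y_Y]
    exact hc _ (sub_mem (add_mem (X_mem_Tau _) (X_mem_Tau _)) (X_mem_Tau _))
  change superCommutator UBar.part x y ∈ Tau
  refine LinearMap.BilinMap.apply_apply_mem_of_mem_span Tau _ _ (superCommutator UBar.part) ?_ x y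
    hx hy
  rintro _ (⟨m, -, rfl⟩ | ⟨m, -, rfl⟩) _ (⟨n, -, rfl⟩ | ⟨n, -, rfl⟩)
  · rw [superCommutator_apply _ (X_mem m) (X_mem n), koszul_zero_left, one_smul]; exact hXX m n
  · rw [superCommutator_apply _ (X_mem m) (Y_mem n), koszul_zero_left, one_smul]; exact hXY m n
  · rw [superCommutator_apply _ (Y_mem m) (X_mem n), koszul_zero_right, one_smul, ← neg_sub]
    exact neg_mem (hXY n m)
  · rw [superCommutator_apply _ (Y_mem m) (Y_mem n), koszul_one_one, neg_smul, one_smul,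
      sub_neg_eq_add]
    exact hYY m n

/-- `𝒯` is a Lie subsuperalgebra of `Ū`. -/
instance : LieSuperalgebra Tau := LieSuperalgebra.ofSubmodule Tau Tau_graded Tau_bracket

/-! ### The Lie subsuperalgebra `(t - 1) s̄` of `s̄` -/

/-- Multiplication by `t` on the `A`-module `s̄`: `t L_n = L_{n+1}`, `t G_n = G_{n+1}`. -/
def SBar.tMul : SBar →ₗ[ℂ] SBar :=
  SBar.inL ∘ₗ Finsupp.lmapDomain ℂ ℂ (fun n : ℤ => n + 1) ∘ₗ SBar.coL +
    SBar.inG ∘ₗ Finsupp.lmapDomain ℂ ℂ (fun n : ℤ => n + 1) ∘ₗ SBar.coG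

theorem SBar.tMul_L (n : ℤ) : SBar.tMul (SBar.L n) = SBar.L (n + 1) := by
  simp only [tMul, LinearMap.add_apply, LinearMap.comp_apply, coL_L, coG_L, map_zero, add_zero,
    Finsupp.lmapDomain_apply, Finsupp.mapDomain_single]
  rfl

theorem SBar.tMul_G (n : ℤ) : SBar.tMul (SBar.G n) = SBar.G (n + 1) := by
  simp only [tMul, LinearMap.add_apply, LinearMap.comp_apply, coL_G, coG_G, map_zero, zero_add,
    Finsupp.lmapDomain_apply, Finsupp.mapDomain_single]
  rfl

/-- `(t - 1) s̄`, the image of multiplication by `t - 1`. -/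
def TMinusOne : Submodule ℂ SBar := LinearMap.range (SBar.tMul - LinearMap.id)

theorem TMinusOne_L (n : ℤ) : SBar.L (n + 1) - SBar.L n ∈ TMinusOne :=
  ⟨SBar.L n, by rw [LinearMap.sub_apply, SBar.tMul_L, LinearMap.id_apply]⟩

theorem TMinusOne_G (n : ℤ) : SBar.G (n + 1) - SBar.G n ∈ TMinusOne :=
  ⟨SBar.G n, by rw [LinearMap.sub_apply, SBar.tMul_G, LinearMap.id_apply]⟩

theorem TMinusOne_eq : TMinusOne = Submodule.span ℂ (Set.range (fun n => SBar.L (n + 1) - SBar.L n) ∪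
    Set.range (fun n => SBar.G (n + 1) - SBar.G n)) := by
  apply le_antisymm
  · rintro _ ⟨x, rfl⟩
    have h := SBar.hom_ext (f := (Submodule.span ℂ (Set.range (fun n => SBar.L (n + 1) - SBar.L n) ∪
      Set.range (fun n => SBar.G (n + 1) - SBar.G n))).mkQ ∘ₗ (SBar.tMul - LinearMap.id)) (g := 0)
      (fun n => (Submodule.Quotient.mk_eq_zero _).2 (Submodule.subset_span (Or.inl ⟨n, by
        simp only [LinearMap.sub_apply, SBar.tMul_L, LinearMap.id_apply]⟩)))
      (fun n => (Submodule.Quotient.mk_eq_zero _).2 (Submodule.subset_span (Or.inr ⟨n, by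
        simp only [LinearMap.sub_apply, SBar.tMul_G, LinearMap.id_apply]⟩)))
    exact (Submodule.Quotient.mk_eq_zero _).1 (LinearMap.congr_fun h x)
  · refine Submodule.span_le.2 ?_
    rintro _ (⟨n, rfl⟩ | ⟨n, rfl⟩)
    · exact TMinusOne_L n
    · exact TMinusOne_G n

theorem TMinusOne_graded :
    TMinusOne ≤ (TMinusOne ⊓ LieSuperalgebra.part 0) ⊔ (TMinusOne ⊓ LieSuperalgebra.part 1) := by
  conv_lhs => rw [TMinusOne_eq]
  refine Submodule.span_le.2 ?_
  rintro _ (⟨n, rfl⟩ | ⟨n, rfl⟩)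
  · exact Submodule.mem_sup_left ⟨TMinusOne_L n, sub_mem (SBar.L_mem _) (SBar.L_mem _)⟩
  · exact Submodule.mem_sup_right ⟨TMinusOne_G n, sub_mem (SBar.G_mem _) (SBar.G_mem _)⟩

theorem TMinusOne_bracket (x : SBar) (hx : x ∈ TMinusOne) (y : SBar) (hy : y ∈ TMinusOne) :
    LieSuperalgebra.bracket x y ∈ TMinusOne := by
  change SBar.bracket x y ∈ TMinusOne
  rw [TMinusOne_eq] at hx hy
  refine LinearMap.BilinMap.apply_apply_mem_of_mem_span TMinusOne _ _ SBar.bracket ?_ x y hx hy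
  have hc : ∀ (a b : ℂ) {u v : SBar}, u ∈ TMinusOne → v ∈ TMinusOne → a • u + b • v ∈ TMinusOne :=
    fun a b _ _ hu hv => add_mem (Submodule.smul_mem _ a hu) (Submodule.smul_mem _ b hv)
  rintro _ (⟨m, rfl⟩ | ⟨m, rfl⟩) _ (⟨n, rfl⟩ | ⟨n, rfl⟩)
  · convert hc ((n : ℂ) - m) (-((n : ℂ) - m)) (TMinusOne_L (m + n + 1)) (TMinusOne_L (m + n)) using 1
    simp only [map_sub, LinearMap.sub_apply, SBar.bracket_L_L, add_right_comm m 1, ← add_assoc]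
    push_cast
    module
  · convert hc ((n : ℂ) - m / 2 + 1 / 2) (-((n : ℂ) - m / 2)) (TMinusOne_G (m + n + 1))
      (TMinusOne_G (m + n)) using 1
    simp only [map_sub, LinearMap.sub_apply, SBar.bracket_L_G, add_right_comm m 1, ← add_assoc]
    push_cast
    module
  · convert hc (-((m : ℂ) - n / 2 + 1 / 2)) ((m : ℂ) - n / 2) (TMinusOne_G (m + n + 1))
      (TMinusOne_G (m + n)) using 1
    simp only [map_sub, LinearMap.sub_apply, SBar.bracket_G_L, add_right_comm m 1, ← add_assoc]
    push_cast
    module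
  · convert hc (-2) 2 (TMinusOne_L (m + n + 1)) (TMinusOne_L (m + n)) using 1
    simp only [map_sub, LinearMap.sub_apply, SBar.bracket_G_G, add_right_comm m 1, ← add_assoc]
    module

/-- `(t - 1) s̄` is a Lie subsuperalgebra of `s̄`. -/
instance : LieSuperalgebra TMinusOne :=
  LieSuperalgebra.ofSubmodule TMinusOne TMinusOne_graded TMinusOne_bracket

/-! ### The Weyl superalgebra `𝒦 = A[∂_t, ∂_ξ]` -/

/-- The generators `t`, `t⁻¹`, `ξ`, `∂_t`, `∂_ξ` of `𝒦`. -/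
inductive WeylGen : Type
  | t | tInv | xi | dt | dxi

/-- The defining relations of `𝒦`: `t` and `t⁻¹` are inverse to each other, all pairs of generators
supercommute except `[∂_t, t] = 1` and `[∂_ξ, ξ] = 1`, and `ξ² = ∂_ξ² = 0`. (The commutation
relations of `t⁻¹` with the other generators follow from those of `t`.) -/
inductive WeylRel : FreeAlgebra ℂ WeylGen → FreeAlgebra ℂ WeylGen → Prop
  | t_tInv : WeylRel (FreeAlgebra.ι ℂ .t * FreeAlgebra.ι ℂ .tInv) 1
  | tInv_t : WeylRel (FreeAlgebra.ι ℂ .tInv * FreeAlgebra.ι ℂ .t) 1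
  | xi_t : WeylRel (FreeAlgebra.ι ℂ .xi * FreeAlgebra.ι ℂ .t)
      (FreeAlgebra.ι ℂ .t * FreeAlgebra.ι ℂ .xi)
  | xi_xi : WeylRel (FreeAlgebra.ι ℂ .xi * FreeAlgebra.ι ℂ .xi) 0
  | dt_t : WeylRel (FreeAlgebra.ι ℂ .dt * FreeAlgebra.ι ℂ .t)
      (FreeAlgebra.ι ℂ .t * FreeAlgebra.ι ℂ .dt + 1)
  | dt_xi : WeylRel (FreeAlgebra.ι ℂ .dt * FreeAlgebra.ι ℂ .xi)
      (FreeAlgebra.ι ℂ .xi * FreeAlgebra.ι ℂ .dt)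
  | dxi_t : WeylRel (FreeAlgebra.ι ℂ .dxi * FreeAlgebra.ι ℂ .t)
      (FreeAlgebra.ι ℂ .t * FreeAlgebra.ι ℂ .dxi)
  | dxi_xi : WeylRel (FreeAlgebra.ι ℂ .dxi * FreeAlgebra.ι ℂ .xi)
      (-(FreeAlgebra.ι ℂ .xi * FreeAlgebra.ι ℂ .dxi) + 1)
  | dxi_dt : WeylRel (FreeAlgebra.ι ℂ .dxi * FreeAlgebra.ι ℂ .dt)
      (FreeAlgebra.ι ℂ .dt * FreeAlgebra.ι ℂ .dxi)
  | dxi_dxi : WeylRel (FreeAlgebra.ι ℂ .dxi * FreeAlgebra.ι ℂ .dxi) 0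

/-- The Weyl superalgebra `𝒦 = A[∂_t, ∂_ξ]`. -/
def Weyl : Type := RingQuot WeylRel

instance : Ring Weyl := inferInstanceAs (Ring (RingQuot WeylRel))

instance : Algebra ℂ Weyl := inferInstanceAs (Algebra ℂ (RingQuot WeylRel))

/-- The generators of `𝒦` as elements of `𝒦`. -/
def Weyl.gen (g : WeylGen) : Weyl := RingQuot.mkAlgHom ℂ WeylRel (FreeAlgebra.ι ℂ g)

/-- The parity of the generators: `t`, `t⁻¹`, `∂_t` are even, `ξ`, `∂_ξ` are odd. -/
def WeylGen.sign : WeylGen → ℂ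
  | .t => 1
  | .tInv => 1
  | .xi => -1
  | .dt => 1
  | .dxi => -1

theorem Weyl.rel {a b : FreeAlgebra ℂ WeylGen} (h : WeylRel a b) :
    FreeAlgebra.lift ℂ Weyl.gen a = FreeAlgebra.lift ℂ Weyl.gen b := by
  have e : FreeAlgebra.lift ℂ Weyl.gen = RingQuot.mkAlgHom ℂ WeylRel := by
    ext g
    simp only [Function.comp_apply, FreeAlgebra.lift_ι_apply]
    rfl
  rw [e]; exact RingQuot.mkAlgHom_rel ℂ h

/-- The parity automorphism of `𝒦`, `g ↦ (-1)^{|g|} g` on generators. -/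
def Weyl.parityHom : Weyl →ₐ[ℂ] Weyl :=
  RingQuot.liftAlgHom ℂ ⟨FreeAlgebra.lift ℂ fun g => g.sign • Weyl.gen g, by
    intro a b h
    have h' := Weyl.rel h
    cases h <;>
      simp only [map_mul, map_add, map_neg, map_one, map_zero, FreeAlgebra.lift_ι_apply] at h' ⊢ <;>
      simp [WeylGen.sign, h']⟩

theorem Weyl.parityHom_gen (g : WeylGen) : Weyl.parityHom (Weyl.gen g) = g.sign • Weyl.gen g :=
  (RingQuot.liftAlgHom_mkAlgHom_apply ℂ _ _ _).trans (FreeAlgebra.lift_ι_apply _ _)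

theorem Weyl.parityHom_parityHom (b : Weyl) : Weyl.parityHom (Weyl.parityHom b) = b := by
  have h : Weyl.parityHom.comp Weyl.parityHom = AlgHom.id ℂ Weyl := by
    refine RingQuot.ringQuot_ext' ℂ _ _ ?_
    ext g
    change Weyl.parityHom (Weyl.parityHom (Weyl.gen g)) = Weyl.gen g
    rw [parityHom_gen, map_smul, parityHom_gen, smul_smul]
    cases g <;> simp [WeylGen.sign]
  exact DFunLike.congr_fun h b

/-- The superalgebra structure of `𝒦`. -/
def Weyl.part : ZMod 2 → Submodule ℂ Weyl := parityPart Weyl.parityHom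

instance : GradedAlgebra Weyl.part := parityGradedAlgebra _ Weyl.parityHom_parityHom

end Ramond

end

noncomputable section

namespace Ramond

/-! ### The universal property of `Ū` -/

/-! On `A`, `L_0` acts as t∂_t and `G_0` as ξt∂_t − ∂_ξ. So Ū contains an image of 𝒦 in which ∂_t =
t⁻¹L_0 and ∂_ξ = ξL_0 − G_0. The elements X_m and Y_m are t^{-m}L_m and t^{-m}G_m, corrected so that
they supercommute with this image. Because ξ² = 0, the correction can be undone: t^{-m}L_m = t∂_t +
(m/2)ξ∂_ξ + X_m − (m/2)ξY_m, t^{-m}G_m = ξt∂_t − ∂_ξ + Y_m + 2ξX_m. Hence Ū is generated by two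
supercommuting pieces, the images of 𝒦 and U(𝒯), and multiplication is a homomorphism 𝒦 ⊗ U(𝒯) → Ū
(`unsplit`).

Injectivity needs no PBW theorem. Ū is given by generators and relations (`UBarSystem.lift`), so the
two formulas, read inside 𝒦 ⊗ U(𝒯), define a homomorphism in the other direction (`split`) once
their right-hand sides are shown to satisfy the relations of Ū. That is a normal-ordering
computation using only the relations of 𝒦, the brackets of 𝒯 and the Koszul signs; it is carried out
in an arbitrary algebra (`SplitSystem`), and its core is `SplitSystem.l_l`, `SplitSystem.l_g` and
`SplitSystem.g_g`. The two homomorphisms are inverse to each other because both composites fix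
generators. For the gradings it suffices that `unsplit` is even.

For the Lie superalgebras, the brackets `X_X`, `X_Y`, `Y_Y` are those of L_m − L_0 and G_m − G_0,
which span (t−1)s̄. What remains is that no linear relations among the X_m, Y_m with m ≠ 0 arise in
the quotient Ū. A representation of Ū on A ⊗ A settles this: a linear map built from it (`symbol`)
sends X_m to L_m − L_0 and Y_m to G_m − G_0. -/

/-- Elements of an algebra satisfying the relations between `L_n`, `G_n`, `t^n`, `t^n ξ` in `Ū`. -/
structure UBarSystem (B : Type) [Ring B] [Algebra ℂ B] where
  L : ℤ → B
  G : ℤ → B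
  T : ℤ → B
  Xi : ℤ → B
  L_L : ∀ m n, L m * L n = L n * L m + ((n : ℂ) - m) • L (m + n)
  L_G : ∀ m n, L m * G n = G n * L m + ((n : ℂ) - m / 2) • G (m + n)
  G_G : ∀ m n, G m * G n = -(G n * G m) + (-2 : ℂ) • L (m + n)
  L_T : ∀ m i, L m * T i = T i * L m + (i : ℂ) • T (m + i)
  L_Xi : ∀ m i, L m * Xi i = Xi i * L m + ((i : ℂ) + m / 2) • Xi (m + i)
  G_T : ∀ m i, G m * T i = T i * G m + (i : ℂ) • Xi (m + i)
  G_Xi : ∀ m i, G m * Xi i = -(Xi i * G m) - T (m + i)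
  T_T : ∀ i j, T i * T j = T (i + j)
  T_zero : T 0 = 1
  T_Xi : ∀ i j, T i * Xi j = Xi (i + j)
  Xi_T : ∀ i j, Xi i * T j = Xi (i + j)
  Xi_Xi : ∀ i j, Xi i * Xi j = 0

/-! ### Linear maps given on bases -/

/-- The linear map on `A` with given values on the basis. -/
def A.constr {M : Type} [AddCommGroup M] [Module ℂ M] (T Xi : ℤ → M) : A →ₗ[ℂ] M :=
  Finsupp.linearCombination ℂ T ∘ₗ (AddMonoidAlgebra.coeffLinearEquiv ℂ).toLinearMap ∘ₗ evenCoord +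
    Finsupp.linearCombination ℂ Xi ∘ₗ (AddMonoidAlgebra.coeffLinearEquiv ℂ).toLinearMap ∘ₗ oddCoord

theorem coeffLinearEquiv_T (n : ℤ) :
    (AddMonoidAlgebra.coeffLinearEquiv ℂ) (LaurentPolynomial.T n : ℂ[T;T⁻¹]) =
      Finsupp.single n (1 : ℂ) := rfl

theorem A.constr_tPow {M : Type} [AddCommGroup M] [Module ℂ M] (T Xi : ℤ → M) (n : ℤ) :
    A.constr T Xi (tPow n) = T n := by
  simp [A.constr, tPow, evenCoord_apply, oddCoord_apply, coeffLinearEquiv_T,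
    -AddMonoidAlgebra.coeffLinearEquiv_apply]

theorem A.constr_tXi {M : Type} [AddCommGroup M] [Module ℂ M] (T Xi : ℤ → M) (n : ℤ) :
    A.constr T Xi (tXi n) = Xi n := by
  simp [A.constr, tXi, evenCoord_apply, oddCoord_apply, coeffLinearEquiv_T,
    -AddMonoidAlgebra.coeffLinearEquiv_apply]

/-- The linear map on `s̄` with given values on the basis. -/
def SBar.constr {M : Type} [AddCommGroup M] [Module ℂ M] (L G : ℤ → M) : SBar →ₗ[ℂ] M :=
  Finsupp.linearCombination ℂ L ∘ₗ SBar.coL + Finsupp.linearCombination ℂ G ∘ₗ SBar.coG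

theorem SBar.constr_L {M : Type} [AddCommGroup M] [Module ℂ M] (L G : ℤ → M) (n : ℤ) :
    SBar.constr L G (SBar.L n) = L n := by
  simp [SBar.constr, coL_L, coG_L]

theorem SBar.constr_G {M : Type} [AddCommGroup M] [Module ℂ M] (L G : ℤ → M) (n : ℤ) :
    SBar.constr L G (SBar.G n) = G n := by
  simp [SBar.constr, coL_G, coG_G]

/-- Two linear maps on `A` agree on a homogeneous component if they agree on its basis. -/
theorem A.eq_of_mem {M : Type} [AddCommGroup M] [Module ℂ M] {f g : A →ₗ[ℂ] M} {i : ZMod 2}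
    (h0 : i = 0 → ∀ n, f (tPow n) = g (tPow n)) (h1 : i = 1 → ∀ n, f (tXi n) = g (tXi n))
    {x : A} (hx : x ∈ A.part i) : f x = g x := by
  have e0 : ∀ n, evenIncl (evenCoord (tPow n)) = tPow n := fun _ => rfl
  have e1 : ∀ n, evenIncl (evenCoord (tXi n)) = 0 := fun n => by
    simp [tXi, evenIncl_apply, evenCoord_apply]
  have o0 : ∀ n, oddIncl (oddCoord (tPow n)) = 0 := fun n => by
    simp [tPow, oddIncl_apply, oddCoord_apply]
  have o1 : ∀ n, oddIncl (oddCoord (tXi n)) = tXi n := fun _ => rfl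
  rcases parity_cases i with rfl | rfl
  · have h : f ∘ₗ evenIncl ∘ₗ evenCoord = g ∘ₗ evenIncl ∘ₗ evenCoord :=
      A_hom_ext (fun n => by simp only [LinearMap.comp_apply, e0, h0 rfl])
        (fun n => by simp only [LinearMap.comp_apply, e1, map_zero])
    rw [A.part_zero] at hx
    obtain ⟨p, rfl⟩ := hx
    exact LinearMap.congr_fun h (evenIncl p)
  · have h : f ∘ₗ oddIncl ∘ₗ oddCoord = g ∘ₗ oddIncl ∘ₗ oddCoord :=
      A_hom_ext (fun n => by simp only [LinearMap.comp_apply, o0, map_zero])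
        (fun n => by simp only [LinearMap.comp_apply, o1, h1 rfl])
    rw [A.part_one] at hx
    obtain ⟨p, rfl⟩ := hx
    exact LinearMap.congr_fun h (oddIncl p)

theorem STilde.eq_of_mem {M : Type} [AddCommGroup M] [Module ℂ M] {f g : STilde →ₗ[ℂ] M}
    {i : ZMod 2}
    (hL : i = 0 → ∀ n, f (inS (SBar.L n)) = g (inS (SBar.L n)))
    (hT : i = 0 → ∀ n, f (inA (tPow n)) = g (inA (tPow n)))
    (hG : i = 1 → ∀ n, f (inS (SBar.G n)) = g (inS (SBar.G n)))
    (hXi : i = 1 → ∀ n, f (inA (tXi n)) = g (inA (tXi n)))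
    {x : STilde} (hx : x ∈ LieSuperalgebra.part i) : f x = g x := by
  have e : x = inS (prS x) + inA (prA x) := Prod.ext (add_zero _).symm (zero_add _).symm
  rw [e, map_add, map_add]
  exact congrArg₂ (· + ·)
    (SBar.eq_of_mem (f := f ∘ₗ inS) (g := g ∘ₗ inS) hL hG hx.1)
    (A.eq_of_mem (f := f ∘ₗ inA) (g := g ∘ₗ inA) hT hXi hx.2)

/-- The linear map on `s̃` with given restrictions to `s̄` and `A`. -/
def STilde.coprod {M : Type} [AddCommGroup M] [Module ℂ M] (f : SBar →ₗ[ℂ] M) (g : A →ₗ[ℂ] M) :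
    STilde →ₗ[ℂ] M := f ∘ₗ prS + g ∘ₗ prA

theorem STilde.coprod_inS {M : Type} [AddCommGroup M] [Module ℂ M] (f : SBar →ₗ[ℂ] M)
    (g : A →ₗ[ℂ] M) (x : SBar) : coprod f g (inS x) = f x := by
  change f x + g 0 = f x
  rw [map_zero, add_zero]

theorem STilde.coprod_inA {M : Type} [AddCommGroup M] [Module ℂ M] (f : SBar →ₗ[ℂ] M)
    (g : A →ₗ[ℂ] M) (a : A) : coprod f g (inA a) = g a := by
  change f 0 + g a = g a
  rw [map_zero, zero_add]

theorem UBar.hom_ext {B : Type} [Ring B] [Algebra ℂ B] {f g : UBar →ₐ[ℂ] B}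
    (hL : ∀ n, f (bL n) = g (bL n)) (hG : ∀ n, f (bG n) = g (bG n))
    (hT : ∀ n, f (bT n) = g (bT n)) (hXi : ∀ n, f (bXi n) = g (bXi n)) : f = g := by
  have h : f.comp toUBar = g.comp toUBar := by
    refine SuperUEA.hom_ext fun x => ?_
    exact LinearMap.congr_fun (STilde.hom_ext
      (f := (f.comp toUBar).toLinearMap ∘ₗ SuperUEA.ι)
      (g := (g.comp toUBar).toLinearMap ∘ₗ SuperUEA.ι) hL hG hT hXi) x
  refine AlgHom.ext fun b => ?_
  obtain ⟨u, rfl⟩ := toUBar_surjective b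
  exact DFunLike.congr_fun h u

/-! ### The homomorphism out of Ū attached to a system -/

namespace UBarSystem
variable {B : Type} [Ring B] [Algebra ℂ B] (S : UBarSystem B)

/-- The enveloping algebra imposes a relation for each ordered pair of homogeneous elements, while a
system lists each mixed s̄–s̄ or s̄–`A` pair in one order only. This and the next four lemmas supply
the opposite orders. -/
theorem G_L (m n : ℤ) : S.G m * S.L n = S.L n * S.G m - ((m : ℂ) - n / 2) • S.G (m + n) := by
  rw [S.L_G n m, add_comm n m]; abel

theorem T_L (i m : ℤ) : S.T i * S.L m = S.L m * S.T i - (i : ℂ) • S.T (m + i) := by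
  rw [S.L_T]; abel

theorem Xi_L (i m : ℤ) :
    S.Xi i * S.L m = S.L m * S.Xi i - ((i : ℂ) + m / 2) • S.Xi (m + i) := by
  rw [S.L_Xi]; abel

theorem T_G (i m : ℤ) : S.T i * S.G m = S.G m * S.T i - (i : ℂ) • S.Xi (m + i) := by
  rw [S.G_T]; abel

theorem Xi_G (i m : ℤ) : S.Xi i * S.G m = -(S.G m * S.Xi i) - S.T (m + i) := by
  rw [S.G_Xi]; abel

/-- The linear map `s̃ → B` attached to a system. -/
def linear : STilde →ₗ[ℂ] B :=
  STilde.coprod (SBar.constr S.L S.G) (A.constr S.T S.Xi)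

theorem linear_L (n : ℤ) : S.linear (STilde.inS (SBar.L n)) = S.L n := by
  rw [linear, STilde.coprod_inS, SBar.constr_L]

theorem linear_G (n : ℤ) : S.linear (STilde.inS (SBar.G n)) = S.G n := by
  rw [linear, STilde.coprod_inS, SBar.constr_G]

theorem linear_T (n : ℤ) : S.linear (STilde.inA (tPow n)) = S.T n := by
  rw [linear, STilde.coprod_inA, A.constr_tPow]

theorem linear_Xi (n : ℤ) : S.linear (STilde.inA (tXi n)) = S.Xi n := by
  rw [linear, STilde.coprod_inA, A.constr_tXi]

theorem bracket_A_S {i j : ZMod 2} {a : A} {x : SBar} (ha : a ∈ A.part i) (hx : x ∈ SBar.part j) :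
    LieSuperalgebra.bracket (STilde.inA a) (STilde.inS x) =
      -(koszul i j • STilde.inA (act x a)) := by
  rw [← STilde.bracket_S_A]
  exact LieSuperalgebra.skew i j _ _ ⟨zero_mem (SBar.part i), ha⟩ ⟨hx, zero_mem (A.part j)⟩

/-- Both sides are bilinear in x and y once the parities are fixed, so basis vectors suffice; for
each pair of basis types the identity is one field of the system or one of the reversed relations.
-/
theorem linear_mul_linear (i j : ZMod 2) (x y : STilde) (hx : x ∈ LieSuperalgebra.part i)
    (hy : y ∈ LieSuperalgebra.part j) :
    S.linear x * S.linear y =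
      koszul i j • (S.linear y * S.linear x) + S.linear (LieSuperalgebra.bracket x y) := by
  have key : ∀ (x y : STilde), S.linear x * S.linear y =
      koszul i j • (S.linear y * S.linear x) + S.linear (LieSuperalgebra.bracket x y) ↔
      ((LinearMap.mul ℂ B).compl₁₂ S.linear S.linear) x y =
        (koszul i j • ((LinearMap.mul ℂ B).compl₁₂ S.linear S.linear).flip +
          (LieSuperalgebra.bracket (L := STilde)).compr₂ S.linear) x y := fun _ _ => Iff.rfl
  -- Flipping makes x the free variable of a linear map with y fixed, so that x is reduced to basis
  -- vectors before y.
  rw [key, ← LinearMap.flip_apply, ← LinearMap.flip_apply (m := x) (n := y)]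
  refine STilde.eq_of_mem (i := i) ?_ ?_ ?_ ?_ hx <;>
    · rintro rfl m
      rw [LinearMap.flip_apply, LinearMap.flip_apply]
      refine STilde.eq_of_mem (i := j) ?_ ?_ ?_ ?_ hy <;>
      · rintro rfl n
        rw [← key]
        simp only [linear_L, linear_G, linear_T, linear_Xi, STilde.bracket_S_S, STilde.bracket_S_A,
          STilde.bracket_A_A, bracket_A_S (tPow_mem _) (SBar.L_mem _),
          bracket_A_S (tPow_mem _) (SBar.G_mem _), bracket_A_S (tXi_mem _) (SBar.L_mem _),
          bracket_A_S (tXi_mem _) (SBar.G_mem _),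
          act_L, act_G, actL_tPow, actL_tXi, actG_tPow, actG_tXi, SBar.bracket_L_L,
          SBar.bracket_L_G, SBar.bracket_G_L, SBar.bracket_G_G, koszul_zero_left, koszul_zero_right,
          koszul_one_one, map_smul, map_neg, map_zero, one_smul, neg_smul]
        -- Exactly one relation fits each pair from s̄ × s̄, s̄ × `A` or `A` × s̄. The pairs from
        -- `A` × `A` fall to the last alternative, where the products are known outright.
        first
          | rw [S.L_L m n] | rw [S.L_G m n] | rw [S.G_G m n] | rw [S.L_T m n] | rw [S.L_Xi m n]
          | rw [S.G_T m n] | rw [S.G_Xi m n] | rw [S.G_L m n] | rw [S.T_L m n] | rw [S.T_G m n]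
          | rw [S.Xi_L m n] | rw [S.Xi_G m n] | simp only [S.T_T, S.T_Xi, S.Xi_T, S.Xi_Xi]
        try simp only [add_comm n m]
        try module

/-- The homomorphism `Ū → B` attached to a system in `B`. -/
def lift : UBar →ₐ[ℂ] B :=
  Ideal.Quotient.liftₐ relatorIdeal (SuperUEA.lift S.linear S.linear_mul_linear) (by
    -- A kernel is stable under left multiplication, so only the relators need to be sent to 0.
    intro u hu
    induction hu using Submodule.span_induction with
    | mem s hs =>
      rcases hs with ⟨i, j, rfl⟩ | rfl | ⟨i, rfl⟩ | rfl <;>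
        simp [uA, SuperUEA.lift_ι, linear_T, linear_Xi, S.T_T, S.T_zero, S.T_Xi, S.Xi_Xi]
    | zero => rw [map_zero]
    | add a b _ _ ha hb => rw [map_add, ha, hb, add_zero]
    | smul c a _ ha => rw [smul_eq_mul, map_mul, ha, mul_zero])

theorem lift_bL (n : ℤ) : S.lift (bL n) = S.L n :=
  (SuperUEA.lift_ι S.linear S.linear_mul_linear _).trans (S.linear_L n)

theorem lift_bG (n : ℤ) : S.lift (bG n) = S.G n :=
  (SuperUEA.lift_ι S.linear S.linear_mul_linear _).trans (S.linear_G n)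

theorem lift_bT (n : ℤ) : S.lift (bT n) = S.T n :=
  (SuperUEA.lift_ι S.linear S.linear_mul_linear _).trans (S.linear_T n)

theorem lift_bXi (n : ℤ) : S.lift (bXi n) = S.Xi n :=
  (SuperUEA.lift_ι S.linear S.linear_mul_linear _).trans (S.linear_Xi n)

end UBarSystem

/-! ### Systems in a superalgebra `𝒦 ⊗ U(𝒯)` -/

/-- Elements of an algebra satisfying the relations between `t^n`, `ξ`, `t ∂_t`, `∂_ξ` in `𝒦`,
the relations between the `X_m`, `Y_m` in `𝒯`, and supercommutation of the two families. -/
structure SplitSystem (B : Type) [Ring B] [Algebra ℂ B] where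
  T : ℤ → B
  ξ : B
  D : B
  P : B
  x : ℤ → B
  y : ℤ → B
  T_T : ∀ i j, T i * T j = T (i + j)
  T_zero : T 0 = 1
  ξ_T : ∀ i, ξ * T i = T i * ξ
  ξ_ξ : ξ * ξ = 0
  D_T : ∀ i, D * T i = T i * D + (i : ℂ) • T i
  D_ξ : D * ξ = ξ * D
  P_T : ∀ i, P * T i = T i * P
  P_ξ : P * ξ = -(ξ * P) + 1
  P_D : P * D = D * P
  P_P : P * P = 0
  x_T : ∀ m i, x m * T i = T i * x m
  x_ξ : ∀ m, x m * ξ = ξ * x m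
  x_D : ∀ m, x m * D = D * x m
  x_P : ∀ m, x m * P = P * x m
  y_T : ∀ m i, y m * T i = T i * y m
  y_ξ : ∀ m, y m * ξ = -(ξ * y m)
  y_D : ∀ m, y m * D = D * y m
  y_P : ∀ m, y m * P = -(P * y m)
  x_x : ∀ m n, x m * x n = x n * x m +
    (((n : ℂ) - m) • x (m + n) + (m : ℂ) • x m - (n : ℂ) • x n)
  x_y : ∀ m n, x m * y n = y n * x m +
    (((n : ℂ) - m / 2) • y (m + n) + ((m : ℂ) / 2) • y m - (n : ℂ) • y n)
  y_y : ∀ m n, y m * y n = -(y n * y m) + (2 : ℂ) • (x n + x m - x (m + n))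

theorem mul_mul_of_mul_eq {B : Type} [Semigroup B] {a b c : B} (h : a * b = c) (z : B) :
    a * (b * z) = c * z := by rw [← mul_assoc, h]

/-! ### Commutation relations of the candidates for t^{-m}L_m and t^{-m}G_m -/

namespace SplitSystem
variable {B : Type} [Ring B] [Algebra ℂ B] (S : SplitSystem B)

/-- `t^{-m} L_m`. -/
def l (m : ℤ) : B := S.D + ((m : ℂ) / 2) • (S.ξ * S.P) + S.x m - ((m : ℂ) / 2) • (S.ξ * S.y m)

/-- `t^{-m} G_m`. -/
def g (m : ℤ) : B := S.ξ * S.D - S.P + S.y m + (2 : ℂ) • (S.ξ * S.x m)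

/-- With the four lemmas that follow, this moves ξ to the left inside right-associated products.
Normal order puts ξ first, then `D`, then `P`, then the `x` and `y`. -/
theorem ξξ_mul (z : B) : S.ξ * (S.ξ * z) = 0 := by rw [← mul_assoc, S.ξ_ξ, zero_mul]

theorem Dξ_mul (z : B) : S.D * (S.ξ * z) = S.ξ * (S.D * z) := by
  rw [← mul_assoc, S.D_ξ, mul_assoc]

theorem Pξ_mul (z : B) : S.P * (S.ξ * z) = -(S.ξ * (S.P * z)) + z := by
  rw [← mul_assoc, S.P_ξ]; noncomm_ring

theorem xξ_mul (m : ℤ) (z : B) : S.x m * (S.ξ * z) = S.ξ * (S.x m * z) := by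
  rw [← mul_assoc, S.x_ξ, mul_assoc]

theorem yξ_mul (m : ℤ) (z : B) : S.y m * (S.ξ * z) = -(S.ξ * (S.y m * z)) := by
  rw [← mul_assoc, S.y_ξ, neg_mul, mul_assoc]

/-- Only the summand `D` of `l m` fails to commute with t^i, so the extra term does not depend on m.
In `g_T` the same role is played by ξD. -/
theorem l_T (m i : ℤ) : S.l m * S.T i = S.T i * S.l m + (i : ℂ) • S.T i := by
  simp only [l, add_mul, sub_mul, mul_add, mul_sub, smul_mul_assoc, mul_smul_comm, mul_assoc,
    S.D_T, S.P_T, S.x_T, S.y_T]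
  simp only [← mul_assoc, S.ξ_T]
  module

theorem g_T (m i : ℤ) : S.g m * S.T i = S.T i * S.g m + (i : ℂ) • (S.T i * S.ξ) := by
  simp only [g, add_mul, sub_mul, mul_add, mul_sub, smul_mul_assoc, mul_smul_comm, mul_assoc,
    S.D_T, S.P_T, S.x_T, S.y_T]
  simp only [← mul_assoc, S.ξ_T]
  module

/-- The summand (m/2)ξP is the only source of the extra term: ξPξ = ξ, while ξξP = 0. -/
theorem l_ξ (m : ℤ) : S.l m * S.ξ = S.ξ * S.l m + ((m : ℂ) / 2) • S.ξ := by
  simp only [l, add_mul, sub_mul, mul_add, mul_sub, smul_mul_assoc, mul_smul_comm, mul_assoc,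
    S.D_ξ, S.P_ξ, S.x_ξ, S.y_ξ, S.ξξ_mul, mul_neg, mul_one]
  module

theorem g_ξ (m : ℤ) : S.g m * S.ξ = -(S.ξ * S.g m) - 1 := by
  simp only [g, add_mul, sub_mul, mul_add, mul_sub, smul_mul_assoc, mul_smul_comm, mul_assoc,
    S.D_ξ, S.P_ξ, S.x_ξ, S.y_ξ, S.ξξ_mul]
  module

/-- This is the bracket of L_m and L_n with powers of t removed: by `l_T`, moving t^n to the left
past `l m` adds the scalar n, and a common factor t^{m+n} is then cancelled. `l_g` and `g_g` have
the same origin; moving t^n past `g m` adds nξ. -/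
theorem l_l (m n : ℤ) : (S.l m + (n : ℂ) • 1) * S.l n =
    (S.l n + (m : ℂ) • 1) * S.l m + ((n : ℂ) - m) • S.l (m + n) := by
  simp only [l, add_mul, sub_mul, mul_add, mul_sub, smul_mul_assoc, mul_smul_comm, mul_assoc,
    S.P_D, S.x_D, S.y_D, S.P_P, S.x_P, S.y_P,
    S.ξξ_mul, S.Dξ_mul, S.Pξ_mul, S.xξ_mul, S.yξ_mul,
    -- The indices are fixed because `x_x` and `y_y` with free indices would swap factors back and
    -- forth. Both instances of `x_y` occur, since the terms ξ·y in `l m` and in `l n` each meet an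
    -- x.
    mul_neg, one_mul, S.x_x m n, S.x_y m n, S.x_y n m, S.y_y m n,
    add_comm n m, mul_zero]
  push_cast
  module

theorem l_g (m n : ℤ) : (S.l m + (n : ℂ) • 1) * S.g n =
    (S.g n + (m : ℂ) • S.ξ) * S.l m + ((n : ℂ) - m / 2) • S.g (m + n) := by
  simp only [l, g, add_mul, sub_mul, mul_add, mul_sub, smul_mul_assoc, mul_smul_comm, mul_assoc,
    S.P_D, S.x_D, S.y_D, S.P_P, S.x_P, S.y_P,
    S.ξξ_mul, S.Dξ_mul, S.Pξ_mul, S.xξ_mul, S.yξ_mul,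
    mul_neg, one_mul, S.x_x m n, S.x_y m n, S.y_y m n,
    mul_zero]
  module

theorem g_g (m n : ℤ) : (S.g m + (n : ℂ) • S.ξ) * S.g n =
    -((S.g n + (m : ℂ) • S.ξ) * S.g m) + (-2 : ℂ) • S.l (m + n) := by
  simp only [l, g, add_mul, sub_mul, mul_add, mul_sub, smul_mul_assoc, mul_smul_comm, mul_assoc,
    S.P_D, S.x_D, S.y_D, S.P_P, S.x_P, S.y_P,
    S.ξξ_mul, S.Dξ_mul, S.Pξ_mul, S.xξ_mul, S.yξ_mul,
    S.x_x m n, S.x_y m n, S.x_y n m, S.y_y m n,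
    add_comm n m]
  push_cast
  module

/-- Collecting the powers of t on the left turns the relations of Ū into the t-free identities
above. -/
theorem TlT_mul (m n : ℤ) (z : B) :
    S.T m * S.l m * (S.T n * z) = S.T (m + n) * ((S.l m + (n : ℂ) • 1) * z) := by
  rw [← S.T_T, mul_assoc, mul_mul_of_mul_eq (S.l_T m n)]
  simp only [add_mul, mul_add, smul_mul_assoc, mul_smul_comm, one_mul, mul_assoc]

theorem TgT_mul (m n : ℤ) (z : B) :
    S.T m * S.g m * (S.T n * z) = S.T (m + n) * ((S.g m + (n : ℂ) • S.ξ) * z) := by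
  rw [← S.T_T, mul_assoc, mul_mul_of_mul_eq (S.g_T m n)]
  simp only [add_mul, mul_add, smul_mul_assoc, mul_smul_comm, mul_assoc]

/-- The system of `Ū` determined by a split system. -/
def toUBarSystem : UBarSystem B where
  L m := S.T m * S.l m
  G m := S.T m * S.g m
  T := S.T
  Xi m := S.T m * S.ξ
  L_L m n := by
    rw [S.TlT_mul, S.TlT_mul, S.l_l, add_comm n m, mul_add, mul_smul_comm]
  L_G m n := by
    rw [S.TlT_mul, S.TgT_mul, S.l_g, add_comm n m, mul_add, mul_smul_comm]
  G_G m n := by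
    rw [S.TgT_mul, S.TgT_mul, S.g_g, add_comm n m, mul_add, mul_smul_comm, mul_neg]
  L_T m i := by
    rw [← mul_one (S.T i), S.TlT_mul, mul_one, mul_one, mul_add, ← mul_assoc (S.T i), S.T_T,
      add_comm i m, mul_smul_comm, mul_one]
  L_Xi m i := by
    rw [S.TlT_mul, add_mul, S.l_ξ, smul_mul_assoc, one_mul, ← mul_assoc _ _ (S.l m),
      mul_assoc (S.T i), S.ξ_T, ← mul_assoc, S.T_T, add_comm i m]
    simp only [mul_add, mul_smul_comm, mul_assoc]
    module
  G_T m i := by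
    rw [← mul_one (S.T i), S.TgT_mul, mul_one, mul_one, mul_add, ← mul_assoc (S.T i), S.T_T,
      add_comm i m, mul_smul_comm]
  G_Xi m i := by
    rw [S.TgT_mul, add_mul, S.g_ξ, smul_mul_assoc, S.ξ_ξ, ← mul_assoc _ _ (S.g m),
      mul_assoc (S.T i), S.ξ_T, ← mul_assoc, S.T_T, add_comm i m]
    simp only [mul_sub, mul_neg, mul_assoc, mul_one, smul_zero, add_zero]
  T_T := S.T_T
  T_zero := S.T_zero
  T_Xi i j := by rw [← mul_assoc, S.T_T]
  Xi_T i j := by rw [mul_assoc, S.ξ_T, ← mul_assoc, S.T_T]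
  Xi_Xi i j := by rw [mul_assoc, mul_mul_of_mul_eq (S.ξ_T j), mul_assoc, S.ξ_ξ, mul_zero, mul_zero]

end SplitSystem

/-! ### The isomorphism `𝒯 ≅ (t - 1) s̄` -/

/-! ### A representation that separates the X_m and Y_m -/

theorem tensor_hom_ext {M : Type} [AddCommGroup M] [Module ℂ M] {f g : A ⊗[ℂ] A →ₗ[ℂ] M}
    (h00 : ∀ i j, f (tPow i ⊗ₜ tPow j) = g (tPow i ⊗ₜ tPow j))
    (h01 : ∀ i j, f (tPow i ⊗ₜ tXi j) = g (tPow i ⊗ₜ tXi j))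
    (h10 : ∀ i j, f (tXi i ⊗ₜ tPow j) = g (tXi i ⊗ₜ tPow j))
    (h11 : ∀ i j, f (tXi i ⊗ₜ tXi j) = g (tXi i ⊗ₜ tXi j)) : f = g := by
  refine TensorProduct.ext (A_hom_ext (fun i => ?_) fun i => ?_)
  · exact A_hom_ext (h00 i) (h01 i)
  · exact A_hom_ext (h10 i) (h11 i)

open TensorProduct in
/-- The action of `Ū` on `A ⊗ A` in which `A` acts on the first factor and `s̄` on both. -/
def tensorSystem : UBarSystem (Module.End ℂ (A ⊗[ℂ] A)) where
  -- The algebra s̄ acts by the super Leibniz rule; `A.parity` is the sign for moving the odd G_n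
  -- past the first factor. Since `A` acts on the first factor alone, its brackets with s̄ see only
  -- the action there, as the relations of s̄ ⋉ A require.
  L n := map (actL n) LinearMap.id + map LinearMap.id (actL n)
  G n := map (actG n) LinearMap.id + map A.parity (actG n)
  T n := map (LinearMap.mulLeft ℂ (tPow n)) LinearMap.id
  Xi n := map (LinearMap.mulLeft ℂ (tXi n)) LinearMap.id
  L_L m n := by
    apply tensor_hom_ext <;> intro i j <;>
    · simp only [Module.End.mul_apply, LinearMap.add_apply, LinearMap.smul_apply, map_tmul,
        LinearMap.id_apply, map_add, map_smul, actL_tPow, actL_tXi, ← smul_tmul', tmul_smul,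
        smul_add, add_left_comm m n, add_assoc]
      push_cast
      module
  L_G m n := by
    apply tensor_hom_ext <;> intro i j <;>
    · simp only [Module.End.mul_apply, LinearMap.add_apply, LinearMap.smul_apply, map_tmul,
        LinearMap.id_apply, map_add, map_smul, map_neg, actL_tPow, actL_tXi, actG_tPow, actG_tXi,
        A_parity_tPow, A_parity_tXi, ← smul_tmul', tmul_smul, neg_tmul, tmul_neg, smul_add,
        add_left_comm m n, add_assoc]
      push_cast
      module
  G_G m n := by
    apply tensor_hom_ext <;> intro i j <;>
    · simp only [Module.End.mul_apply, LinearMap.add_apply, LinearMap.smul_apply,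
        LinearMap.neg_apply, map_tmul,
        LinearMap.id_apply, map_add, map_smul, map_neg, actL_tPow, actL_tXi, actG_tPow, actG_tXi,
        A_parity_tPow, A_parity_tXi, ← smul_tmul', tmul_smul, neg_tmul, tmul_neg, smul_add,
        add_left_comm m n, add_assoc]
      push_cast
      module
  L_T m n := by
    apply tensor_hom_ext <;> intro i j <;>
    · simp only [Module.End.mul_apply, LinearMap.add_apply, LinearMap.smul_apply, map_tmul,
        LinearMap.id_apply, LinearMap.mulLeft_apply, map_add, map_smul, actL_tPow, actL_tXi,
        tPow_mul_tPow, tPow_mul_tXi, ← smul_tmul', tmul_smul,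
        add_left_comm m n, add_assoc]
      push_cast
      module
  L_Xi m n := by
    apply tensor_hom_ext <;> intro i j <;>
    · simp only [Module.End.mul_apply, LinearMap.add_apply, LinearMap.smul_apply, map_tmul,
        LinearMap.id_apply, LinearMap.mulLeft_apply, map_add, map_smul, map_zero, actL_tPow,
        actL_tXi, tXi_mul_tPow, tXi_mul_tXi, ← smul_tmul', tmul_smul, zero_tmul,
        smul_zero, add_left_comm m n, add_assoc]
      push_cast
      module
  G_T m n := by
    apply tensor_hom_ext <;> intro i j <;>
    · simp only [Module.End.mul_apply, LinearMap.add_apply, LinearMap.smul_apply, map_tmul,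
        LinearMap.id_apply, LinearMap.mulLeft_apply, map_add, map_smul, map_neg,
        actG_tPow, actG_tXi, A_parity_tPow, A_parity_tXi, tXi_mul_tPow, tXi_mul_tXi, tPow_mul_tPow,
        tPow_mul_tXi, ← smul_tmul', tmul_smul, zero_tmul,
        neg_tmul, tmul_neg, smul_zero, add_left_comm m n, add_assoc]
      push_cast
      module
  G_Xi m n := by
    apply tensor_hom_ext <;> intro i j <;>
    · simp only [Module.End.mul_apply, LinearMap.add_apply, LinearMap.sub_apply,
        LinearMap.neg_apply, map_tmul,
        LinearMap.id_apply, LinearMap.mulLeft_apply, map_add, map_smul, map_zero, map_neg,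
        actG_tPow, actG_tXi, A_parity_tPow, A_parity_tXi, tXi_mul_tPow, tXi_mul_tXi, tPow_mul_tPow,
        tPow_mul_tXi, ← smul_tmul', tmul_smul, zero_tmul,
        neg_tmul, tmul_neg, smul_zero, add_left_comm m n, add_assoc]
      module
  T_T m n := by
    apply tensor_hom_ext <;> intro i j <;>
    simp only [Module.End.mul_apply, map_tmul, LinearMap.id_apply, LinearMap.mulLeft_apply,
      tPow_mul_tPow, tPow_mul_tXi, add_assoc]
  T_zero := by
    rw [tPow_zero, LinearMap.mulLeft_one, map_id]; rfl
  T_Xi m n := by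
    apply tensor_hom_ext <;> intro i j <;>
    simp only [Module.End.mul_apply, map_tmul, LinearMap.id_apply, LinearMap.mulLeft_apply,
      tXi_mul_tPow, tXi_mul_tXi, tPow_mul_tXi, zero_tmul, _root_.map_zero, add_assoc]
  Xi_T m n := by
    apply tensor_hom_ext <;> intro i j <;>
    simp only [Module.End.mul_apply, map_tmul, LinearMap.id_apply, LinearMap.mulLeft_apply,
      tXi_mul_tPow, tXi_mul_tXi, tPow_mul_tXi, tPow_mul_tPow, add_assoc]
  Xi_Xi m n := by
    apply tensor_hom_ext <;> intro i j <;>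
    simp only [Module.End.mul_apply, map_tmul, LinearMap.id_apply, LinearMap.mulLeft_apply,
      tXi_mul_tPow, tXi_mul_tXi, _root_.map_zero, zero_tmul, LinearMap.zero_apply]

/-- A linear map `Ū → s̄` with `X_m ↦ L_m - L_0` and `Y_m ↦ G_m - G_0`. -/
def symbol : UBar →ₗ[ℂ] SBar :=
  (TensorProduct.lid ℂ SBar).toLinearMap ∘ₗ
    -- The first factor is specialised at t = 1, ξ = 0; the second is identified with s̄ after a
    -- shift by one that undoes the exponent of the test vector.
    TensorProduct.map (A.constr (fun _ => 1) (fun _ => 0))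
      (A.constr (fun n => SBar.L (n - 1)) (fun n => SBar.G (n - 1))) ∘ₗ
    -- The test vector is 1 ⊗ t. Every L_n and G_n kills 1, so only the action on the second factor
    -- counts, and there L_n and G_n send t to t^{n+1} and t^{n+1}ξ with coefficient 1.
    LinearMap.applyₗ (tPow 0 ⊗ₜ tPow 1) ∘ₗ tensorSystem.lift.toLinearMap

/-- X_m sends 1 ⊗ t to t^{-m} ⊗ t^{m+1} + (m/2) t^{-m}ξ ⊗ t^{m+1}ξ − 1 ⊗ t, and the specialisation ξ
= 0 in the first factor removes the middle term. In `symbol_Y` the two terms with ξ in the first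
factor vanish likewise. -/
theorem symbol_X (m : ℤ) : symbol (X m) = SBar.L m - SBar.L 0 := by
  simp only [symbol, LinearMap.comp_apply, AlgHom.toLinearMap_apply, X, map_sub, map_add, map_smul,
    map_mul, UBarSystem.lift_bL, UBarSystem.lift_bG, UBarSystem.lift_bT, UBarSystem.lift_bXi,
    LinearMap.applyₗ_apply_apply]
  simp [tensorSystem, actL_tPow, actG_tPow, A_parity_tPow, tPow_mul_tPow, tXi_mul_tPow, A.constr_tPow,
    A.constr_tXi]

theorem symbol_Y (m : ℤ) : symbol (Y m) = SBar.G m - SBar.G 0 := by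
  simp only [symbol, LinearMap.comp_apply, AlgHom.toLinearMap_apply, Y, map_sub, map_add, map_smul,
    map_mul, UBarSystem.lift_bL, UBarSystem.lift_bG, UBarSystem.lift_bT, UBarSystem.lift_bXi,
    LinearMap.applyₗ_apply_apply]
  simp [tensorSystem, actL_tPow, actG_tPow, A_parity_tPow, tPow_mul_tPow, tXi_mul_tPow, A.constr_tPow,
    A.constr_tXi]

/-! ### Transport of the bracket between (t−1)s̄ and 𝒯 -/

/-- The linear map `s̄ → Ū` with `L_m ↦ X_m` and `G_m ↦ Y_m`. -/
def toTau : SBar →ₗ[ℂ] UBar := SBar.constr X Y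

theorem toTau_L (m : ℤ) : toTau (SBar.L m) = X m := SBar.constr_L _ _ _

theorem toTau_G (m : ℤ) : toTau (SBar.G m) = Y m := SBar.constr_G _ _ _

theorem toTau_mem (x : SBar) : toTau x ∈ Tau := by
  have h := SBar.hom_ext (f := Tau.mkQ ∘ₗ toTau) (g := 0)
    (fun n => (Submodule.Quotient.mk_eq_zero _).2 (by rw [toTau_L]; exact X_mem_Tau n))
    (fun n => (Submodule.Quotient.mk_eq_zero _).2 (by rw [toTau_G]; exact Y_mem_Tau n))
  exact (Submodule.Quotient.mk_eq_zero _).1 (LinearMap.congr_fun h x)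

theorem toTau_mem_part {i : ZMod 2} {x : SBar} (hx : x ∈ SBar.part i) :
    toTau x ∈ UBar.part i := by
  have h := SBar.eq_of_mem (f := (UBar.part i).mkQ ∘ₗ toTau) (g := 0) (i := i)
    (by
      rintro rfl n
      exact (Submodule.Quotient.mk_eq_zero _).2 (by rw [toTau_L]; exact X_mem n))
    (by
      rintro rfl n
      exact (Submodule.Quotient.mk_eq_zero _).2 (by rw [toTau_G]; exact Y_mem n)) hx
  exact (Submodule.Quotient.mk_eq_zero _).1 h

/-- On all of s̄ this fails: L_0 is sent to X_0 = 0, although [L_0, L_m] = mL_m. The brackets of the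
X and Y differ from those of the L and G by terms that each depend on one of the two indices only.
On (t−1)s̄ both arguments are differences of neighbouring basis vectors, and the double difference
annihilates such terms. -/
theorem toTau_bracket {x y : SBar} (hx : x ∈ TMinusOne) (hy : y ∈ TMinusOne) :
    toTau (SBar.bracket x y) = superCommutator UBar.part (toTau x) (toTau y) := by
  obtain ⟨x, rfl⟩ := hx
  obtain ⟨y, rfl⟩ := hy
  -- Precomposing both arguments with t − 1 reduces the claim to basis vectors of s̄, without
  -- choosing a basis of the image.
  have h : (SBar.bracket.compl₁₂ (SBar.tMul - LinearMap.id) (SBar.tMul - LinearMap.id)).compr₂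
      toTau = (superCommutator UBar.part).compl₁₂ (toTau ∘ₗ (SBar.tMul - LinearMap.id))
        (toTau ∘ₗ (SBar.tMul - LinearMap.id)) := by
    have XX : ∀ m n, superCommutator UBar.part (X m) (X n) =
        ((n : ℂ) - m) • X (m + n) + (m : ℂ) • X m - (n : ℂ) • X n := fun m n => by
      rw [superCommutator_apply _ (X_mem m) (X_mem n), koszul_zero_left, one_smul, X_X]
    have XY : ∀ m n, superCommutator UBar.part (X m) (Y n) =
        ((n : ℂ) - m / 2) • Y (m + n) + ((m : ℂ) / 2) • Y m - (n : ℂ) • Y n := fun m n => by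
      rw [superCommutator_apply _ (X_mem m) (Y_mem n), koszul_zero_left, one_smul, X_Y]
    have YX : ∀ n m, superCommutator UBar.part (Y n) (X m) =
        -(((n : ℂ) - m / 2) • Y (n + m) + ((m : ℂ) / 2) • Y m - (n : ℂ) • Y n) := fun n m => by
      rw [superCommutator_apply _ (Y_mem n) (X_mem m), koszul_zero_right, one_smul, ← neg_sub, X_Y,
        add_comm m n]
    have YY : ∀ m n, superCommutator UBar.part (Y m) (Y n) =
        (2 : ℂ) • (X n + X m - X (m + n)) := fun m n => by
      rw [superCommutator_apply _ (Y_mem m) (Y_mem n), koszul_one_one, neg_smul, one_smul,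
        sub_neg_eq_add, Y_Y]
    refine SBar.hom_ext (fun m => SBar.hom_ext (fun n => ?_) fun n => ?_)
      (fun m => SBar.hom_ext (fun n => ?_) fun n => ?_) <;>
    · simp only [LinearMap.compl₁₂_apply, LinearMap.compr₂_apply, LinearMap.comp_apply,
        LinearMap.sub_apply, LinearMap.id_apply, SBar.tMul_L, SBar.tMul_G, map_sub, map_smul,
        SBar.bracket_L_L, SBar.bracket_L_G, SBar.bracket_G_L, SBar.bracket_G_G, toTau_L, toTau_G,
        XX, XY, YX, YY, ← add_assoc, add_right_comm m 1]
      push_cast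
      module
  exact LinearMap.congr_fun (LinearMap.congr_fun h x) y

/-- On a difference of neighbouring basis vectors the subtracted L_0 or G_0 cancels. This is where
the linear independence of the X_m, Y_m enters. -/
theorem symbol_toTau {x : SBar} (hx : x ∈ TMinusOne) : symbol (toTau x) = x := by
  obtain ⟨x, rfl⟩ := hx
  have h : symbol ∘ₗ toTau ∘ₗ (SBar.tMul - LinearMap.id) = SBar.tMul - LinearMap.id := by
    refine SBar.hom_ext (fun n => ?_) fun n => ?_ <;>
    · simp only [LinearMap.comp_apply, LinearMap.sub_apply, LinearMap.id_apply, SBar.tMul_L,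
        SBar.tMul_G, map_sub, toTau_L, toTau_G, symbol_X, symbol_Y]
      abel
  exact LinearMap.congr_fun h x

/-- The subtracted vectors L_0 and G_0 are sent to X_0 = 0 and Y_0 = 0, so X_m and Y_m return
unchanged. -/
theorem toTau_symbol {u : UBar} (hu : u ∈ Tau) : toTau (symbol u) = u := by
  have h : Tau ≤ LinearMap.eqLocus (toTau ∘ₗ symbol) LinearMap.id := by
    refine Submodule.span_le.2 ?_
    rintro _ (⟨m, -, rfl⟩ | ⟨m, -, rfl⟩)
    · change toTau (symbol (X m)) = X m
      rw [symbol_X, map_sub, toTau_L, toTau_L, X_zero, sub_zero]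
    · change toTau (symbol (Y m)) = Y m
      rw [symbol_Y, map_sub, toTau_G, toTau_G, Y_zero, sub_zero]
  exact h hu

/-- The difference telescopes into neighbouring differences, upwards or downwards according to the
sign of m. -/
theorem SBar.L_sub_L_zero_mem (m : ℤ) : SBar.L m - SBar.L 0 ∈ TMinusOne := by
  induction m using Int.induction_on with
  | zero => rw [sub_self]; exact zero_mem _
  | succ n h => rw [← sub_add_sub_cancel _ (SBar.L n)]; exact add_mem (TMinusOne_L n) h
  | pred n h =>
    have h' := TMinusOne_L (-(n : ℤ) - 1)
    rw [sub_add_cancel] at h'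
    convert sub_mem h h' using 1
    abel

theorem SBar.G_sub_G_zero_mem (m : ℤ) : SBar.G m - SBar.G 0 ∈ TMinusOne := by
  induction m using Int.induction_on with
  | zero => rw [sub_self]; exact zero_mem _
  | succ n h => rw [← sub_add_sub_cancel _ (SBar.G n)]; exact add_mem (TMinusOne_G n) h
  | pred n h =>
    have h' := TMinusOne_G (-(n : ℤ) - 1)
    rw [sub_add_cancel] at h'
    convert sub_mem h h' using 1
    abel

theorem symbol_mem {u : UBar} (hu : u ∈ Tau) : symbol u ∈ TMinusOne := by
  have h : Tau ≤ TMinusOne.comap symbol := by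
    refine Submodule.span_le.2 ?_
    rintro _ (⟨m, -, rfl⟩ | ⟨m, -, rfl⟩)
    · change symbol (X m) ∈ TMinusOne
      rw [symbol_X]; exact SBar.L_sub_L_zero_mem m
    · change symbol (Y m) ∈ TMinusOne
      rw [symbol_Y]; exact SBar.G_sub_G_zero_mem m
  exact h hu

/-- A linear equivalence between graded spaces that maps each component into the corresponding
component also reflects the components. -/
theorem mem_iff_of_isCompl {M N : Type} [AddCommGroup M] [Module ℂ M] [AddCommGroup N] [Module ℂ N]
    {p : ZMod 2 → Submodule ℂ M} {q : ZMod 2 → Submodule ℂ N} (hp : p 0 ⊔ p 1 = ⊤)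
    (hq : Disjoint (q 0) (q 1)) (e : M ≃ₗ[ℂ] N) (he : ∀ i, ∀ x ∈ p i, e x ∈ q i) (i : ZMod 2)
    (x : M) : x ∈ p i ↔ e x ∈ q i := by
  refine ⟨he i x, fun hx => ?_⟩
  have hx' : x ∈ p 0 ⊔ p 1 := by rw [hp]; trivial
  obtain ⟨y, hy, z, hz, rfl⟩ := Submodule.mem_sup.1 hx'
  rw [map_add] at hx
  rcases parity_cases i with rfl | rfl
  -- The odd summand z has an image that is odd by hypothesis and even as a difference of even
  -- elements; so it is 0, and z = 0 by injectivity.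
  · have h := Submodule.disjoint_def.1 hq (e z) (by
      simpa using sub_mem hx (he 0 y hy)) (he 1 z hz)
    rw [LinearEquiv.map_eq_zero_iff] at h
    rwa [h, add_zero]
  · have h := Submodule.disjoint_def.1 hq (e y) (he 0 y hy) (by
      simpa using sub_mem hx (he 1 z hz))
    rw [LinearEquiv.map_eq_zero_iff] at h
    rwa [h, zero_add]

/-- The linear equivalence underlying `(t - 1) s̄ ≅ 𝒯`. -/
def tauLinearEquiv : TMinusOne ≃ₗ[ℂ] Tau where
  toLinearMap := (toTau ∘ₗ TMinusOne.subtype).codRestrict Tau fun x => toTau_mem x.1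
  invFun u := ⟨symbol u.1, symbol_mem u.2⟩
  left_inv x := Subtype.ext (symbol_toTau x.2)
  right_inv u := Subtype.ext (toTau_symbol u.2)

theorem tauLinearEquiv_mem (i : ZMod 2) (x : TMinusOne) :
    x ∈ LieSuperalgebra.part i ↔ tauLinearEquiv x ∈ LieSuperalgebra.part (L := Tau) i :=
  mem_iff_of_isCompl (LieSuperalgebra.isCompl (L := TMinusOne)).sup_eq_top
    (LieSuperalgebra.isCompl (L := Tau)).disjoint tauLinearEquiv
    (fun _ _ hx => toTau_mem_part hx) i x

theorem tauLinearEquiv_bracket (x y : TMinusOne) :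
    tauLinearEquiv (LieSuperalgebra.bracket x y) =
      LieSuperalgebra.bracket (tauLinearEquiv x) (tauLinearEquiv y) :=
  Subtype.ext (toTau_bracket x.2 y.2)

/-- The isomorphism of Lie superalgebras `𝒯 ≅ (t - 1) s̄`. -/
def tauEquiv : LieSuperEquiv Tau TMinusOne where
  toLinearEquiv := tauLinearEquiv.symm
  map_part i u := by
    rw [tauLinearEquiv_mem, LinearEquiv.apply_symm_apply]
  map_bracket u v := by
    rw [LinearEquiv.symm_apply_eq, tauLinearEquiv_bracket, LinearEquiv.apply_symm_apply,
      LinearEquiv.apply_symm_apply]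

/-! ### The isomorphism `Ū ≅ 𝒦 ⊗ U(𝒯)` -/

/-! ### Relations in 𝒦 between t^n, ξ, t∂_t and ∂_ξ -/

namespace Weyl

theorem t_tInv : gen .t * gen .tInv = 1 := by simpa using rel .t_tInv
theorem tInv_t : gen .tInv * gen .t = 1 := by simpa using rel .tInv_t
theorem xi_t : gen .xi * gen .t = gen .t * gen .xi := by simpa using rel .xi_t
theorem xi_xi : gen .xi * gen .xi = 0 := by simpa using rel .xi_xi
theorem dt_t : gen .dt * gen .t = gen .t * gen .dt + 1 := by simpa using rel .dt_t
theorem dt_xi : gen .dt * gen .xi = gen .xi * gen .dt := by simpa using rel .dt_xi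
theorem dxi_t : gen .dxi * gen .t = gen .t * gen .dxi := by simpa using rel .dxi_t
theorem dxi_xi : gen .dxi * gen .xi = -(gen .xi * gen .dxi) + 1 := by simpa using rel .dxi_xi
theorem dxi_dt : gen .dxi * gen .dt = gen .dt * gen .dxi := by simpa using rel .dxi_dt
theorem dxi_dxi : gen .dxi * gen .dxi = 0 := by simpa using rel .dxi_dxi

/-- `t` as a unit of `𝒦`. -/
def unitT : Weylˣ := ⟨gen .t, gen .tInv, t_tInv, tInv_t⟩

/-- `t^n` in `𝒦`. -/
def T (n : ℤ) : Weyl := ↑(unitT ^ n)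

/-- `t ∂_t` in `𝒦`. -/
def euler : Weyl := gen .t * gen .dt

theorem T_zero : T 0 = 1 := by simp [T]
theorem T_one : T 1 = gen .t := by simp [T, unitT]
theorem T_neg_one : T (-1) = gen .tInv := by simp [T, unitT]
theorem T_T (i j : ℤ) : T i * T j = T (i + j) := by simp [T, zpow_add]
-- An element commuting with a unit commutes with all its integer powers, so no separate relation
-- with t⁻¹ is needed.
theorem xi_T (i : ℤ) : gen .xi * T i = T i * gen .xi :=
  (Commute.units_zpow_right (u := unitT) xi_t i).eq
theorem dxi_T (i : ℤ) : gen .dxi * T i = T i * gen .dxi :=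
  (Commute.units_zpow_right (u := unitT) dxi_t i).eq

/-- The operator t∂_t, unlike ∂_t, preserves the degree in t: its commutator with t^i is a multiple
of t^i itself. -/
theorem euler_T (i : ℤ) : euler * T i = T i * euler + (i : ℂ) • T i := by
  have h1 : euler * T 1 = T 1 * euler + T 1 := by
    rw [T_one, euler, mul_assoc, dt_t, mul_add, mul_one, ← mul_assoc]
  have h2 : euler * T (-1) = T (-1) * euler - T (-1) := by
    -- Multiplying the relation for t by t⁻¹ on both sides gives the relation for t⁻¹.
    have h : T (-1) * (euler * T 1) * T (-1) = T (-1) * (T 1 * euler + T 1) * T (-1) := by rw [h1]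
    simp only [mul_add, add_mul, ← mul_assoc, T_T, neg_add_cancel, T_zero, one_mul] at h
    rw [mul_assoc, T_T, add_neg_cancel, T_zero, mul_one] at h
    rw [h, add_sub_cancel_right]
  induction i using Int.induction_on with
  | zero => simp [T_zero]
  | succ n h =>
    rw [← T_T, ← mul_assoc, h, add_mul, mul_assoc, h1, mul_add, ← mul_assoc, smul_mul_assoc, T_T]
    push_cast
    module
  | pred n h =>
    rw [sub_eq_add_neg, ← T_T, ← mul_assoc, h, add_mul, mul_assoc, h2, mul_sub, ← mul_assoc,
      smul_mul_assoc, T_T]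
    push_cast
    module

theorem euler_xi : euler * gen .xi = gen .xi * euler := by
  rw [euler, mul_assoc, dt_xi, ← mul_assoc, ← xi_t, mul_assoc]

theorem dxi_euler : gen .dxi * euler = euler * gen .dxi := by
  rw [euler, ← mul_assoc, dxi_t, mul_assoc, dxi_dt, mul_assoc]

theorem gen_mem_zero {g : WeylGen} (hg : g.sign = 1) : gen g ∈ part 0 :=
  mem_parityPart_zero.2 (by rw [parityHom_gen, hg, one_smul])

theorem gen_mem_one {g : WeylGen} (hg : g.sign = -1) : gen g ∈ part 1 :=
  mem_parityPart_one.2 (by rw [parityHom_gen, hg, neg_smul, one_smul])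

theorem euler_mem : euler ∈ part 0 := by
  have h : euler ∈ part (0 + 0) := SetLike.mul_mem_graded (gen_mem_zero rfl) (gen_mem_zero rfl)
  rwa [add_zero] at h

theorem T_mem (n : ℤ) : T n ∈ part 0 := by
  have mul : ∀ {a b : Weyl}, a ∈ part 0 → b ∈ part 0 → a * b ∈ part 0 := fun ha hb => by
    have h := SetLike.mul_mem_graded ha hb
    rwa [add_zero] at h
  induction n using Int.induction_on with
  | zero => rw [T_zero]; exact SetLike.one_mem_graded part
  | succ n h => rw [← T_T, T_one]; exact mul h (gen_mem_zero rfl)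
  | pred n h => rw [sub_eq_add_neg, ← T_T, T_neg_one]; exact mul h (gen_mem_zero rfl)

/-- `𝒦` is generated by `t`, `t⁻¹`, `ξ`, `∂_t`, `∂_ξ`. -/
theorem induction_on {p : Weyl → Prop} (a : Weyl) (hg : ∀ g, p (gen g))
    (hc : ∀ c : ℂ, p (algebraMap ℂ Weyl c)) (ha : ∀ a b, p a → p b → p (a + b))
    (hm : ∀ a b, p a → p b → p (a * b)) : p a := by
  obtain ⟨a, rfl⟩ := RingQuot.mkAlgHom_surjective ℂ WeylRel a
  induction a using FreeAlgebra.induction with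
  | grade0 c => rw [AlgHom.commutes]; exact hc c
  | grade1 g => exact hg g
  | mul a b iha ihb => rw [map_mul]; exact hm _ _ iha ihb
  | add a b iha ihb => rw [map_add]; exact ha _ _ iha ihb

theorem hom_ext {B : Type} [Ring B] [Algebra ℂ B] {f g : Weyl →ₐ[ℂ] B}
    (h : ∀ x, f (gen x) = g (gen x)) : f = g := by
  refine RingQuot.ringQuot_ext' ℂ f g ?_
  ext x
  exact h x

end Weyl

/-! #### The homomorphism from `Ū` -/

/-- `𝒦 ⊗ U(𝒯)`. -/
abbrev WeylTau : Type := Weyl.part ᵍ⊗[ℂ] SuperUEA.part Tau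

/-- The embedding of the first factor. -/
def inWeyl : Weyl →ₐ[ℂ] WeylTau := GradedTensorProduct.includeLeft _ _

/-- The embedding of the second factor. -/
def inUTau : SuperUEA Tau →ₐ[ℂ] WeylTau := GradedTensorProduct.includeRight _ _

theorem inWeyl_mul_inUTau (a : Weyl) (b : SuperUEA Tau) :
    inWeyl a * inUTau b = GradedTensorProduct.tmul ℂ a b :=
  GradedTensorProduct.tmul_one_mul_one_tmul _ _ a b

/-- The graded tensor product takes its signs in the units of ℤ with exponent in `ZMod 2`; here they
are matched with the complex sign. -/
theorem uzpow_smul_eq_koszul {M : Type} [AddCommGroup M] [Module ℂ M] (i j : ZMod 2) (x : M) :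
    ((-1 : ℤˣ) ^ (i * j)) • x = koszul i j • x := by
  rcases parity_cases i with rfl | rfl
  · rw [zero_mul, uzpow_zero, one_smul, koszul_zero_left, one_smul]
  · rcases parity_cases j with rfl | rfl
    · rw [mul_zero, uzpow_zero, one_smul, koszul_zero_right, one_smul]
    · rw [mul_one, uzpow_one, koszul_one_one, neg_smul, one_smul, Units.neg_smul, one_smul]

/-- The product rule on (1 ⊗ b)(a ⊗ 1) yields the Koszul sign, and all supercommutation of 𝒦 with
U(𝒯) in the tensor product comes from it. -/
theorem inUTau_mul_inWeyl {i j : ZMod 2} {a : Weyl} {b : SuperUEA Tau} (ha : a ∈ Weyl.part i)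
    (hb : b ∈ SuperUEA.part Tau j) :
    inUTau b * inWeyl a = koszul j i • (inWeyl a * inUTau b) := by
  have h := GradedTensorProduct.tmul_coe_mul_coe_tmul (R := ℂ) Weyl.part (SuperUEA.part Tau) 1
    ⟨b, hb⟩ ⟨a, ha⟩ 1
  rw [one_mul, mul_one, uzpow_smul_eq_koszul] at h
  rw [inWeyl_mul_inUTau]
  exact h

/-! ### Relations between X_m and Y_m in U(𝒯) -/

theorem SuperUEA_ι_mem {L : Type} [AddCommGroup L] [Module ℂ L] [LieSuperalgebra L] {i : ZMod 2}
    {x : L} (hx : x ∈ LieSuperalgebra.part i) : SuperUEA.ι x ∈ SuperUEA.part L i := by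
  change SuperUEA.parityHom L (SuperUEA.ι x) = _
  rw [SuperUEA.parityHom_ι, LieSuperalgebra.parity_of_mem hx, map_smul]

/-- `X_m` as an element of `U(𝒯)`. -/
def uX (m : ℤ) : SuperUEA Tau := SuperUEA.ι ⟨X m, X_mem_Tau m⟩

/-- `Y_m` as an element of `U(𝒯)`. -/
def uY (m : ℤ) : SuperUEA Tau := SuperUEA.ι ⟨Y m, Y_mem_Tau m⟩

theorem uX_mem (m : ℤ) : uX m ∈ SuperUEA.part Tau 0 := SuperUEA_ι_mem (X_mem m)

theorem uY_mem (m : ℤ) : uY m ∈ SuperUEA.part Tau 1 := SuperUEA_ι_mem (Y_mem m)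

/-- This makes the formulas for L_0 and G_0 collapse to elements of 𝒦. -/
theorem uX_zero : uX 0 = 0 := by
  rw [uX, ← map_zero SuperUEA.ι]
  exact congrArg _ (Subtype.ext X_zero)

theorem uY_zero : uY 0 = 0 := by
  rw [uY, ← map_zero SuperUEA.ι]
  exact congrArg _ (Subtype.ext Y_zero)

theorem Tau_bracket_coe {i j : ZMod 2} {x y : Tau} (hx : x ∈ LieSuperalgebra.part i)
    (hy : y ∈ LieSuperalgebra.part j) :
    (LieSuperalgebra.bracket x y : Tau).1 = x.1 * y.1 - koszul i j • (y.1 * x.1) :=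
  superCommutator_apply UBar.part hx hy

/-- The product of U(𝒯) is not that of Ū, but the bracket of 𝒯 is by definition the supercommutator
in Ū. So the commutation formula in Ū passes to U(𝒯) through the enveloping relation, although the
individual products do not. -/
theorem uX_uX (m n : ℤ) : uX m * uX n = uX n * uX m +
    (((n : ℂ) - m) • uX (m + n) + (m : ℂ) • uX m - (n : ℂ) • uX n) := by
  have hm : (⟨X m, X_mem_Tau m⟩ : Tau) ∈ LieSuperalgebra.part (L := Tau) 0 := X_mem m
  have hn : (⟨X n, X_mem_Tau n⟩ : Tau) ∈ LieSuperalgebra.part (L := Tau) 0 := X_mem n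
  have h := SuperUEA.ι_mul_ι hm hn
  rw [koszul_zero_left, one_smul] at h
  simp only [uX, ← map_smul, ← map_add, ← map_sub]
  rw [h]
  congr 2
  refine Subtype.ext ((Tau_bracket_coe hm hn).trans ?_)
  rw [koszul_zero_left, one_smul]
  exact X_X m n

theorem uX_uY (m n : ℤ) : uX m * uY n = uY n * uX m +
    (((n : ℂ) - m / 2) • uY (m + n) + ((m : ℂ) / 2) • uY m - (n : ℂ) • uY n) := by
  have hm : (⟨X m, X_mem_Tau m⟩ : Tau) ∈ LieSuperalgebra.part (L := Tau) 0 := X_mem m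
  have hn : (⟨Y n, Y_mem_Tau n⟩ : Tau) ∈ LieSuperalgebra.part (L := Tau) 1 := Y_mem n
  have h := SuperUEA.ι_mul_ι hm hn
  rw [koszul_zero_left, one_smul] at h
  simp only [uX, uY, ← map_smul, ← map_add, ← map_sub]
  rw [h]
  congr 2
  refine Subtype.ext ((Tau_bracket_coe hm hn).trans ?_)
  rw [koszul_zero_left, one_smul]
  exact X_Y m n

theorem uY_uY (m n : ℤ) : uY m * uY n = -(uY n * uY m) +
    (2 : ℂ) • (uX n + uX m - uX (m + n)) := by
  have hm : (⟨Y m, Y_mem_Tau m⟩ : Tau) ∈ LieSuperalgebra.part (L := Tau) 1 := Y_mem m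
  have hn : (⟨Y n, Y_mem_Tau n⟩ : Tau) ∈ LieSuperalgebra.part (L := Tau) 1 := Y_mem n
  have h := SuperUEA.ι_mul_ι hm hn
  rw [koszul_one_one, neg_smul, one_smul] at h
  simp only [uX, uY, ← map_smul, ← map_add, ← map_sub]
  rw [h]
  congr 2
  refine Subtype.ext ((Tau_bracket_coe hm hn).trans ?_)
  rw [koszul_one_one, neg_smul, one_smul, sub_neg_eq_add]
  exact Y_Y m n

theorem inX_inWeyl (m : ℤ) {i : ZMod 2} {a : Weyl} (ha : a ∈ Weyl.part i) :
    inUTau (uX m) * inWeyl a = inWeyl a * inUTau (uX m) := by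
  rw [inUTau_mul_inWeyl ha (uX_mem m), koszul_zero_left, one_smul]

theorem inY_inWeyl_even (m : ℤ) {a : Weyl} (ha : a ∈ Weyl.part 0) :
    inUTau (uY m) * inWeyl a = inWeyl a * inUTau (uY m) := by
  rw [inUTau_mul_inWeyl ha (uY_mem m), koszul_zero_right, one_smul]

theorem inY_inWeyl_odd (m : ℤ) {a : Weyl} (ha : a ∈ Weyl.part 1) :
    inUTau (uY m) * inWeyl a = -(inWeyl a * inUTau (uY m)) := by
  rw [inUTau_mul_inWeyl ha (uY_mem m), koszul_one_one, neg_smul, one_smul]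

/-- The split system in `𝒦 ⊗ U(𝒯)`. -/
def weylTauSystem : SplitSystem WeylTau where
  T n := inWeyl (Weyl.T n)
  ξ := inWeyl (Weyl.gen .xi)
  D := inWeyl Weyl.euler
  P := inWeyl (Weyl.gen .dxi)
  x m := inUTau (uX m)
  y m := inUTau (uY m)
  T_T i j := by rw [← map_mul, Weyl.T_T]
  T_zero := by rw [Weyl.T_zero, map_one]
  ξ_T i := by rw [← map_mul, ← map_mul, Weyl.xi_T]
  ξ_ξ := by rw [← map_mul, Weyl.xi_xi, map_zero]
  D_T i := by rw [← map_mul, ← map_mul, ← map_smul, ← map_add, Weyl.euler_T]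
  D_ξ := by rw [← map_mul, ← map_mul, Weyl.euler_xi]
  P_T i := by rw [← map_mul, ← map_mul, Weyl.dxi_T]
  P_ξ := by rw [← map_mul, ← map_mul, ← map_neg, ← map_one inWeyl, ← map_add, Weyl.dxi_xi]
  P_D := by rw [← map_mul, ← map_mul, Weyl.dxi_euler]
  P_P := by rw [← map_mul, Weyl.dxi_dxi, map_zero]
  x_T m i := inX_inWeyl m (Weyl.T_mem i)
  x_ξ m := inX_inWeyl m (Weyl.gen_mem_one rfl)
  x_D m := inX_inWeyl m Weyl.euler_mem
  x_P m := inX_inWeyl m (Weyl.gen_mem_one rfl)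
  y_T m i := inY_inWeyl_even m (Weyl.T_mem i)
  y_ξ m := inY_inWeyl_odd m (Weyl.gen_mem_one rfl)
  y_D m := inY_inWeyl_even m Weyl.euler_mem
  y_P m := inY_inWeyl_odd m (Weyl.gen_mem_one rfl)
  x_x m n := by simp only [← map_mul, ← map_smul, ← map_add, ← map_sub, uX_uX m n]
  x_y m n := by simp only [← map_mul, ← map_smul, ← map_add, ← map_sub, uX_uY m n]
  y_y m n := by simp only [← map_mul, ← map_smul, ← map_add, ← map_sub, ← map_neg, uY_uY m n]

/-- The homomorphism `Ū → 𝒦 ⊗ U(𝒯)`. -/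
def split : UBar →ₐ[ℂ] WeylTau := weylTauSystem.toUBarSystem.lift

theorem split_bL (m : ℤ) : split (bL m) = inWeyl (Weyl.T m) *
    (inWeyl Weyl.euler + ((m : ℂ) / 2) • (inWeyl (Weyl.gen .xi) * inWeyl (Weyl.gen .dxi)) +
      inUTau (uX m) - ((m : ℂ) / 2) • (inWeyl (Weyl.gen .xi) * inUTau (uY m))) :=
  UBarSystem.lift_bL _ m

theorem split_bG (m : ℤ) : split (bG m) = inWeyl (Weyl.T m) *
    (inWeyl (Weyl.gen .xi) * inWeyl Weyl.euler - inWeyl (Weyl.gen .dxi) + inUTau (uY m) +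
      (2 : ℂ) • (inWeyl (Weyl.gen .xi) * inUTau (uX m))) :=
  UBarSystem.lift_bG _ m

theorem split_bT (m : ℤ) : split (bT m) = inWeyl (Weyl.T m) := UBarSystem.lift_bT _ m

theorem split_bXi (m : ℤ) : split (bXi m) = inWeyl (Weyl.T m) * inWeyl (Weyl.gen .xi) :=
  UBarSystem.lift_bXi _ m

theorem split_bL_zero : split (bL 0) = inWeyl Weyl.euler := by
  simp [split_bL, uX_zero, Weyl.T_zero]

theorem split_bG_zero : split (bG 0) =
    inWeyl (Weyl.gen .xi) * inWeyl Weyl.euler - inWeyl (Weyl.gen .dxi) := by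
  simp [split_bG, uX_zero, uY_zero, Weyl.T_zero]

theorem split_bXi_zero : split (bXi 0) = inWeyl (Weyl.gen .xi) := by
  simp [split_bXi, Weyl.T_zero]

theorem inWeyl_T_neg_mul (m : ℤ) (z : WeylTau) :
    inWeyl (Weyl.T (-m)) * (inWeyl (Weyl.T m) * z) = z := by
  rw [← mul_assoc, ← map_mul, Weyl.T_T, neg_add_cancel, Weyl.T_zero, map_one, one_mul]

theorem inWeyl_xi_mul_xi_mul (z : WeylTau) :
    inWeyl (Weyl.gen .xi) * (inWeyl (Weyl.gen .xi) * z) = 0 := by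
  rw [← mul_assoc, ← map_mul, Weyl.xi_xi, map_zero, zero_mul]

theorem inWeyl_xi_T_mul (m : ℤ) (z : WeylTau) :
    inWeyl (Weyl.T (-m)) * inWeyl (Weyl.gen .xi) * (inWeyl (Weyl.T m) * z) =
      inWeyl (Weyl.gen .xi) * z := by
  rw [← map_mul, ← Weyl.xi_T, map_mul, mul_assoc, inWeyl_T_neg_mul]

/-- Since ξ² = 0, multiplying the image of t^{-m}G_m by ξ leaves −ξ∂_ξ + ξY_m. With the factor m/2
this cancels the two ξ-terms in the image of t^{-m}L_m, and subtracting t∂_t leaves X_m. -/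
theorem split_X (m : ℤ) : split (X m) = inUTau (uX m) := by
  simp only [X, map_sub, map_add, map_smul, map_mul split, split_bL_zero, split_bT, split_bXi]
  rw [split_bL, split_bG, inWeyl_T_neg_mul, inWeyl_xi_T_mul]
  simp only [mul_add, mul_sub, mul_smul_comm, inWeyl_xi_mul_xi_mul]
  module

theorem split_Y (m : ℤ) : split (Y m) = inUTau (uY m) := by
  simp only [Y, map_sub, map_add, map_smul, map_mul split, split_bL_zero, split_bG_zero, split_bT,
    split_bXi, Weyl.T_zero, map_one, one_mul]
  rw [split_bL, split_bG, inWeyl_T_neg_mul, inWeyl_xi_T_mul]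
  simp only [mul_add, mul_sub, mul_smul_comm, inWeyl_xi_mul_xi_mul]
  module

/-! #### The homomorphism to `Ū` -/

theorem bT_neg_one_mul (z : UBar) : bT (-1) * (bT 1 * z) = z := by
  rw [← mul_assoc, bT_bT, neg_add_cancel, bT_zero, one_mul]

theorem bL_zero_bXi_zero : bL 0 * bXi 0 = bXi 0 * bL 0 := by
  rw [bL_bXi]; simp

theorem bG_zero_bXi_zero : bG 0 * bXi 0 = -(bXi 0 * bG 0) - 1 := by
  rw [bG_bXi, add_zero, bT_zero]

theorem bL_zero_bG_zero : bL 0 * bG 0 = bG 0 * bL 0 := by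
  rw [bL_bG]; simp

/-- The relation [G_0, G_0] = −2L_0 says 2G_0² = −2L_0. This is what gives ∂_ξ² = 0 in Ū. -/
theorem bG_zero_bG_zero : bG 0 * bG 0 = -bL 0 := by
  have h := bG_bG 0 0
  have h2 : (2 : ℂ) • (bG 0 * bG 0) = (2 : ℂ) • -bL 0 := by
    rw [two_smul]
    nth_rewrite 1 [h]
    rw [add_zero]
    module
  exact smul_right_injective UBar (two_ne_zero' ℂ) h2

/-- The images in `Ū` of the generators of `𝒦`. -/
def weylImage : WeylGen → UBar
  | .t => bT 1
  | .tInv => bT (-1)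
  | .xi => bXi 0
  -- These come from solving L_0 = t∂_t and G_0 = ξt∂_t − ∂_ξ for the two derivations.
  | .dt => bT (-1) * bL 0
  | .dxi => bXi 0 * bL 0 - bG 0

/-- The homomorphism `𝒦 → Ū`. -/
def weylToUBar : Weyl →ₐ[ℂ] UBar :=
  RingQuot.liftAlgHom ℂ ⟨FreeAlgebra.lift ℂ weylImage, by
    -- These rules move t^i leftmost and ξ next, ahead of L_0 and G_0, inside right-associated
    -- products; the longer relations below then become linear identities.
    have hd : ∀ i z, bL 0 * (bT i * z) = bT i * (bL 0 * z) + (i : ℂ) • (bT i * z) := fun i z => by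
      rw [← mul_assoc, bL_bT, zero_add, add_mul, mul_assoc, smul_mul_assoc]
    have h1 : ∀ z, bXi 0 * (bXi 0 * z) = 0 := fun z => by rw [← mul_assoc, bXi_bXi, zero_mul]
    have h2 : ∀ z, bL 0 * (bXi 0 * z) = bXi 0 * (bL 0 * z) := fun z => by
      rw [← mul_assoc, bL_zero_bXi_zero, mul_assoc]
    have h3 : ∀ z, bG 0 * (bXi 0 * z) = -(bXi 0 * (bG 0 * z)) - z := fun z => by
      rw [← mul_assoc, bG_zero_bXi_zero, sub_mul, neg_mul, one_mul, mul_assoc]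
    have h4 : ∀ i z, bXi 0 * (bT i * z) = bT i * (bXi 0 * z) := fun i z => by
      rw [← mul_assoc, ← mul_assoc, bXi_bT, bT_bXi, add_comm]
    have h5 : ∀ i z, bG 0 * (bT i * z) = bT i * (bG 0 * z) + (i : ℂ) • (bT i * (bXi 0 * z)) :=
      fun i z => by
      rw [← mul_assoc, bG_bT, add_mul, mul_assoc, smul_mul_assoc, ← mul_assoc (bT i) (bXi 0), bT_bXi,
        zero_add, add_zero]
    intro a b h
    cases h <;>
      simp only [map_mul, map_add, map_neg, map_one, map_zero, FreeAlgebra.lift_ι_apply, weylImage]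
    · rw [bT_bT, add_neg_cancel, bT_zero]
    · rw [bT_bT, neg_add_cancel, bT_zero]
    · rw [bXi_bT, bT_bXi, add_comm]
    · exact bXi_bXi 0 0
    · rw [mul_assoc, bL_bT, zero_add, mul_add, mul_smul_comm, bT_neg_one_mul, bT_bT, neg_add_cancel,
        ← mul_assoc, bT_bT, add_neg_cancel, bT_zero, one_mul, Int.cast_one, one_smul]
    · rw [mul_assoc, bL_zero_bXi_zero, h4]
    · simp only [sub_mul, mul_sub, mul_assoc, bL_bT, bG_bT, zero_add, mul_add, mul_smul_comm, h4]
      rw [bXi_bT, zero_add]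
      module
    · rw [sub_mul, mul_assoc, bL_zero_bXi_zero, h1, bG_zero_bXi_zero, mul_sub, h1]
      abel
    · simp only [sub_mul, mul_sub, mul_assoc, hd, h5, h4, mul_add, mul_smul_comm, h2,
        bL_zero_bG_zero]
      module
    -- In (ξL_0 − G_0)² the cross terms add up to L_0, because G_0ξ = −ξG_0 − 1, and G_0² = −L_0
    -- cancels it.
    · simp only [sub_mul, mul_sub, mul_assoc, h1, h2, h3, bL_zero_bG_zero,
        bG_zero_bG_zero]
      abel⟩

theorem weylToUBar_gen (g : WeylGen) : weylToUBar (Weyl.gen g) = weylImage g :=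
  (RingQuot.liftAlgHom_mkAlgHom_apply ℂ _ _ _).trans (FreeAlgebra.lift_ι_apply _ _)

theorem weylToUBar_T (n : ℤ) : weylToUBar (Weyl.T n) = bT n := by
  induction n using Int.induction_on with
  | zero => rw [Weyl.T_zero, map_one, bT_zero]
  | succ n h => rw [← Weyl.T_T, map_mul, h, Weyl.T_one, weylToUBar_gen, ← bT_bT]; rfl
  | pred n h =>
    rw [sub_eq_add_neg, ← Weyl.T_T, map_mul, h, Weyl.T_neg_one, weylToUBar_gen, ← bT_bT]; rfl

theorem weylToUBar_euler : weylToUBar Weyl.euler = bL 0 := by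
  rw [Weyl.euler, map_mul, weylToUBar_gen, weylToUBar_gen]
  change bT 1 * (bT (-1) * bL 0) = bL 0
  rw [← mul_assoc, bT_bT, add_neg_cancel, bT_zero, one_mul]

/-- Both composites are algebra homomorphisms, so generators decide; this gives evenness of
`unsplit` on the first tensor factor. -/
theorem parityHom_weylToUBar (a : Weyl) :
    UBar.parityHom (weylToUBar a) = weylToUBar (Weyl.parityHom a) := by
  have h : UBar.parityHom.comp weylToUBar = weylToUBar.comp Weyl.parityHom := by
    refine Weyl.hom_ext fun g => ?_
    change UBar.parityHom (weylToUBar _) = weylToUBar (Weyl.parityHom _)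
    rw [Weyl.parityHom_gen, map_smul, weylToUBar_gen]
    have hL := mem_parityPart_zero.1 (bL_mem 0)
    have hG := mem_parityPart_one.1 (bG_mem 0)
    have hT := fun n => mem_parityPart_zero.1 (bT_mem n)
    have hXi := mem_parityPart_one.1 (bXi_mem 0)
    cases g <;> simp only [weylImage, WeylGen.sign, map_mul, map_sub, hL, hG, hT, hXi] <;>
      simp [sub_eq_add_neg, add_comm]
  exact DFunLike.congr_fun h a

/-- The homomorphism `U(𝒯) → Ū` extending the inclusion of `𝒯`. -/
def uTauToUBar : SuperUEA Tau →ₐ[ℂ] UBar :=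
  SuperUEA.lift Tau.subtype (by
    intro i j x y hx hy
    change x.1 * y.1 = koszul i j • (y.1 * x.1) + (LieSuperalgebra.bracket x y : Tau).1
    rw [Tau_bracket_coe hx hy, add_sub_cancel])

theorem uTauToUBar_ι (x : Tau) : uTauToUBar (SuperUEA.ι x) = x.1 := SuperUEA.lift_ι _ _ _

theorem Tau_induction {p : Tau → Prop} (x : Tau) (hX : ∀ m, p ⟨X m, X_mem_Tau m⟩)
    (hY : ∀ m, p ⟨Y m, Y_mem_Tau m⟩) (hz : p 0) (ha : ∀ x y, p x → p y → p (x + y))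
    (hs : ∀ (c : ℂ) x, p x → p (c • x)) : p x := by
  obtain ⟨x, hx⟩ := x
  induction hx using Submodule.span_induction with
  | mem u hu =>
    rcases hu with ⟨m, -, rfl⟩ | ⟨m, -, rfl⟩
    · exact hX m
    · exact hY m
  | zero => exact hz
  | add a b ha' hb' iha ihb => exact ha _ _ iha ihb
  | smul c a ha' iha => exact hs c _ iha

theorem UTau_induction {p : SuperUEA Tau → Prop} (u : SuperUEA Tau) (hX : ∀ m, p (uX m))
    (hY : ∀ m, p (uY m)) (hc : ∀ c : ℂ, p (algebraMap ℂ _ c)) (ha : ∀ x y, p x → p y → p (x + y))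
    (hm : ∀ x y, p x → p y → p (x * y)) : p u := by
  have hu : u ∈ Algebra.adjoin ℂ (Set.range (SuperUEA.ι (L := Tau))) := by
    rw [SuperUEA.adjoin_ι]; trivial
  induction hu using Algebra.adjoin_induction with
  | mem u hu =>
    obtain ⟨x, rfl⟩ := hu
    refine Tau_induction (p := fun x => p (SuperUEA.ι x)) x hX hY ?_ ?_ ?_
    · have h := hc 0
      rw [map_zero] at h
      rwa [map_zero]
    · intro x y hx hy
      rw [map_add]; exact ha _ _ hx hy
    · intro c x hx
      rw [map_smul, Algebra.smul_def]; exact hm _ _ (hc c) hx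
  | algebraMap c => exact hc c
  | add x y _ _ hx hy => exact ha _ _ hx hy
  | mul x y _ _ hx hy => exact hm _ _ hx hy

theorem uTauToUBar_uX (m : ℤ) : uTauToUBar (uX m) = X m := uTauToUBar_ι _

theorem uTauToUBar_uY (m : ℤ) : uTauToUBar (uY m) = Y m := uTauToUBar_ι _

theorem parityHom_uX (m : ℤ) : SuperUEA.parityHom Tau (uX m) = uX m :=
  mem_parityPart_zero.1 (uX_mem m)

theorem parityHom_uY (m : ℤ) : SuperUEA.parityHom Tau (uY m) = -uY m :=
  mem_parityPart_one.1 (uY_mem m)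

theorem parityHom_uTauToUBar (u : SuperUEA Tau) :
    UBar.parityHom (uTauToUBar u) = uTauToUBar (SuperUEA.parityHom Tau u) := by
  induction u using UTau_induction with
  | hX m => rw [parityHom_uX, uTauToUBar_uX]; exact mem_parityPart_zero.1 (X_mem m)
  | hY m => rw [parityHom_uY, map_neg, uTauToUBar_uY]; exact mem_parityPart_one.1 (Y_mem m)
  | hc c => simp only [AlgHom.commutes]
  | ha x y hx hy => simp only [map_add, hx, hy]
  | hm x y hx hy => simp only [map_mul, hx, hy]

/-! ### Supercommutation of the images of 𝒦 and U(𝒯) in Ū -/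

theorem weylToUBar_mul_X (a : Weyl) (m : ℤ) : weylToUBar a * X m = X m * weylToUBar a := by
  induction a using Weyl.induction_on with
  | hg g =>
    rw [weylToUBar_gen]
    cases g
    · exact (X_bT m 1).symm
    · exact (X_bT m (-1)).symm
    · exact (X_bXi m 0).symm
    · change bT (-1) * bL 0 * X m = X m * (bT (-1) * bL 0)
      rw [mul_assoc, ← X_bL_zero, ← mul_assoc, ← X_bT, mul_assoc]
    · change (bXi 0 * bL 0 - bG 0) * X m = X m * (bXi 0 * bL 0 - bG 0)
      rw [sub_mul, mul_sub, mul_assoc, ← X_bL_zero, ← X_bG_zero, ← mul_assoc, ← X_bXi, mul_assoc]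
  | hc c => rw [AlgHom.commutes, Algebra.commutes]
  | ha a b ha hb => rw [map_add, add_mul, mul_add, ha, hb]
  | hm a b ha hb => rw [map_mul, mul_assoc, hb, ← mul_assoc, ha, mul_assoc]

/-- Stating the sign through the parity automorphism avoids homogeneity assumptions on a, so the
induction over sums and products of generators goes through. The next two lemmas fix the parity of a
and use the same device for u in U(𝒯). -/
theorem weylToUBar_mul_Y (a : Weyl) (m : ℤ) :
    weylToUBar a * Y m = Y m * weylToUBar (Weyl.parityHom a) := by
  induction a using Weyl.induction_on with
  | hg g =>
    rw [Weyl.parityHom_gen, map_smul, weylToUBar_gen]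
    cases g
    · exact (Y_bT m 1).symm.trans (by rw [WeylGen.sign, one_smul]; rfl)
    · exact (Y_bT m (-1)).symm.trans (by rw [WeylGen.sign, one_smul]; rfl)
    · change bXi 0 * Y m = Y m * ((-1 : ℂ) • bXi 0)
      rw [mul_smul_comm, Y_bXi, neg_smul, one_smul, neg_neg]
    · change bT (-1) * bL 0 * Y m = Y m * ((1 : ℂ) • (bT (-1) * bL 0))
      rw [one_smul, mul_assoc, ← Y_bL_zero, ← mul_assoc, ← Y_bT, mul_assoc]
    · change (bXi 0 * bL 0 - bG 0) * Y m = Y m * ((-1 : ℂ) • (bXi 0 * bL 0 - bG 0))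
      rw [mul_smul_comm, sub_mul, mul_sub, mul_assoc, ← Y_bL_zero, Y_bG_zero,
        ← mul_assoc (Y m), Y_bXi, neg_mul, mul_assoc]
      module
  | hc c => rw [AlgHom.commutes, AlgHom.commutes, AlgHom.commutes, Algebra.commutes]
  | ha a b ha hb => simp only [map_add, add_mul, mul_add, ha, hb]
  | hm a b ha hb => rw [map_mul, mul_assoc, hb, ← mul_assoc, ha, mul_assoc, map_mul, map_mul]

theorem weylToUBar_even_mul {a : Weyl} (ha : a ∈ Weyl.part 0) (u : SuperUEA Tau) :
    weylToUBar a * uTauToUBar u = uTauToUBar u * weylToUBar a := by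
  induction u using UTau_induction with
  | hX m => rw [uTauToUBar_uX, weylToUBar_mul_X]
  | hY m => rw [uTauToUBar_uY, weylToUBar_mul_Y, mem_parityPart_zero.1 ha]
  | hc c => rw [AlgHom.commutes, Algebra.commutes]
  | ha x y hx hy => simp only [map_add, add_mul, mul_add, hx, hy]
  | hm x y hx hy => rw [map_mul, ← mul_assoc, hx, mul_assoc, hy, mul_assoc]

theorem weylToUBar_odd_mul {a : Weyl} (ha : a ∈ Weyl.part 1) (u : SuperUEA Tau) :
    weylToUBar a * uTauToUBar u = uTauToUBar (SuperUEA.parityHom Tau u) * weylToUBar a := by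
  induction u using UTau_induction with
  | hX m => rw [parityHom_uX, uTauToUBar_uX, weylToUBar_mul_X]
  | hY m =>
    rw [parityHom_uY, map_neg, uTauToUBar_uY, weylToUBar_mul_Y, mem_parityPart_one.1 ha, map_neg,
      mul_neg, neg_mul]
  | hc c => rw [AlgHom.commutes, AlgHom.commutes, AlgHom.commutes, Algebra.commutes]
  | ha x y hx hy => simp only [map_add, add_mul, mul_add, hx, hy]
  | hm x y hx hy => rw [map_mul, ← mul_assoc, hx, mul_assoc, hy, map_mul, map_mul, mul_assoc]

theorem weylToUBar_mul_uTauToUBar {i j : ZMod 2} {a : Weyl} {u : SuperUEA Tau}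
    (ha : a ∈ Weyl.part i) (hu : u ∈ SuperUEA.part Tau j) :
    weylToUBar a * uTauToUBar u = koszul j i • (uTauToUBar u * weylToUBar a) := by
  rcases parity_cases i with rfl | rfl
  · rw [weylToUBar_even_mul ha, koszul_zero_right, one_smul]
  · rw [weylToUBar_odd_mul ha]
    rcases parity_cases j with rfl | rfl
    · rw [mem_parityPart_zero.1 hu, koszul_zero_left, one_smul]
    · rw [mem_parityPart_one.1 hu, koszul_one_one, neg_smul, one_smul, map_neg, neg_mul]

/-- The homomorphism `𝒦 ⊗ U(𝒯) → Ū`. -/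
def unsplit : WeylTau →ₐ[ℂ] UBar :=
  GradedTensorProduct.lift _ _ weylToUBar uTauToUBar fun i j a u => by
    rw [uzpow_smul_eq_koszul]
    exact weylToUBar_mul_uTauToUBar a.2 u.2

theorem unsplit_tmul (a : Weyl) (u : SuperUEA Tau) :
    unsplit (GradedTensorProduct.tmul ℂ a u) = weylToUBar a * uTauToUBar u := rfl

theorem unsplit_inWeyl (a : Weyl) : unsplit (inWeyl a) = weylToUBar a := by
  rw [← mul_one (inWeyl a), ← map_one inUTau, inWeyl_mul_inUTau, unsplit_tmul, map_one, mul_one]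

theorem unsplit_inUTau (u : SuperUEA Tau) : unsplit (inUTau u) = uTauToUBar u := by
  rw [← one_mul (inUTau u), ← map_one inWeyl, inWeyl_mul_inUTau, unsplit_tmul, map_one, one_mul]

/-! ### The two homomorphisms are mutually inverse -/

theorem bT_mul_bT_neg_mul (m : ℤ) (z : UBar) : bT m * (bT (-m) * z) = z := by
  rw [← mul_assoc, bT_bT, add_neg_cancel, bT_zero, one_mul]

theorem bXi_zero_mul_bXi_mul (m : ℤ) (z : UBar) : bXi 0 * (bXi m * z) = 0 := by
  rw [← mul_assoc, bXi_bXi, zero_mul]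

/-- Inserting the definitions of X_m and Y_m into the formulas for L_m and G_m, every term except
L_m, respectively G_m, cancels or contains ξ². -/
theorem unsplit_comp_split : unsplit.comp split = AlgHom.id ℂ UBar := by
  have hT : ∀ m z, bXi 0 * (bT (-m) * z) = bXi (-m) * z := fun m z => by
    rw [← mul_assoc, bXi_bT, zero_add]
  have hXi : ∀ m z, bT m * (bXi (-m) * z) = bXi 0 * z := fun m z => by
    rw [← mul_assoc, bT_bXi, add_neg_cancel]
  refine UBar.hom_ext (fun m => ?_) (fun m => ?_) (fun m => ?_) (fun m => ?_)
  · change unsplit (split (bL m)) = bL m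
    simp only [split_bL, map_mul, map_add, map_sub, map_smul, unsplit_inWeyl, unsplit_inUTau,
      weylToUBar_T, weylToUBar_euler, weylToUBar_gen, uTauToUBar_uX, uTauToUBar_uY, weylImage, X, Y,
      mul_add, mul_sub, mul_smul_comm, bXi_zero_mul_bXi_mul, mul_zero, hT, hXi,
      bT_mul_bT_neg_mul]
    module
  · change unsplit (split (bG m)) = bG m
    simp only [split_bG, map_mul, map_add, map_sub, map_smul, unsplit_inWeyl, unsplit_inUTau,
      weylToUBar_T, weylToUBar_euler, weylToUBar_gen, uTauToUBar_uX, uTauToUBar_uY, weylImage, X, Y,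
      mul_add, mul_sub, mul_smul_comm, bXi_zero_mul_bXi_mul, mul_zero, hT, hXi,
      bT_mul_bT_neg_mul]
    module
  · change unsplit (split (bT m)) = bT m
    rw [split_bT, unsplit_inWeyl, weylToUBar_T]
  · change unsplit (split (bXi m)) = bXi m
    rw [split_bXi, map_mul, unsplit_inWeyl, unsplit_inWeyl, weylToUBar_T, weylToUBar_gen]
    exact (bT_bXi m 0).trans (by rw [add_zero])

theorem split_weylToUBar (a : Weyl) : split (weylToUBar a) = inWeyl a := by
  refine DFunLike.congr_fun (Weyl.hom_ext (f := split.comp weylToUBar) (g := inWeyl) fun g => ?_) a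
  change split (weylToUBar _) = _
  rw [weylToUBar_gen]
  cases g
  · exact (split_bT 1).trans (by rw [Weyl.T_one])
  · exact (split_bT (-1)).trans (by rw [Weyl.T_neg_one])
  · exact split_bXi_zero
  · change split (bT (-1) * bL 0) = _
    rw [map_mul, split_bT, split_bL_zero, ← map_mul, Weyl.euler, Weyl.T_neg_one, ← mul_assoc,
      Weyl.tInv_t, one_mul]
  · change split (bXi 0 * bL 0 - bG 0) = _
    rw [map_sub, map_mul, split_bXi_zero, split_bL_zero, split_bG_zero, sub_sub_cancel]

theorem split_uTauToUBar (u : SuperUEA Tau) : split (uTauToUBar u) = inUTau u := by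
  induction u using UTau_induction with
  | hX m => rw [uTauToUBar_uX, split_X]
  | hY m => rw [uTauToUBar_uY, split_Y]
  | hc c => simp only [AlgHom.commutes]
  | ha x y hx hy => simp only [map_add, hx, hy]
  | hm x y hx hy => simp only [map_mul, hx, hy]

/-- A homomorphism out of the graded tensor product is determined on the two factors, where `split`
undoes each inclusion into Ū. -/
theorem split_comp_unsplit : split.comp unsplit = AlgHom.id ℂ WeylTau := by
  refine GradedTensorProduct.algHom_ext _ _ (AlgHom.ext fun a => ?_) (AlgHom.ext fun u => ?_)
  · change split (unsplit (inWeyl a)) = inWeyl a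
    rw [unsplit_inWeyl, split_weylToUBar]
  · change split (unsplit (inUTau u)) = inUTau u
    rw [unsplit_inUTau, split_uTauToUBar]

/-- The isomorphism `Ū ≅ 𝒦 ⊗ U(𝒯)`. -/
def splitEquiv : UBar ≃ₐ[ℂ] WeylTau :=
  AlgEquiv.ofAlgHom split unsplit split_comp_unsplit unsplit_comp_split

/-! #### Compatibility with the gradings -/

theorem map_mem_parityPart {B C : Type} [Ring B] [Algebra ℂ B] [Ring C] [Algebra ℂ C]
    {σ : B →ₐ[ℂ] B} {τ : C →ₐ[ℂ] C} {f : B →ₐ[ℂ] C} (hf : ∀ b, τ (f b) = f (σ b)) {i : ZMod 2}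
    {b : B} (hb : b ∈ parityPart σ i) : f b ∈ parityPart τ i := by
  change τ (f b) = _
  rw [hf, show σ b = _ from hb, map_smul]

theorem exists_add_of_graded {B : Type} [Ring B] [Algebra ℂ B] (𝒜 : ZMod 2 → Submodule ℂ B)
    [GradedAlgebra 𝒜] (x : B) : ∃ y ∈ 𝒜 0, ∃ z ∈ 𝒜 1, y + z = x :=
  -- The supercommutator structure has the same homogeneous components, so its decomposition lemma
  -- can be reused.
  letI := LieSuperalgebra.ofGradedAlgebra 𝒜
  LieSuperalgebra.exists_add x

theorem tmul_mem_tensorPart {B C : Type} [Ring B] [Algebra ℂ B] [Ring C] [Algebra ℂ C]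
    (𝒜 : ZMod 2 → Submodule ℂ B) (ℬ : ZMod 2 → Submodule ℂ C) [GradedAlgebra 𝒜] [GradedAlgebra ℬ]
    {i j : ZMod 2} {a : B} {b : C} (ha : a ∈ 𝒜 i) (hb : b ∈ ℬ j) :
    GradedTensorProduct.tmul ℂ a b ∈ tensorPart 𝒜 ℬ (i + j) :=
  Submodule.subset_span ⟨i, j, rfl, a, ha, b, hb, rfl⟩

/-- Only spanning is needed: directness of the two components is never required, since in the
application disjointness is used on the side of Ū. -/
theorem tensorPart_sup {B C : Type} [Ring B] [Algebra ℂ B] [Ring C] [Algebra ℂ C]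
    (𝒜 : ZMod 2 → Submodule ℂ B) (ℬ : ZMod 2 → Submodule ℂ C) [GradedAlgebra 𝒜]
    [GradedAlgebra ℬ] : tensorPart 𝒜 ℬ 0 ⊔ tensorPart 𝒜 ℬ 1 = ⊤ := by
  rw [eq_top_iff]
  rintro z -
  obtain ⟨z, rfl⟩ := (GradedTensorProduct.of ℂ 𝒜 ℬ).surjective z
  induction z using TensorProduct.induction_on with
  | zero => rw [map_zero]; exact zero_mem _
  | add x y hx hy => rw [map_add]; exact add_mem hx hy
  | tmul a b =>
    obtain ⟨a0, ha0, a1, ha1, rfl⟩ := exists_add_of_graded 𝒜 a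
    obtain ⟨b0, hb0, b1, hb1, rfl⟩ := exists_add_of_graded ℬ b
    rw [TensorProduct.add_tmul, TensorProduct.tmul_add, TensorProduct.tmul_add, map_add, map_add,
      map_add]
    have h00 := tmul_mem_tensorPart 𝒜 ℬ ha0 hb0
    have h01 := tmul_mem_tensorPart 𝒜 ℬ ha0 hb1
    have h10 := tmul_mem_tensorPart 𝒜 ℬ ha1 hb0
    have h11 := tmul_mem_tensorPart 𝒜 ℬ ha1 hb1
    rw [add_zero] at h00 h10
    rw [zero_add] at h01
    rw [show (1 + 1 : ZMod 2) = 0 from rfl] at h11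
    exact add_mem (add_mem (Submodule.mem_sup_left h00) (Submodule.mem_sup_right h01))
      (add_mem (Submodule.mem_sup_right h10) (Submodule.mem_sup_left h11))

theorem unsplit_mem (k : ZMod 2) (z : WeylTau)
    (hz : z ∈ tensorPart Weyl.part (SuperUEA.part Tau) k) : unsplit z ∈ UBar.part k := by
  have h : tensorPart Weyl.part (SuperUEA.part Tau) k ≤
      (UBar.part k).comap unsplit.toLinearMap := by
    refine Submodule.span_le.2 ?_
    rintro _ ⟨i, j, rfl, a, ha, u, hu, rfl⟩
    change weylToUBar a * uTauToUBar u ∈ UBar.part (i + j)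
    exact SetLike.mul_mem_graded (map_mem_parityPart parityHom_weylToUBar ha)
      (map_mem_parityPart parityHom_uTauToUBar hu)
  exact h hz

/-- It is enough that the inverse map is even: a bijection carrying a spanning pair of components
into a disjoint pair also reflects membership. -/
theorem mem_part_iff_splitEquiv (i : ZMod 2) (u : UBar) : u ∈ UBar.part i ↔
    splitEquiv u ∈ tensorPart Weyl.part (SuperUEA.part Tau) i := by
  have h := mem_iff_of_isCompl (tensorPart_sup Weyl.part (SuperUEA.part Tau))
    (LieSuperalgebra.isCompl (L := UBar)).disjoint splitEquiv.symm.toLinearEquiv unsplit_mem i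
    (splitEquiv u)
  rw [h]
  exact (iff_of_eq (congrArg (· ∈ UBar.part i) (splitEquiv.symm_apply_apply u))).symm

end Ramond

end

theorem proposition3p2 :
    (∃ e : Ramond.UBar ≃ₐ[ℂ] (Ramond.Weyl.part ᵍ⊗[ℂ] SuperUEA.part Ramond.Tau),
      ∀ (i : ZMod 2) (u : Ramond.UBar), u ∈ Ramond.UBar.part i ↔
        e u ∈ tensorPart Ramond.Weyl.part (SuperUEA.part Ramond.Tau) i) ∧
    Nonempty (LieSuperEquiv Ramond.Tau Ramond.TMinusOne) :=
  ⟨⟨Ramond.splitEquiv, Ramond.mem_part_iff_splitEquiv⟩, ⟨Ramond.tauEquiv⟩⟩
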